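/- **Theorem (Mattei–Moussu, holonomy conjugacy).** Let $\lambda_1,\lambda_2\in\mathbb C^*$ with $\lambda_1/\lambda_2\in\mathbb R_-$, i.e. $\lambda_1/\lambda_2$ is a negative real number. For $i=1,2$ let $\mathcal F_i$ be the germ at $(0,0)\in\mathbb C^2$ of the holomorphic foliation defined by a vector field $$X_i=\lambda_1x\,(1+f_i(x,y))\,\frac{\partial}{\partial x}+\lambda_2y\,(1+g_i(x,y))\,\frac{\partial}{\partial y},$$ where $f_i,g_i$ are holomorphic near $(0,0)$ and $f_i(0,0)=g_i(0,0)=0$. Let $r_i>0$ be such that $f_i,g_i$ are holomorphic near every point $(x,0)$ with $|x|\le r_i$ and $1+f_i(x,0)\neq0$ there (every sufficiently small $r_i>0$ is such). Denote by $h_i$ the holonomy of $\mathcal F_i$ relative to the axis $\{y=0\}$: it is the germ at $0\in\mathbb C$ of the map $z\mapsto\gamma_z(2\pi)$, where $\theta\mapsto(r_ie^{i\theta},\gamma_z(\theta))$, $0\le\theta\le2\pi$, is the path with $\gamma_z(0)=z$ in the leaf of $\mathcal F_i$ through $(r_i,z)$ that lifts the loop $\theta\mapsto r_ie^{i\theta}$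 along the fibres of $(x,y)\mapsto x$. A germ $\phi$ of analytic diffeomorphism of $(\mathbb C^2,0)$ *conjugates* $\mathcal F_1,\mathcal F_2$ if $D\phi\cdot X_1=u\cdot(X_2\circ\phi)$ near the origin for some holomorphic function $u$ with $u(0,0)\ne0$. The germs $h_1,h_2$ are *analytically conjugate* if $\varphi\circ h_1=h_2\circ\varphi$ near $0$ for some germ $\varphi$ of analytic diffeomorphism of $(\mathbb C,0)$. Then: 1. There is a germ $\phi$ of analytic diffeomorphism of $(\mathbb C^2,0)$ that conjugates $\mathcal F_1,\mathcal F_2$ and maps the axis $\{y=0\}$ to itself if and only if $h_1$ and $h_2$ are analytically conjugate. 2. If $\lambda_1\neq-\lambda_2$, the condition on the axis can be dropped: there is a germ $\phi$ of analytic diffeomorphism of $(\mathbb C^2,0)$ that conjugates $\mathcal F_1,\mathcal F_2$ if and only if $h_1$ and $h_2$ are analytically conjugate. -/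

import Mathlib

open Filter Topology

noncomputable section

/-- A germ at `0 ∈ E` of an analytic diffeomorphism `(E, 0) → (E, 0)`: an analytic germ fixing
the origin which has a two-sided analytic inverse germ. -/
def IsGermDiffeo {E : Type*} [NormedAddCommGroup E] [NormedSpace ℂ E] (φ : E → E) : Prop :=
  AnalyticAt ℂ φ 0 ∧ φ 0 = 0 ∧
    ∃ ψ : E → E, AnalyticAt ℂ ψ 0 ∧ ψ 0 = 0 ∧
      (∀ᶠ p in 𝓝 (0 : E), ψ (φ p) = p) ∧ (∀ᶠ p in 𝓝 (0 : E), φ (ψ p) = p)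

/-- Two germs of self-maps of `(ℂ, 0)` are analytically conjugate: `φ ∘ h₁ = h₂ ∘ φ` near `0`
for a germ `φ` of analytic diffeomorphism of `(ℂ, 0)`. -/
def GermConjugate (h₁ h₂ : ℂ → ℂ) : Prop :=
  ∃ φ : ℂ → ℂ, IsGermDiffeo φ ∧ ∀ᶠ z in 𝓝 (0 : ℂ), φ (h₁ z) = h₂ (φ z)

/-- The data `(f, g)` of a vector field `l₁ x (1 + f) ∂/∂x + l₂ y (1 + g) ∂/∂y` near the origin of
`ℂ²`, with `f` and `g` holomorphic near the origin and vanishing there. It represents a germ of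
foliation; only the behaviour of `f`, `g` where they are analytic is ever used. -/
structure SiegelFoliation (l₁ l₂ : ℂ) where
  f : ℂ × ℂ → ℂ
  g : ℂ × ℂ → ℂ
  f_analytic : AnalyticAt ℂ f 0
  g_analytic : AnalyticAt ℂ g 0
  f_zero : f 0 = 0
  g_zero : g 0 = 0

namespace SiegelFoliation

variable {l₁ l₂ : ℂ}

/-- The vector field `l₁ x (1 + f) ∂/∂x + l₂ y (1 + g) ∂/∂y`. -/
def field (F : SiegelFoliation l₁ l₂) (p : ℂ × ℂ) : ℂ × ℂ :=
  (l₁ * p.1 * (1 + F.f p), l₂ * p.2 * (1 + F.g p))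

/-- The germ of analytic diffeomorphism `φ` of `(ℂ², 0)` conjugates the foliations: it carries the
vector field of `F₁` to that of `F₂` up to multiplication by a holomorphic unit. -/
def IsConjugacy (F₁ F₂ : SiegelFoliation l₁ l₂) (φ : ℂ × ℂ → ℂ × ℂ) : Prop :=
  IsGermDiffeo φ ∧
    ∃ u : ℂ × ℂ → ℂ, AnalyticAt ℂ u 0 ∧ u 0 ≠ 0 ∧
      ∀ᶠ p in 𝓝 (0 : ℂ × ℂ), fderiv ℂ φ p (F₁.field p) = u p • F₂.field (φ p)

/-- The punctured axis `{y = 0, 0 < |x| ≤ r}` lies in the domain of the foliation and is a piece of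
leaf, transverse to the vertical lines. Every sufficiently small `r > 0` has this property. -/
def AdmissibleRadius (F : SiegelFoliation l₁ l₂) (r : ℝ) : Prop :=
  0 < r ∧ ∀ x : ℂ, ‖x‖ ≤ r →
    AnalyticAt ℂ F.f (x, 0) ∧ AnalyticAt ℂ F.g (x, 0) ∧ 1 + F.f (x, 0) ≠ 0

/-- `θ ↦ (r e^{iθ}, γ θ)`, `0 ≤ θ ≤ 2π`, is the lift to a leaf of the loop `r e^{iθ}` of the axis
`{y = 0}` along the fibres of `(x, y) ↦ x`, starting at `(r, z)`: it solves
`dy/dθ = (dy/dx) (dx/dθ)` within the region where the foliation is holomorphic and transverse to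
the vertical lines. -/
def IsLift (F : SiegelFoliation l₁ l₂) (r : ℝ) (z : ℂ) (γ : ℝ → ℂ) : Prop :=
  γ 0 = z ∧ ∀ θ ∈ Set.Icc (0 : ℝ) (2 * Real.pi),
    AnalyticAt ℂ F.f (circleMap 0 r θ, γ θ) ∧ AnalyticAt ℂ F.g (circleMap 0 r θ, γ θ) ∧
    1 + F.f (circleMap 0 r θ, γ θ) ≠ 0 ∧
    HasDerivWithinAt γ
      ((F.field (circleMap 0 r θ, γ θ)).2 / (F.field (circleMap 0 r θ, γ θ)).1 *
        (circleMap 0 r θ * Complex.I))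
      (Set.Icc (0 : ℝ) (2 * Real.pi)) θ

open Classical in
/-- The holonomy of the foliation relative to the axis `{y = 0}`, on the transversal `{x = r}`
with coordinate `y`: the end point of the lift of the loop `r e^{iθ}` that starts at `(r, z)`. By
uniqueness of solutions the end point does not depend on the chosen lift; for admissible `r` the
lift exists for all `z` near `0` (the value `0` elsewhere is irrelevant for the germ). -/
def holonomy (F : SiegelFoliation l₁ l₂) (r : ℝ) (z : ℂ) : ℂ :=
  if h : ∃ γ : ℝ → ℂ, F.IsLift r z γ then h.choose (2 * Real.pi) else 0

end SiegelFoliation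

end

/-!
The proof works in the logarithmic coordinate `x = r e^s` near the separatrix `{y = 0}`. Write
`μ = l₂ / l₁ < 0`. The leaves are the solutions of `dy/ds = μ y F.slope (r e^s, y)`, a perturbation
of `dy/ds = μ y`, and they are sought in the form `y = L (s, z) = z e^{μ s} e^{w (s, z)}` with
`L (0, z) = z`; the parameter `z`, the trace of the leaf on the transversal `{x = r}`, is called the
label of the leaf. The equation for `w` is an integral equation along the segment from `0` to `s`.
Since `μ` is real and nonzero, the integral of `|z e^{μ σ}| |dσ|` along this segment is bounded by
the largest of `|z|` and `|z e^{μ s}|` (`norm_integral_le_of_exp_bound`), so the equation is a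
contraction, with bounds uniform in `Re s`, wherever these two quantities are small
(`exists_leaf_parametrization`). Since `μ < 0`, the factor `e^{μ s}` is large for `Re s < 0`: the
equation `y = L (s, z)` can be solved for the label `z = I (s, y)` for all `Re s < 0` and all `y` in
a fixed disc (`IsLeafParametrization.exists_label`). In other words, the leaves through the
transversal fill a neighbourhood of the origin outside of `{x = 0}`. Uniqueness for the differential
equation shows that the holonomy is `z ↦ L (2πi, z)` and that the label changes by the holonomy under
`s ↦ s + 2πi` (`SiegelFoliation.exists_isUniformization`).

If `φ` conjugates the holonomies, then `P (s, y) = L₂ (s, φ (I₁ (s, y)))` maps leaves to leaves and is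
`2πi`-periodic in `s`, so it is a function of `(x, y)` with `x ≠ 0`. It is bounded by a multiple of
`|y|`, whence it extends across `{x = 0}` by Riemann's theorem, and with a linear change of `x` it is a
conjugacy preserving the axis (`SiegelFoliation.exists_isConjugacy_of_germConjugate`).

Conversely, let `Φ` be a conjugacy with unit `u`. Comparing linear parts gives `u 0 = 1`, if `Φ`
preserves the axis `{y = 0}` or if `l₁ ≠ -l₂`; otherwise `Φ` could exchange the two separatrices. Then
`Φ` preserves both axes: along an axis, the transverse component `b` of `Φ` satisfies `x b' = c b` with
`c 0 = μ` or `μ⁻¹`, which is impossible for a nonzero holomorphic function vanishing at `0` because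
`c 0 < 0` is not its order of vanishing (`SiegelFoliation.eventually_snd_eq_zero`). Hence `Φ` lifts to
the logarithmic coordinates near a circle `‖x‖ = x₀`, and the label of the image under `Φ` of the leaf
with label `z`, being constant along the leaf, defines a germ `ψ`. Going once around the circle
replaces `z` and its image by their images under the holonomies, so that `ψ` conjugates them
(`SiegelFoliation.germConjugate_of_isGermDiffeo`).

Holomorphy in two variables is obtained from Osgood's lemma, which is proved here by writing a
Cauchy integral as a continuous functional applied to a product of holomorphic functions of one
variable with values in the Banach algebra of continuous functions on the circle.
-/

noncomputable section

open Metric Set MeasureTheory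

/-! ### Holomorphic functions of two variables -/

theorem exists_continuousMap_family {E X : Type*} [TopologicalSpace E] [TopologicalSpace X]
    {U : Set E} {f : E → X → ℂ}
    (hf : ContinuousOn (fun p : E × X => f p.1 p.2) (U ×ˢ univ)) :
    ∃ F : E → C(X, ℂ), (∀ y ∈ U, ∀ x, F y x = f y x) ∧ ContinuousOn F U := by
  classical
  have hc : Continuous (fun q : U × X => f q.1 q.2) :=
    hf.comp_continuous (f := fun q : U × X => ((q.1 : E), q.2)) (by fun_prop)
      (fun q => ⟨q.1.2, mem_univ _⟩)
  let G : U → C(X, ℂ) := fun y => ⟨fun x => f y x, hc.comp (Continuous.prodMk_right y)⟩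
  have hG : Continuous G := ContinuousMap.continuous_of_continuous_uncurry G hc
  refine ⟨fun y => if h : y ∈ U then G ⟨y, h⟩ else 0, fun y hy x => by simp [hy, G], ?_⟩
  rw [continuousOn_iff_continuous_domRestrict]
  convert hG using 1
  ext y x
  simp [G]

/-- A jointly continuous family of holomorphic functions of one variable, with a compact parameter
space, is a holomorphic function with values in the Banach space of continuous functions on the
parameter space: it is the Cauchy integral of its restriction to circles. -/
theorem exists_differentiableOn_continuousMap_family {X : Type*} [TopologicalSpace X]
    [CompactSpace X] {U : Set ℂ} (hU : IsOpen U) {f : ℂ → X → ℂ}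
    (hf : ContinuousOn (fun p : ℂ × X => f p.1 p.2) (U ×ˢ univ))
    (hd : ∀ x, DifferentiableOn ℂ (fun y => f y x) U) :
    ∃ F : ℂ → C(X, ℂ), (∀ y ∈ U, ∀ x, F y x = f y x) ∧ DifferentiableOn ℂ F U := by
  obtain ⟨F, hF, hFc⟩ := exists_continuousMap_family hf
  refine ⟨F, hF, fun y₀ hy₀ => DifferentiableAt.differentiableWithinAt ?_⟩
  obtain ⟨τ, hτ, hτU⟩ := nhds_basis_closedBall.mem_iff.1 (hU.mem_nhds hy₀)
  lift τ to NNReal using hτ.le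
  have hint : CircleIntegrable F y₀ τ :=
    (hFc.mono (sphere_subset_closedBall.trans hτU)).circleIntegrable τ.2
  have hps := (hasFPowerSeriesOn_cauchy_integral hint (by exact_mod_cast hτ)).analyticAt
  refine hps.differentiableAt.congr_of_eventuallyEq ?_
  filter_upwards [ball_mem_nhds y₀ hτ] with y hy
  ext x
  have hcomm := (ContinuousMap.evalCLM ℂ x : C(X, ℂ) →L[ℂ] ℂ).intervalIntegral_comp_comm
    (a := 0) (b := 2 * Real.pi) (μ := volume)
    (f := fun θ => deriv (circleMap y₀ τ) θ • (circleMap y₀ τ θ - y)⁻¹ • F (circleMap y₀ τ θ))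
    (by
      have h1 : ContinuousOn (fun z => (z - y)⁻¹ • F z) (sphere y₀ τ) := by
        refine ContinuousOn.smul (ContinuousOn.inv₀ (continuousOn_id.sub continuousOn_const) ?_)
          (hFc.mono (sphere_subset_closedBall.trans hτU))
        intro z hz h0
        change z - y = 0 at h0
        rw [sub_eq_zero] at h0
        rw [mem_sphere] at hz
        rw [mem_ball, ← h0, hz] at hy
        exact lt_irrefl _ hy
      exact (h1.circleIntegrable τ.2).out)
  have hdx : DifferentiableOn ℂ (fun y => f y x) (closedBall y₀ τ) := (hd x).mono hτU
  have hcauchy := hdx.circleIntegral_sub_inv_smul hy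
  have hfy : F y x = f y x := hF y (hτU (ball_subset_closedBall hy)) x
  have hrw : (∮ z in C(y₀, τ), (z - y)⁻¹ • F z) x = ∮ z in C(y₀, τ), (z - y)⁻¹ • f z x := by
    rw [circleIntegral, circleIntegral]
    refine Eq.trans hcomm.symm ?_
    refine intervalIntegral.integral_congr fun θ _ => ?_
    have := hF (circleMap y₀ τ θ)
      (hτU (sphere_subset_closedBall (circleMap_mem_sphere _ τ.2 θ))) x
    simp [this]
  rw [ContinuousMap.smul_apply, hrw, hcauchy, hfy, smul_smul, inv_mul_cancel₀, one_smul]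
  simp [Real.pi_ne_zero]

/-- The Cauchy integral over a circle, in the first variable, of a function which is continuous in
both variables and holomorphic in the second is holomorphic in both variables. -/
theorem analyticAt_cauchyIntegral {c : ℂ} {ρ : ℝ} (hρ : 0 < ρ) {Q : ℂ × ℂ → ℂ} {V : Set ℂ}
    (hV : IsOpen V)
    (hc : ContinuousOn Q (sphere c ρ ×ˢ V))
    (hd : ∀ ζ ∈ sphere c ρ, DifferentiableOn ℂ (fun y => Q (ζ, y)) V) {p : ℂ × ℂ}
    (hp : p ∈ ball c ρ ×ˢ V) :
    AnalyticAt ℂ (fun p : ℂ × ℂ => ∮ ζ in C(c, ρ), (ζ - p.1)⁻¹ • Q (ζ, p.2)) p := by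
  have : CompactSpace (sphere c ρ) := isCompact_iff_compactSpace.1 (isCompact_sphere c ρ)
  let X := sphere c ρ
  obtain ⟨F, hF, hFd⟩ := exists_differentiableOn_continuousMap_family (X := X) hV
    (f := fun y ζ => Q (ζ, y))
    (hc.comp (f := fun q : ℂ × X => ((q.2 : ℂ), q.1)) (by fun_prop) (fun q hq => ⟨q.2.2, hq.1⟩))
    (fun ζ => hd ζ ζ.2)
  -- integration over the circle is a continuous functional on `C(X, ℂ)`
  let γ : ℝ → X := fun θ => ⟨circleMap c ρ θ, circleMap_mem_sphere _ hρ.le θ⟩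
  have hγ : Continuous γ := Continuous.subtype_mk (continuous_circleMap c ρ) _
  let J : C(X, ℂ) →L[ℂ] ℂ := LinearMap.mkContinuous
    { toFun := fun b => ∫ θ in (0 : ℝ)..2 * Real.pi, deriv (circleMap c ρ) θ * b (γ θ)
      map_add' := fun a b => by
        simp only [ContinuousMap.add_apply, mul_add]
        refine intervalIntegral.integral_add ?_ ?_ <;>
        · apply Continuous.intervalIntegrable
          simp only [deriv_circleMap]
          fun_prop
      map_smul' := fun k b => by
        simp only [ContinuousMap.smul_apply, smul_eq_mul, RingHom.id_apply]
        rw [← intervalIntegral.integral_const_mul]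
        refine intervalIntegral.integral_congr fun θ _ => ?_
        ring }
    (ρ * (2 * Real.pi)) (fun b => by
      have := intervalIntegral.norm_integral_le_of_norm_le_const (a := 0) (b := 2 * Real.pi)
        (f := fun θ => deriv (circleMap c ρ) θ * b (γ θ)) (C := ρ * ‖b‖) (fun θ _ => by
          rw [norm_mul]
          refine mul_le_mul ?_ (b.norm_coe_le_norm _) (norm_nonneg _) hρ.le
          simp [abs_of_pos hρ])
      simp only [LinearMap.coe_mk, AddHom.coe_mk]
      refine this.trans (le_of_eq ?_)
      rw [sub_zero, abs_of_pos Real.two_pi_pos]; ring)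
  have hJ : ∀ b, J b = ∫ θ in (0 : ℝ)..2 * Real.pi, deriv (circleMap c ρ) θ * b (γ θ) := fun b => rfl
  let ι : C(X, ℂ) := ⟨fun ζ => (ζ : ℂ), by fun_prop⟩
  -- the kernel is the inverse of an affine function, in a Banach algebra
  let k : ℂ → C(X, ℂ) := fun x => Ring.inverse (ι - x • (1 : C(X, ℂ)))
  have hne : ∀ x ∈ ball c ρ, ∀ ζ : X, (ζ : ℂ) - x ≠ 0 := by
    intro x hx ζ h0
    have hz := ζ.2
    rw [mem_sphere, sub_eq_zero.1 h0] at hz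
    rw [mem_ball, hz] at hx
    exact lt_irrefl _ hx
  have hunit : ∀ x ∈ ball c ρ, ∃ u : (C(X, ℂ))ˣ, (u : C(X, ℂ)) = ι - x • (1 : C(X, ℂ)) ∧
      ∀ ζ, (↑u⁻¹ : C(X, ℂ)) ζ = ((ζ : ℂ) - x)⁻¹ := by
    intro x hx
    refine ⟨⟨ι - x • (1 : C(X, ℂ)), ⟨fun ζ => ((ζ : ℂ) - x)⁻¹,
      Continuous.inv₀ (by fun_prop) (hne x hx)⟩, ?_, ?_⟩, rfl, fun ζ => rfl⟩
    · ext ζ; simp [ι, hne x hx ζ]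
    · ext ζ; simp [ι, hne x hx ζ]
  have hk : ∀ x ∈ ball c ρ, ∀ ζ, k x ζ = ((ζ : ℂ) - x)⁻¹ := by
    intro x hx ζ
    obtain ⟨u, hu, hu'⟩ := hunit x hx
    simp only [k, ← hu, Ring.inverse_unit]
    exact hu' ζ
  have hkan : AnalyticAt ℂ k p.1 := by
    obtain ⟨u, hu, -⟩ := hunit p.1 hp.1
    have h1 : AnalyticAt ℂ (fun x : ℂ => ι - x • (1 : C(X, ℂ))) p.1 :=
      analyticAt_const.sub (analyticAt_id.smul analyticAt_const)
    have h2 := analyticAt_inverse (𝕜 := ℂ) u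
    rw [hu] at h2
    exact AnalyticAt.comp (g := Ring.inverse) (f := fun x : ℂ => ι - x • (1 : C(X, ℂ))) h2 h1
  have hFan : AnalyticAt ℂ F p.2 := hFd.analyticAt (hV.mem_nhds hp.2)
  have hall : AnalyticAt ℂ (fun q : ℂ × ℂ => J (k q.1 * F q.2)) p :=
    (J.analyticAt _).comp ((hkan.comp analyticAt_fst).mul (hFan.comp analyticAt_snd))
  refine hall.congr ?_
  filter_upwards [(isOpen_ball.prod hV).mem_nhds hp] with q hq
  rw [hJ, circleIntegral]
  refine intervalIntegral.integral_congr fun θ _ => ?_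
  have h1 := hk q.1 hq.1 (γ θ)
  have h2 := hF q.2 hq.2 (γ θ)
  simp only [ContinuousMap.mul_apply, h1, h2, smul_eq_mul, γ]

/-- **Osgood's lemma** in two variables: a continuous function which is holomorphic in each variable
separately is holomorphic. -/
theorem analyticOnNhd_of_continuousOn_of_separately {f : ℂ × ℂ → ℂ} {U : Set (ℂ × ℂ)}
    (hU : IsOpen U) (hc : ContinuousOn f U)
    (h1 : ∀ p ∈ U, DifferentiableAt ℂ (fun x => f (x, p.2)) p.1)
    (h2 : ∀ p ∈ U, DifferentiableAt ℂ (fun y => f (p.1, y)) p.2) :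
    AnalyticOnNhd ℂ f U := by
  intro p hp
  obtain ⟨ρ, hρ, hρU⟩ := nhds_basis_closedBall.mem_iff.1 (hU.mem_nhds hp)
  have hsub : closedBall p.1 ρ ×ˢ closedBall p.2 ρ ⊆ U := by
    rwa [closedBall_prod_same]
  have hk := analyticAt_cauchyIntegral (c := p.1) hρ (Q := f) (V := ball p.2 ρ) isOpen_ball
    (hc.mono ((Set.prod_mono sphere_subset_closedBall ball_subset_closedBall).trans hsub))
    (fun ζ hζ y hy => (h2 (ζ, y) (hsub ⟨sphere_subset_closedBall hζ,
      ball_subset_closedBall hy⟩)).differentiableWithinAt)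
    (p := p) ⟨mem_ball_self hρ, mem_ball_self hρ⟩
  refine ((analyticAt_const (v := (2 * Real.pi * Complex.I : ℂ)⁻¹)).smul hk).congr ?_
  filter_upwards [(isOpen_ball.prod isOpen_ball).mem_nhds
    (⟨mem_ball_self hρ, mem_ball_self hρ⟩ : p ∈ ball p.1 ρ ×ˢ ball p.2 ρ)] with q hq
  have hd : DifferentiableOn ℂ (fun x => f (x, q.2)) (closedBall p.1 ρ) := fun x hx =>
    (h1 (x, q.2) (hsub ⟨hx, ball_subset_closedBall hq.2⟩)).differentiableWithinAt
  have := hd.circleIntegral_sub_inv_smul hq.1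
  simp only [Pi.smul_apply', this]
  rw [smul_smul, inv_mul_cancel₀, one_smul]
  simp [Real.pi_ne_zero]

/-- The integral over `[0, 1]` of a jointly continuous family of holomorphic functions of two
variables is holomorphic. -/
theorem analyticOnNhd_integral {f : ℂ × ℂ → ℝ → ℂ} {U : Set (ℂ × ℂ)} (hU : IsOpen U)
    (hc : ContinuousOn (fun q : (ℂ × ℂ) × ℝ => f q.1 q.2) (U ×ˢ Icc 0 1))
    (hd : ∀ t ∈ Icc (0 : ℝ) 1, DifferentiableOn ℂ (fun p => f p t) U) :
    AnalyticOnNhd ℂ (fun p => ∫ t in (0 : ℝ)..1, f p t) U := by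
  let X := Icc (0 : ℝ) 1
  let γ : ℝ → X := projIcc 0 1 zero_le_one
  have hγ : Continuous γ := continuous_projIcc
  let J : C(X, ℂ) →L[ℂ] ℂ := LinearMap.mkContinuous
    { toFun := fun b => ∫ t in (0 : ℝ)..1, b (γ t)
      map_add' := fun a b => by
        simp only [ContinuousMap.add_apply]
        refine intervalIntegral.integral_add ?_ ?_ <;>
        · apply Continuous.intervalIntegrable
          fun_prop
      map_smul' := fun k b => by
        simp only [ContinuousMap.smul_apply, smul_eq_mul, RingHom.id_apply]
        rw [← intervalIntegral.integral_const_mul] }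
    1 (fun b => by
      have := intervalIntegral.norm_integral_le_of_norm_le_const (a := 0) (b := 1)
        (f := fun θ => b (γ θ)) (C := ‖b‖) (fun θ _ => b.norm_coe_le_norm _)
      simpa using this)
  have hJ : ∀ b : C(X, ℂ), ∀ p : ℂ × ℂ, (∀ t : X, b t = f p t) →
      J b = ∫ t in (0 : ℝ)..1, f p t := by
    intro b p h
    refine intervalIntegral.integral_congr fun t ht => ?_
    rw [uIcc_of_le zero_le_one] at ht
    simp only [h, γ, projIcc_of_mem zero_le_one ht]
  have hcX : ContinuousOn (fun q : (ℂ × ℂ) × X => f q.1 q.2) (U ×ˢ univ) :=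
    hc.comp (f := fun q : (ℂ × ℂ) × X => (q.1, (q.2 : ℝ))) (by fun_prop)
      (fun q hq => ⟨hq.1, q.2.2⟩)
  refine analyticOnNhd_of_continuousOn_of_separately hU ?_ ?_ ?_
  · obtain ⟨F, hF, hFc⟩ := exists_continuousMap_family (f := fun p (t : X) => f p t) hcX
    exact (J.continuous.comp_continuousOn hFc).congr fun p hp => (hJ _ _ (hF p hp)).symm
  · intro p hp
    have hV : IsOpen {x : ℂ | (x, p.2) ∈ U} := hU.preimage (by fun_prop)
    obtain ⟨F, hF, hFd⟩ := exists_differentiableOn_continuousMap_family (X := X) hV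
      (f := fun x t => f (x, p.2) t)
      (hcX.comp (f := fun q : ℂ × X => ((q.1, p.2), q.2)) (by fun_prop) (fun q hq => ⟨hq.1, hq.2⟩))
      (fun t => (hd t t.2).comp (by fun_prop) (fun x hx => hx))
    refine (J.differentiableAt.comp p.1 (hFd.differentiableAt
      (hV.mem_nhds hp))).congr_of_eventuallyEq ?_
    filter_upwards [hV.mem_nhds hp] with x hx
    exact (hJ _ _ (hF x hx)).symm
  · intro p hp
    have hV : IsOpen {y : ℂ | (p.1, y) ∈ U} := hU.preimage (by fun_prop)
    obtain ⟨F, hF, hFd⟩ := exists_differentiableOn_continuousMap_family (X := X) hV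
      (f := fun y t => f (p.1, y) t)
      (hcX.comp (f := fun q : ℂ × X => ((p.1, q.1), q.2)) (by fun_prop) (fun q hq => ⟨hq.1, hq.2⟩))
      (fun t => (hd t t.2).comp (by fun_prop) (fun x hx => hx))
    refine (J.differentiableAt.comp p.2 (hFd.differentiableAt
      (hV.mem_nhds hp))).congr_of_eventuallyEq ?_
    filter_upwards [hV.mem_nhds hp] with x hx
    exact (hJ _ _ (hF x hx)).symm

/-- A uniform limit of holomorphic functions of two variables is holomorphic. -/
theorem TendstoUniformlyOn.analyticOnNhd_prod {F : ℕ → ℂ × ℂ → ℂ} {f : ℂ × ℂ → ℂ}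
    {U : Set (ℂ × ℂ)} (hU : IsOpen U) (h : TendstoUniformlyOn F f atTop U)
    (hF : ∀ n, AnalyticOnNhd ℂ (F n) U) : AnalyticOnNhd ℂ f U := by
  refine analyticOnNhd_of_continuousOn_of_separately hU
    (h.continuousOn (Frequently.of_forall fun n => (hF n).continuousOn)) ?_ ?_
  · intro p hp
    have hV : IsOpen {x : ℂ | (x, p.2) ∈ U} := hU.preimage (by fun_prop)
    have h' := (h.comp fun x : ℂ => (x, p.2)).tendstoLocallyUniformlyOn
    exact (h'.differentiableOn (Eventually.of_forall fun n => (hF n).differentiableOn.comp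
      (by fun_prop) (fun x hx => hx)) hV).differentiableAt (hV.mem_nhds hp)
  · intro p hp
    have hV : IsOpen {y : ℂ | (p.1, y) ∈ U} := hU.preimage (by fun_prop)
    have h' := (h.comp fun y : ℂ => (p.1, y)).tendstoLocallyUniformlyOn
    exact (h'.differentiableOn (Eventually.of_forall fun n => (hF n).differentiableOn.comp
      (by fun_prop) (fun x hx => hx)) hV).differentiableAt (hV.mem_nhds hp)

/-- A contraction of the set of holomorphic functions on `U` bounded by `R` has a fixed point. -/
theorem exists_analyticOnNhd_fixedPoint {U : Set (ℂ × ℂ)} (hU : IsOpen U) {R : ℝ} (hR : 0 ≤ R)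
    (T : (ℂ × ℂ → ℂ) → ℂ × ℂ → ℂ)
    (hT : ∀ u, AnalyticOnNhd ℂ u U → (∀ p ∈ U, ‖u p‖ ≤ R) →
      AnalyticOnNhd ℂ (T u) U ∧ ∀ p ∈ U, ‖T u p‖ ≤ R)
    (hcontr : ∀ u v, AnalyticOnNhd ℂ u U → (∀ p ∈ U, ‖u p‖ ≤ R) → AnalyticOnNhd ℂ v U →
      (∀ p ∈ U, ‖v p‖ ≤ R) → ∀ d : ℝ, 0 ≤ d → (∀ p ∈ U, ‖u p - v p‖ ≤ d) →
      ∀ p ∈ U, ‖T u p - T v p‖ ≤ d / 2) :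
    ∃ w, AnalyticOnNhd ℂ w U ∧ (∀ p ∈ U, ‖w p‖ ≤ R) ∧ ∀ p ∈ U, T w p = w p := by
  let w : ℕ → ℂ × ℂ → ℂ := fun n => T^[n] 0
  have hwsucc : ∀ n, w (n + 1) = T (w n) := fun n => Function.iterate_succ_apply' T n 0
  have hw : ∀ n, AnalyticOnNhd ℂ (w n) U ∧ ∀ p ∈ U, ‖w n p‖ ≤ R := by
    intro n
    induction n with
    | zero => exact ⟨fun p _ => analyticAt_const, fun p _ => by simpa [w] using hR⟩
    | succ n ih => rw [hwsucc]; exact hT _ ih.1 ih.2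
  have hdist : ∀ n, ∀ p ∈ U, ‖w n p - w (n + 1) p‖ ≤ 2 * R / 2 ^ n := by
    intro n
    induction n with
    | zero =>
      intro p hp
      have h1 := (hw 0).2 p hp
      have h2 := (hw 1).2 p hp
      have := norm_sub_le (w 0 p) (w 1 p)
      simp only [pow_zero, div_one]
      linarith
    | succ n ih =>
      intro p hp
      have := hcontr _ _ (hw n).1 (hw n).2 (hw (n + 1)).1 (hw (n + 1)).2 _ (by positivity) ih p hp
      rw [hwsucc n, hwsucc (n + 1)]
      rw [hwsucc n] at this ⊢
      refine this.trans (le_of_eq ?_)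
      rw [pow_succ]; ring
  have hlim : ∀ p, ∃ l, p ∈ U → Tendsto (fun n => w n p) atTop (𝓝 l) := by
    intro p
    by_cases hp : p ∈ U
    · obtain ⟨l, hl⟩ := cauchySeq_tendsto_of_complete (cauchySeq_of_le_geometric_two
        (f := fun n => w n p) (C := 4 * R) (fun n => by
          rw [dist_eq_norm]; refine (hdist n p hp).trans (le_of_eq ?_); ring))
      exact ⟨l, fun _ => hl⟩
    · exact ⟨0, fun h => absurd h hp⟩
  choose l hl using hlim
  have hbound : ∀ n, ∀ p ∈ U, ‖w n p - l p‖ ≤ 4 * R / 2 ^ n := by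
    intro n p hp
    have := dist_le_of_le_geometric_two_of_tendsto (f := fun n => w n p) (C := 4 * R) (fun n => by
          rw [dist_eq_norm]; refine (hdist n p hp).trans (le_of_eq ?_); ring) (hl p hp) n
    rwa [dist_eq_norm] at this
  have hto0 : Tendsto (fun n : ℕ => 4 * R / 2 ^ n) atTop (𝓝 0) := by
    have := (tendsto_pow_atTop_nhds_zero_of_lt_one (r := (1 / 2 : ℝ)) (by norm_num)
      (by norm_num)).const_mul (4 * R)
    simpa [div_eq_mul_inv] using this
  have hunif : TendstoUniformlyOn w l atTop U := by
    rw [Metric.tendstoUniformlyOn_iff]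
    intro ε hε
    filter_upwards [hto0.eventually (gt_mem_nhds hε)] with n hn p hp
    rw [dist_comm, dist_eq_norm]
    exact (hbound n p hp).trans_lt hn
  have hlan := hunif.analyticOnNhd_prod hU fun n => (hw n).1
  have hlR : ∀ p ∈ U, ‖l p‖ ≤ R := fun p hp =>
    le_of_tendsto (hl p hp).norm (Eventually.of_forall fun n => (hw n).2 p hp)
  refine ⟨l, hlan, hlR, fun p hp => ?_⟩
  refine tendsto_nhds_unique (f := fun n => w (n + 1) p) (l := atTop) ?_
    ((tendsto_add_atTop_iff_nat 1).2 (hl p hp))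
  rw [tendsto_iff_norm_sub_tendsto_zero]
  refine squeeze_zero (fun n => norm_nonneg _) (fun n => ?_) (by simpa using hto0.div_const 2)
  rw [hwsucc]
  exact hcontr _ _ (hw n).1 (hw n).2 hlan hlR _ (by positivity) (hbound n) p hp

/-! ### Leaves over a logarithmic coordinate -/

theorem abs_mul_integral_exp_le {c : ℝ} (hc : c ≠ 0) (σ : ℝ) :
    |σ| * ∫ t in (0 : ℝ)..1, Real.exp (c * σ * t) ≤ |c|⁻¹ * max 1 (Real.exp (c * σ)) := by
  rcases eq_or_ne σ 0 with rfl | hσ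
  · simp
  have hcσ : c * σ ≠ 0 := mul_ne_zero hc hσ
  have h1 : ∫ t in (0 : ℝ)..1, Real.exp (c * σ * t) = (c * σ)⁻¹ * (Real.exp (c * σ) - 1) := by
    rw [intervalIntegral.integral_comp_mul_left (fun t => Real.exp t) hcσ]
    simp
  have h0 : 0 ≤ ∫ t in (0 : ℝ)..1, Real.exp (c * σ * t) :=
    intervalIntegral.integral_nonneg zero_le_one fun t _ => (Real.exp_pos _).le
  rw [← abs_of_nonneg h0, h1, abs_mul, abs_inv, abs_mul, mul_inv, ← mul_assoc, mul_comm |c|⁻¹,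
    ← mul_assoc, mul_inv_cancel₀ (abs_ne_zero.2 hσ), one_mul]
  gcongr
  rw [abs_le]
  constructor
  · have := le_max_left 1 (Real.exp (c * σ))
    have := Real.exp_pos (c * σ)
    linarith
  · have := le_max_right 1 (Real.exp (c * σ))
    linarith

/-- The integral of `|dσ| e^{c Re σ}` over the segment from `0` to `s` is bounded in terms of the
values of the integrand at the end points, uniformly in `Re s`. This is what makes the leaves
controllable arbitrarily close to the other separatrix, where `Re s` tends to `-∞`. -/
theorem norm_integral_le_of_exp_bound {c B A : ℝ} (hc : c ≠ 0) (hA : 0 ≤ A) {s : ℂ}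
    (hs : |s.im| ≤ B) {f : ℝ → ℂ}
    (hf : ∀ t ∈ Icc (0 : ℝ) 1, ‖f t‖ ≤ A * (‖s‖ * Real.exp (c * s.re * t))) :
    ‖∫ t in (0 : ℝ)..1, f t‖ ≤ A * ((B + |c|⁻¹) * max 1 (Real.exp (c * s.re))) := by
  have hint : ∀ K : ℝ, IntervalIntegrable (fun t => K * Real.exp (c * s.re * t)) volume 0 1 :=
    fun K => Continuous.intervalIntegrable (by fun_prop) _ _
  have h1 : ‖∫ t in (0 : ℝ)..1, f t‖ ≤ ∫ t in (0 : ℝ)..1, A * ‖s‖ * Real.exp (c * s.re * t) :=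
    intervalIntegral.norm_integral_le_of_norm_le zero_le_one
      (ae_of_all _ fun t ht => (hf t (Ioc_subset_Icc_self ht)).trans_eq (mul_assoc _ _ _).symm)
      (hint _)
  refine h1.trans ?_
  rw [intervalIntegral.integral_const_mul, mul_assoc]
  refine mul_le_mul_of_nonneg_left ?_ hA
  set I := ∫ t in (0 : ℝ)..1, Real.exp (c * s.re * t) with hI
  have hIm : I ≤ max 1 (Real.exp (c * s.re)) := by
    have h := intervalIntegral.norm_integral_le_of_norm_le_const (a := 0) (b := 1)
      (f := fun t => Real.exp (c * s.re * t)) (C := max 1 (Real.exp (c * s.re))) (fun t ht => by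
        rw [uIoc_of_le zero_le_one] at ht
        rw [Real.norm_eq_abs, abs_of_pos (Real.exp_pos _)]
        rcases le_total 0 (c * s.re) with h | h
        · exact le_max_of_le_right (Real.exp_le_exp.2 (by nlinarith [ht.1, ht.2]))
        · refine le_max_of_le_left (Real.exp_le_one_iff.2 ?_)
          nlinarith [ht.1, ht.2])
    simp only [sub_zero, abs_one, mul_one] at h
    exact (le_abs_self _).trans h
  have hI0 : 0 ≤ I :=
    intervalIntegral.integral_nonneg zero_le_one fun t _ => (Real.exp_pos _).le
  have hns : ‖s‖ ≤ |s.re| + |s.im| := Complex.norm_le_abs_re_add_abs_im s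
  calc ‖s‖ * I ≤ (|s.re| + |s.im|) * I := by gcongr
    _ = |s.im| * I + |s.re| * I := by ring
    _ ≤ B * max 1 (Real.exp (c * s.re)) + |c|⁻¹ * max 1 (Real.exp (c * s.re)) := by
        refine add_le_add ?_ (abs_mul_integral_exp_le hc _)
        exact mul_le_mul hs hIm hI0 ((abs_nonneg _).trans hs)
    _ = _ := by ring

theorem norm_exp_sub_exp_le_of_norm_le {R : ℝ} {u v : ℂ} (hu : ‖u‖ ≤ R) (hv : ‖v‖ ≤ R) :
    ‖Complex.exp u - Complex.exp v‖ ≤ Real.exp R * ‖u - v‖ := by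
  refine (convex_closedBall (0 : ℂ) R).norm_image_sub_le_of_norm_deriv_le (f := Complex.exp)
    (fun x _ => Complex.differentiableAt_exp) (fun x hx => ?_) (by simpa using hv) (by simpa using hu)
  rw [Complex.deriv_exp]
  exact (Complex.norm_exp_le_exp_norm x).trans (Real.exp_le_exp.2 (by simpa using hx))

/-- The region of pairs `(s, z)` where the leaf with label `z` is followed up to the logarithmic
time `s`: the leaf is compared with the leaf `s ↦ z e^{μ s}` of the linear foliation, and both
`z` and `z e^{μ s}` are required to be smaller than `ε`. The region is stable under
`(s, z) ↦ (t s, z)` for `0 ≤ t ≤ 1`. -/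
def leafDomain (μ δ B ε : ℝ) : Set (ℂ × ℂ) :=
  {p | p.1.re < δ ∧ |p.1.im| < B ∧ ‖p.2‖ < ε ∧ ‖p.2‖ * Real.exp (μ * p.1.re) < ε}

/-- The function `(s, z) ↦ z e^{μ s} e^{w (s, z)}`: for the right `w`, its value is the point above
the logarithmic time `s` of the leaf with label `z`. -/
def leafMap (μ : ℝ) (w : ℂ × ℂ → ℂ) (p : ℂ × ℂ) : ℂ :=
  p.2 * Complex.exp (μ * p.1) * Complex.exp (w p)

theorem isOpen_leafDomain (μ δ B ε : ℝ) : IsOpen (leafDomain μ δ B ε) := by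
  have h1 : IsOpen {p : ℂ × ℂ | p.1.re < δ} := isOpen_lt (by fun_prop) (by fun_prop)
  have h2 : IsOpen {p : ℂ × ℂ | |p.1.im| < B} := isOpen_lt (by fun_prop) (by fun_prop)
  have h3 : IsOpen {p : ℂ × ℂ | ‖p.2‖ < ε} := isOpen_lt (by fun_prop) (by fun_prop)
  have h4 : IsOpen {p : ℂ × ℂ | ‖p.2‖ * Real.exp (μ * p.1.re) < ε} :=
    isOpen_lt (by fun_prop) (by fun_prop)
  exact h1.inter (h2.inter (h3.inter h4))

theorem norm_exp_ofReal_mul (μ : ℝ) (s : ℂ) : ‖Complex.exp (μ * s)‖ = Real.exp (μ * s.re) := by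
  rw [Complex.norm_exp]; simp

theorem mul_exp_lt_of_segment {μ ε ζ σ t : ℝ} (hζ : 0 ≤ ζ) (h0 : ζ < ε)
    (h1 : ζ * Real.exp (μ * σ) < ε) (ht : t ∈ Icc (0 : ℝ) 1) :
    ζ * Real.exp (μ * (t * σ)) < ε := by
  rcases le_total 0 (μ * σ) with h | h
  · refine lt_of_le_of_lt ?_ h1
    gcongr ζ * Real.exp ?_
    nlinarith [ht.1, ht.2]
  · refine lt_of_le_of_lt ?_ h0
    have : Real.exp (μ * (t * σ)) ≤ 1 := Real.exp_le_one_iff.2 (by nlinarith [ht.1, ht.2])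
    nlinarith

theorem ofReal_mul_mem_leafDomain {μ δ B ε : ℝ} (hδ : 0 < δ) {p : ℂ × ℂ}
    (hp : p ∈ leafDomain μ δ B ε) {t : ℝ} (ht : t ∈ Icc (0 : ℝ) 1) :
    ((t : ℂ) * p.1, p.2) ∈ leafDomain μ δ B ε := by
  obtain ⟨h1, h2, h3, h4⟩ := hp
  refine ⟨?_, ?_, h3, ?_⟩
  · simp only [Complex.re_ofReal_mul]
    rcases le_total 0 p.1.re with h | h
    · nlinarith [ht.1, ht.2]
    · exact (mul_nonpos_of_nonneg_of_nonpos ht.1 h).trans_lt hδ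
  · simp only [Complex.im_ofReal_mul, abs_mul, abs_of_nonneg ht.1]
    nlinarith [ht.1, ht.2, abs_nonneg p.1.im]
  · simp only [Complex.re_ofReal_mul]
    exact mul_exp_lt_of_segment (norm_nonneg _) h3 h4 ht

theorem norm_leafMap (μ : ℝ) (w : ℂ × ℂ → ℂ) (p : ℂ × ℂ) :
    ‖leafMap μ w p‖ = ‖p.2‖ * Real.exp (μ * p.1.re) * ‖Complex.exp (w p)‖ := by
  rw [leafMap, norm_mul, norm_mul, norm_exp_ofReal_mul]

theorem norm_leafMap_le {μ R : ℝ} {w : ℂ × ℂ → ℂ} {p : ℂ × ℂ} (hw : ‖w p‖ ≤ R) :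
    ‖leafMap μ w p‖ ≤ ‖p.2‖ * Real.exp (μ * p.1.re) * Real.exp R := by
  rw [norm_leafMap]
  gcongr
  exact (Complex.norm_exp_le_exp_norm _).trans (Real.exp_le_exp.2 hw)

theorem le_norm_leafMap {μ R : ℝ} {w : ℂ × ℂ → ℂ} {p : ℂ × ℂ} (hw : ‖w p‖ ≤ R) :
    ‖p.2‖ * Real.exp (μ * p.1.re) * Real.exp (-R) ≤ ‖leafMap μ w p‖ := by
  rw [norm_leafMap, Complex.norm_exp]
  gcongr
  have := (abs_le.1 ((Complex.abs_re_le_norm (w p)).trans hw)).1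
  linarith

theorem analyticOnNhd_leafMap {μ : ℝ} {w : ℂ × ℂ → ℂ} {U : Set (ℂ × ℂ)}
    (hw : AnalyticOnNhd ℂ w U) : AnalyticOnNhd ℂ (leafMap μ w) U := by
  intro p hp
  have := hw p hp
  exact (analyticAt_snd.mul (analyticAt_const.mul analyticAt_fst).cexp).mul this.cexp

/-- The leaves of `∂/∂s + y (μ + a(s, y)) ∂/∂y` are graphs `y = z e^{μ s} e^{w (s, z)}` with `w`
bounded, as long as `z` and `z e^{μ s}` stay small. The integral equation for `w` is a contraction
because `∫ |z e^{μ σ}| |dσ|` is small along the segment from `0` to `s`. -/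
theorem exists_leaf_parametrization {μ δ B ε₀ C : ℝ} (hμ : μ ≠ 0) (hδ : 0 < δ) (hB : 0 < B)
    (hε₀ : 0 < ε₀) (hC : 0 ≤ C) {a : ℂ × ℂ → ℂ}
    (ha : AnalyticOnNhd ℂ a {p | p.1.re < δ ∧ ‖p.2‖ < ε₀})
    (ha0 : ∀ s : ℂ, s.re < δ → ‖a (s, 0)‖ ≤ C * Real.exp s.re)
    (haL : ∀ s : ℂ, s.re < δ → ∀ y y' : ℂ, ‖y‖ < ε₀ → ‖y'‖ < ε₀ →
      ‖a (s, y) - a (s, y')‖ ≤ C * ‖y - y'‖) :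
    ∃ ε > 0, ∃ R ≥ 0, ε * Real.exp R ≤ ε₀ ∧ ∃ w : ℂ × ℂ → ℂ,
      AnalyticOnNhd ℂ w (leafDomain μ δ B ε) ∧ (∀ p ∈ leafDomain μ δ B ε, ‖w p‖ ≤ R) ∧
      ∀ p ∈ leafDomain μ δ B ε,
        w p = ∫ t in (0 : ℝ)..1, p.1 * a (t * p.1, leafMap μ w (t * p.1, p.2)) := by
  set R := C * ((B + 1) * Real.exp δ) + 1 with hRdef
  have hR : 0 ≤ R := by positivity
  set N := B + |μ|⁻¹ with hN
  have hN0 : 0 < N := by positivity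
  set D := C * Real.exp R * N with hD
  have hD0 : 0 ≤ D := by positivity
  set ε := min (ε₀ / Real.exp R) (1 / (2 * (D + 1))) with hεdef
  have hε : 0 < ε := by positivity
  have hεR : ε * Real.exp R ≤ ε₀ := by
    rw [← le_div_iff₀ (Real.exp_pos _)]; exact min_le_left _ _
  have hεD : D * ε ≤ 1 / 2 := by
    have h1 : ε ≤ 1 / (2 * (D + 1)) := min_le_right _ _
    calc D * ε ≤ D * (1 / (2 * (D + 1))) := by gcongr
      _ ≤ 1 / 2 := by
        rw [mul_one_div, div_le_div_iff₀ (by positivity) (by norm_num)]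
        linarith
  set Ω := leafDomain μ δ B ε with hΩ
  have hΩo : IsOpen Ω := isOpen_leafDomain _ _ _ _
  have hmax : ∀ p ∈ Ω, ‖p.2‖ * max 1 (Real.exp (μ * p.1.re)) ≤ ε := by
    intro p hp
    rw [mul_max_of_nonneg _ _ (norm_nonneg _), mul_one]
    exact max_le hp.2.2.1.le hp.2.2.2.le
  have hY : ∀ u : ℂ × ℂ → ℂ, (∀ p ∈ Ω, ‖u p‖ ≤ R) → ∀ p ∈ Ω, ‖leafMap μ u p‖ < ε₀ := by
    intro u hu p hp
    refine (norm_leafMap_le (hu p hp)).trans_lt (lt_of_lt_of_le ?_ hεR)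
    exact mul_lt_mul_of_pos_right hp.2.2.2 (Real.exp_pos _)
  refine ⟨ε, hε, R, hR, hεR, ?_⟩
  let T : (ℂ × ℂ → ℂ) → ℂ × ℂ → ℂ := fun w p =>
    ∫ t in (0 : ℝ)..1, p.1 * a (t * p.1, leafMap μ w (t * p.1, p.2))
  have hmaps : MapsTo (fun q : (ℂ × ℂ) × ℝ => ((q.2 : ℂ) * q.1.1, q.1.2)) (Ω ×ˢ Icc 0 1) Ω :=
    fun q hq => ofReal_mul_mem_leafDomain hδ hq.1 hq.2
  have hb : ∀ u, AnalyticOnNhd ℂ u Ω → (∀ p ∈ Ω, ‖u p‖ ≤ R) →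
      AnalyticOnNhd ℂ (fun p => a (p.1, leafMap μ u p)) Ω := by
    intro u hu huR p hp
    exact (ha (p.1, leafMap μ u p) ⟨hp.1, hY u huR p hp⟩).comp
      (f := fun p : ℂ × ℂ => (p.1, leafMap μ u p))
      (analyticAt_fst.prod (analyticOnNhd_leafMap hu p hp))
  have hTan : ∀ u, AnalyticOnNhd ℂ u Ω → (∀ p ∈ Ω, ‖u p‖ ≤ R) → AnalyticOnNhd ℂ (T u) Ω := by
    intro u hu huR
    refine analyticOnNhd_integral hΩo ?_ ?_
    · refine ContinuousOn.mul (by fun_prop) ?_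
      exact (hb u hu huR).continuousOn.comp (by fun_prop) hmaps
    · intro t ht
      refine DifferentiableOn.mul (by fun_prop) ?_
      exact (hb u hu huR).differentiableOn.comp (f := fun p : ℂ × ℂ => ((t : ℂ) * p.1, p.2))
        (by fun_prop) fun p hp => ofReal_mul_mem_leafDomain hδ hp ht
  have hbint : ∀ u, AnalyticOnNhd ℂ u Ω → (∀ p ∈ Ω, ‖u p‖ ≤ R) → ∀ p ∈ Ω,
      IntervalIntegrable (fun t : ℝ => p.1 * a (t * p.1, leafMap μ u (t * p.1, p.2)))
        volume 0 1 := by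
    intro u hu huR p hp
    refine ContinuousOn.intervalIntegrable ?_
    rw [uIcc_of_le zero_le_one]
    refine ContinuousOn.mul (by fun_prop) ?_
    exact (hb u hu huR).continuousOn.comp (f := fun t : ℝ => ((t : ℂ) * p.1, p.2))
      (by fun_prop) fun t ht => ofReal_mul_mem_leafDomain hδ hp ht
  suffices h : ∃ w, AnalyticOnNhd ℂ w Ω ∧ (∀ p ∈ Ω, ‖w p‖ ≤ R) ∧ ∀ p ∈ Ω, T w p = w p by
    obtain ⟨w, hw, hwR, hwT⟩ := h
    exact ⟨w, hw, hwR, fun p hp => (hwT p hp).symm⟩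
  refine exists_analyticOnNhd_fixedPoint hΩo hR T ?_ ?_
  · intro u hu huR
    refine ⟨hTan u hu huR, fun p hp => ?_⟩
    have h0int : IntervalIntegrable (fun t : ℝ => p.1 * a (t * p.1, 0)) volume 0 1 := by
      refine ContinuousOn.intervalIntegrable ?_
      rw [uIcc_of_le zero_le_one]
      refine ContinuousOn.mul (by fun_prop) ?_
      exact ha.continuousOn.comp (f := fun t : ℝ => ((t : ℂ) * p.1, (0 : ℂ)))
        (by fun_prop) fun t ht => ⟨(ofReal_mul_mem_leafDomain hδ hp ht).1, by simpa using hε₀⟩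
    have hsplit : T u p = (∫ t in (0 : ℝ)..1, p.1 * a (t * p.1, 0)) +
        ∫ t in (0 : ℝ)..1, (p.1 * a (t * p.1, leafMap μ u (t * p.1, p.2))
          - p.1 * a (t * p.1, 0)) := by
      rw [intervalIntegral.integral_sub (hbint u hu huR p hp) h0int]
      simp [T]
    have h1 : ‖∫ t in (0 : ℝ)..1, p.1 * a (t * p.1, 0)‖ ≤ C * ((B + 1) * Real.exp δ) := by
      have := norm_integral_le_of_exp_bound (c := 1) one_ne_zero hC hp.2.1.le
        (f := fun t : ℝ => p.1 * a (t * p.1, 0)) (fun t ht => by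
          have := ha0 _ (ofReal_mul_mem_leafDomain hδ hp ht).1
          rw [norm_mul]
          calc ‖p.1‖ * ‖a (t * p.1, 0)‖ ≤ ‖p.1‖ * (C * Real.exp ((t : ℂ) * p.1).re) := by gcongr
            _ = C * (‖p.1‖ * Real.exp (1 * p.1.re * t)) := by
              rw [Complex.re_ofReal_mul, mul_comm t, one_mul]; ring)
      refine this.trans ?_
      simp only [abs_one, inv_one, one_mul]
      gcongr
      exact max_le (Real.one_le_exp hδ.le) (Real.exp_le_exp.2 hp.1.le)
    have h2 : ‖∫ t in (0 : ℝ)..1, (p.1 * a (t * p.1, leafMap μ u (t * p.1, p.2))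
          - p.1 * a (t * p.1, 0))‖ ≤ D * ε := by
      have := norm_integral_le_of_exp_bound hμ (A := C * (Real.exp R * ‖p.2‖)) (by positivity)
        hp.2.1.le (f := fun t : ℝ => p.1 * a (t * p.1, leafMap μ u (t * p.1, p.2))
          - p.1 * a (t * p.1, 0)) (fun t ht => by
          have hm := ofReal_mul_mem_leafDomain hδ hp ht
          have h3 := haL _ hm.1 _ 0 (hY u huR _ hm) (by simpa using hε₀)
          have h4 := norm_leafMap_le (μ := μ) (huR _ hm)
          rw [sub_zero] at h3
          rw [← mul_sub, norm_mul]
          simp only [Complex.re_ofReal_mul] at h4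
          calc _ ≤ ‖p.1‖ * (C * (‖p.2‖ * Real.exp (μ * (t * p.1.re)) * Real.exp R)) := by
                gcongr; exact h3.trans (by gcongr)
            _ = C * (Real.exp R * ‖p.2‖) * (‖p.1‖ * Real.exp (μ * p.1.re * t)) := by
              rw [mul_comm t, ← mul_assoc μ]; ring)
      refine this.trans ?_
      calc _ = D * (‖p.2‖ * max 1 (Real.exp (μ * p.1.re))) := by rw [hD, hN]; ring
        _ ≤ D * ε := by gcongr; exact hmax p hp
    rw [hsplit]
    refine (norm_add_le _ _).trans ?_
    rw [hRdef]
    linarith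
  · intro u v hu huR hv hvR d hd huv p hp
    have hsub : T u p - T v p = ∫ t in (0 : ℝ)..1,
        (p.1 * a (t * p.1, leafMap μ u (t * p.1, p.2)) -
          p.1 * a (t * p.1, leafMap μ v (t * p.1, p.2))) :=
      (intervalIntegral.integral_sub (hbint u hu huR p hp) (hbint v hv hvR p hp)).symm
    rw [hsub]
    have := norm_integral_le_of_exp_bound hμ (A := C * (Real.exp R * ‖p.2‖ * d)) (by positivity)
      hp.2.1.le (f := fun t : ℝ => p.1 * a (t * p.1, leafMap μ u (t * p.1, p.2))
          - p.1 * a (t * p.1, leafMap μ v (t * p.1, p.2))) (fun t ht => by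
        have hm := ofReal_mul_mem_leafDomain hδ hp ht
        have h3 := haL _ hm.1 _ _ (hY u huR _ hm) (hY v hvR _ hm)
        have h4 := norm_exp_sub_exp_le_of_norm_le (huR _ hm) (hvR _ hm)
        have h5 : ‖leafMap μ u ((t : ℂ) * p.1, p.2) - leafMap μ v ((t : ℂ) * p.1, p.2)‖ ≤
            ‖p.2‖ * Real.exp (μ * (t * p.1.re)) * (Real.exp R * d) := by
          rw [leafMap, leafMap, ← mul_sub, norm_mul, norm_mul, norm_exp_ofReal_mul,
            Complex.re_ofReal_mul]
          gcongr
          exact h4.trans (by gcongr; exact huv _ hm)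
        rw [← mul_sub, norm_mul]
        calc _ ≤ ‖p.1‖ * (C * (‖p.2‖ * Real.exp (μ * (t * p.1.re)) * (Real.exp R * d))) := by
              gcongr; exact h3.trans (by gcongr)
          _ = C * (Real.exp R * ‖p.2‖ * d) * (‖p.1‖ * Real.exp (μ * p.1.re * t)) := by
            rw [mul_comm t, ← mul_assoc μ]; ring)
    refine this.trans ?_
    calc _ = D * (‖p.2‖ * max 1 (Real.exp (μ * p.1.re))) * d := by rw [hD, hN]; ring
      _ ≤ D * ε * d := by gcongr; exact hmax p hp
      _ ≤ 1 / 2 * d := by gcongr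
      _ = d / 2 := by ring

/-- A holomorphic function on a star-shaped domain which is the integral of `g` along the segments
from `0` is a primitive of `g`. Differentiating along the ray only gives the derivative for `s ≠ 0`;
the origin follows by continuity. -/
theorem hasDerivAt_of_eq_integral_ray {V : Set ℂ} (hV : IsOpen V) (h0 : (0 : ℂ) ∈ V)
    (hstar : ∀ s ∈ V, ∀ t ∈ Icc (0 : ℝ) 1, (t : ℂ) * s ∈ V) {g W : ℂ → ℂ}
    (hg : ContinuousOn g V) (hW : DifferentiableOn ℂ W V)
    (hWg : ∀ s ∈ V, W s = ∫ t in (0 : ℝ)..1, s * g (t * s)) :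
    ∀ s ∈ V, HasDerivAt W (g s) s := by
  have hne : ∀ s ∈ V, s ≠ 0 → deriv W s = g s := by
    intro s hs hs0
    have hray : Continuous (fun t : ℝ => (t : ℂ) * s) := by fun_prop
    have h1V : ((1 : ℝ) : ℂ) * s ∈ V := by simpa using hs
    have hd : HasDerivAt W (deriv W s) (((1 : ℝ) : ℂ) * s) := by
      rw [Complex.ofReal_one, one_mul]
      exact (hW.differentiableAt (hV.mem_nhds hs)).hasDerivAt
    have h1 : HasDerivAt (fun t : ℝ => W ((t : ℂ) * s)) (deriv W s * s) 1 := by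
      refine HasDerivAt.comp (1 : ℝ) (h₂ := W) (h := fun t : ℝ => (t : ℂ) * s) hd ?_
      simpa using (Complex.ofRealCLM.hasDerivAt (x := (1 : ℝ))).mul_const s
    have hnear : ∀ᶠ t : ℝ in 𝓝 1, (t : ℂ) * s ∈ V :=
      hray.continuousAt.eventually (hV.mem_nhds h1V)
    have hcg : ContinuousOn (fun t : ℝ => s * g (t * s)) {t : ℝ | (t : ℂ) * s ∈ V} :=
      continuousOn_const.mul (hg.comp hray.continuousOn fun t ht => ht)
    have hopen : IsOpen {t : ℝ | (t : ℂ) * s ∈ V} := hV.preimage hray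
    have h2 : HasDerivAt (fun t : ℝ => ∫ τ in (0 : ℝ)..t, s * g (τ * s)) (s * g ((1 : ℝ) * s)) 1 := by
      refine intervalIntegral.integral_hasDerivAt_right ?_ ?_ (hcg.continuousAt hnear)
      · refine (hcg.mono ?_).intervalIntegrable
        rw [uIcc_of_le zero_le_one]
        exact fun t ht => hstar s hs t ht
      · exact hcg.stronglyMeasurableAtFilter hopen _ h1V
    have h3 : HasDerivAt (fun t : ℝ => W ((t : ℂ) * s)) (s * g ((1 : ℝ) * s)) 1 := by
      refine h2.congr_of_eventuallyEq ?_
      filter_upwards [hnear] with t ht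
      rw [hWg _ ht]
      have := intervalIntegral.smul_integral_comp_mul_left (a := 0) (b := 1)
        (fun τ : ℝ => s * g (τ * s)) t
      rw [mul_zero, mul_one] at this
      rw [← this, ← intervalIntegral.integral_smul]
      refine intervalIntegral.integral_congr fun τ _ => ?_
      simp only [Complex.real_smul, Complex.ofReal_mul]
      rw [mul_left_comm (τ : ℂ) (t : ℂ) s, mul_assoc (t : ℂ) (τ : ℂ) s, mul_assoc, mul_left_comm (t : ℂ)]
    have h4 := h1.unique h3
    rw [mul_comm, Complex.ofReal_one, one_mul] at h4
    exact mul_left_cancel₀ hs0 h4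
  have hall : ∀ s ∈ V, deriv W s = g s := by
    intro s hs
    rcases eq_or_ne s 0 with rfl | hs0
    · have hc1 : ContinuousAt (deriv W) 0 := ((hW.deriv hV).differentiableAt
        (hV.mem_nhds h0)).continuousAt
      have hc2 : ContinuousAt g 0 := hg.continuousAt (hV.mem_nhds h0)
      refine tendsto_nhds_unique (l := 𝓝[≠] (0 : ℂ)) (hc1.tendsto.mono_left nhdsWithin_le_nhds)
        ((hc2.tendsto.mono_left nhdsWithin_le_nhds).congr' ?_)
      filter_upwards [self_mem_nhdsWithin, mem_nhdsWithin_of_mem_nhds (hV.mem_nhds h0)] with x hx hxV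
      exact (hne x hxV hx).symm
    · exact hne s hs hs0
  intro s hs
  rw [← hall s hs]
  exact (hW.differentiableAt (hV.mem_nhds hs)).hasDerivAt

/-- The function `w` parametrizes, by `y = z e^{μ s} e^{w (s, z)}`, the leaves of the vector field
`∂/∂s + y (μ + a (s, y)) ∂/∂y`, whose coefficient is `2πi`-periodic in `s`. -/
structure IsLeafParametrization (μ δ B ε₀ C ε R : ℝ) (a w : ℂ × ℂ → ℂ) : Prop where
  μ_neg : μ < 0
  δ_pos : 0 < δ
  lt_B : 2 * Real.pi < B
  ε_pos : 0 < ε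
  C_nonneg : 0 ≤ C
  R_nonneg : 0 ≤ R
  ε_le : ε * Real.exp R ≤ ε₀
  norm_a_le : ∀ s : ℂ, s.re < δ → ∀ y, ‖y‖ < ε₀ → ‖a (s, y)‖ ≤ C
  lipschitz_a : ∀ s : ℂ, s.re < δ → ∀ y y' : ℂ, ‖y‖ < ε₀ → ‖y'‖ < ε₀ →
      ‖a (s, y) - a (s, y')‖ ≤ C * ‖y - y'‖
  periodic_a : ∀ s y : ℂ, a (s + 2 * Real.pi * Complex.I, y) = a (s, y)
  analytic_w : AnalyticOnNhd ℂ w (leafDomain μ δ B ε)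
  norm_w_le : ∀ p ∈ leafDomain μ δ B ε, ‖w p‖ ≤ R
  w_zero : ∀ z : ℂ, w (0, z) = 0
  deriv_w : ∀ p ∈ leafDomain μ δ B ε,
    HasDerivAt (fun s => w (s, p.2)) (a (p.1, leafMap μ w p)) p.1

/-- The solution of the integral equation for `w` solves the differential equation of the leaves. -/
theorem exists_isLeafParametrization {μ δ B ε₀ C : ℝ} (hμ : μ < 0) (hδ : 0 < δ)
    (hB : 2 * Real.pi < B) (hε₀ : 0 < ε₀) (hC : 0 ≤ C) {a : ℂ × ℂ → ℂ}
    (ha : AnalyticOnNhd ℂ a {p | p.1.re < δ ∧ ‖p.2‖ < ε₀})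
    (ha0 : ∀ s : ℂ, s.re < δ → ‖a (s, 0)‖ ≤ C * Real.exp s.re)
    (haL : ∀ s : ℂ, s.re < δ → ∀ y y' : ℂ, ‖y‖ < ε₀ → ‖y'‖ < ε₀ →
      ‖a (s, y) - a (s, y')‖ ≤ C * ‖y - y'‖)
    (haP : ∀ s y : ℂ, a (s + 2 * Real.pi * Complex.I, y) = a (s, y)) :
    ∃ ε R w C', IsLeafParametrization μ δ B ε₀ C' ε R a w := by
  have hB0 : 0 < B := Real.two_pi_pos.trans hB
  obtain ⟨ε, hε, R, hR, hεR, w, hw, hwR, hwI⟩ :=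
    exists_leaf_parametrization (hμ.ne) hδ hB0 hε₀ hC ha ha0 haL
  set Ω := leafDomain μ δ B ε with hΩ
  have hY : ∀ p ∈ Ω, ‖leafMap μ w p‖ < ε₀ := by
    intro p hp
    refine (norm_leafMap_le (hwR p hp)).trans_lt (lt_of_lt_of_le ?_ hεR)
    exact mul_lt_mul_of_pos_right hp.2.2.2 (Real.exp_pos _)
  -- outside its domain `w` is normalized to vanish
  classical
  let w' : ℂ × ℂ → ℂ := fun p => if p ∈ Ω then w p else 0
  have hww : ∀ p ∈ Ω, w' p = w p := fun p hp => by simp [w', hp]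
  have hLL : ∀ p ∈ Ω, leafMap μ w' p = leafMap μ w p := fun p hp => by
    simp [leafMap, hww p hp]
  have hΩo : IsOpen Ω := isOpen_leafDomain _ _ _ _
  refine ⟨ε, R, w', C * (Real.exp δ + ε₀ + 1), hμ, hδ, hB, hε, by positivity, hR, hεR, ?_, ?_, haP,
    ?_, ?_, ?_, ?_⟩
  · intro s hs y hy
    have h1 := haL s hs y 0 hy (by simpa using hε₀)
    have h2 := norm_le_norm_add_norm_sub (a (s, 0)) (a (s, y))
    rw [norm_sub_rev, sub_zero] at h1
    have h3 := ha0 s hs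
    have h4 : Real.exp s.re ≤ Real.exp δ := Real.exp_le_exp.2 hs.le
    nlinarith
  · intro s hs y y' hy hy'
    refine (haL s hs y y' hy hy').trans ?_
    gcongr
    have := Real.exp_pos δ
    nlinarith
  · exact hw.congr hΩo fun p hp => (hww p hp).symm
  · intro p hp; rw [hww p hp]; exact hwR p hp
  · intro z
    by_cases hz : ((0 : ℂ), z) ∈ Ω
    · rw [hww _ hz, hwI _ hz]; simp
    · simp [w', hz]
  · intro p hp
    have hV : IsOpen {s : ℂ | (s, p.2) ∈ Ω} := hΩo.preimage (by fun_prop)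
    have hd := hasDerivAt_of_eq_integral_ray hV
      (by have := ofReal_mul_mem_leafDomain hδ hp (t := 0) ⟨le_rfl, zero_le_one⟩
          simpa using this)
      (fun s hs t ht => ofReal_mul_mem_leafDomain hδ (p := (s, p.2)) hs ht)
      (g := fun s => a (s, leafMap μ w (s, p.2))) (W := fun s => w (s, p.2)) ?_ ?_ ?_ p.1 hp
    · rw [hLL p hp]
      refine hd.congr_of_eventuallyEq ?_
      filter_upwards [hV.mem_nhds hp] with s hs
      exact hww _ hs
    · refine ha.continuousOn.comp (ContinuousOn.prodMk continuousOn_id ?_)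
        fun s hs => ⟨hs.1, hY _ hs⟩
      exact (analyticOnNhd_leafMap hw).continuousOn.comp (by fun_prop) fun s hs => hs
    · exact hw.differentiableOn.comp (by fun_prop) fun s hs => hs
    · intro s hs
      exact hwI (s, p.2) hs

/-- The region on which the label of the leaf through a point `(s, y)` is defined. -/
def labelDomain (B ε : ℝ) : Set (ℂ × ℂ) := {p | p.1.re < 0 ∧ |p.1.im| < B ∧ ‖p.2‖ < ε}

theorem isOpen_labelDomain (B ε : ℝ) : IsOpen (labelDomain B ε) := by
  have h1 : IsOpen {p : ℂ × ℂ | p.1.re < 0} := isOpen_lt (by fun_prop) (by fun_prop)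
  have h2 : IsOpen {p : ℂ × ℂ | |p.1.im| < B} := isOpen_lt (by fun_prop) (by fun_prop)
  have h3 : IsOpen {p : ℂ × ℂ | ‖p.2‖ < ε} := isOpen_lt (by fun_prop) (by fun_prop)
  exact h1.inter (h2.inter h3)

namespace IsLeafParametrization

variable {μ δ B ε₀ C ε R : ℝ} {a w : ℂ × ℂ → ℂ}

theorem norm_leafMap_lt (h : IsLeafParametrization μ δ B ε₀ C ε R a w) {p : ℂ × ℂ}
    (hp : p ∈ leafDomain μ δ B ε) : ‖leafMap μ w p‖ < ε₀ := by
  refine (norm_leafMap_le (h.norm_w_le p hp)).trans_lt (lt_of_lt_of_le ?_ h.ε_le)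
  exact mul_lt_mul_of_pos_right hp.2.2.2 (Real.exp_pos _)

theorem hasDerivAt_leafMap (h : IsLeafParametrization μ δ B ε₀ C ε R a w) {p : ℂ × ℂ}
    (hp : p ∈ leafDomain μ δ B ε) :
    HasDerivAt (fun s => leafMap μ w (s, p.2)) (leafMap μ w p * (μ + a (p.1, leafMap μ w p)))
      p.1 := by
  have h1 : HasDerivAt (fun s : ℂ => Complex.exp (μ * s)) (Complex.exp (μ * p.1) * μ) p.1 := by
    simpa using ((hasDerivAt_id p.1).const_mul (μ : ℂ)).cexp
  have h2 := (h.deriv_w p hp).cexp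
  have h3 := (h1.const_mul p.2).mul h2
  refine (h3.congr_deriv ?_)
  simp only [leafMap]
  ring

theorem lipschitz_field (h : IsLeafParametrization μ δ B ε₀ C ε R a w) {s y y' : ℂ}
    (hs : s.re < δ) (hy : ‖y‖ < ε₀) (hy' : ‖y'‖ < ε₀) :
    ‖y * (μ + a (s, y)) - y' * (μ + a (s, y'))‖ ≤ (|μ| + C + ε₀ * C) * ‖y - y'‖ := by
  have h1 : y * (μ + a (s, y)) - y' * (μ + a (s, y')) =
      (y - y') * (μ + a (s, y)) + y' * (a (s, y) - a (s, y')) := by ring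
  have hε₀ : 0 ≤ ε₀ := (norm_nonneg y).trans hy.le
  have h2 := h.norm_a_le s hs y hy
  have h3 := h.lipschitz_a s hs y y' hy hy'
  have h4 : ‖(μ : ℂ) + a (s, y)‖ ≤ |μ| + C := by
    refine (norm_add_le _ _).trans ?_
    rw [Complex.norm_real, Real.norm_eq_abs]
    linarith
  rw [h1]
  calc _ ≤ ‖y - y'‖ * (|μ| + C) + ε₀ * (C * ‖y - y'‖) := by
        refine (norm_add_le _ _).trans ?_
        rw [norm_mul, norm_mul]
        gcongr
    _ = _ := by ring

/-- Uniqueness of solutions of the leaf equation along a real path `t ↦ σ t` with velocity `κ`. -/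
theorem unique_along (h : IsLeafParametrization μ δ B ε₀ C ε R a w) {κ : ℂ} {σ : ℝ → ℂ}
    {t₀ t₁ : ℝ} (hσ : ∀ t ∈ Ico t₀ t₁, (σ t).re < δ) {p q : ℝ → ℂ}
    (hp : ContinuousOn p (Icc t₀ t₁)) (hq : ContinuousOn q (Icc t₀ t₁))
    (hp' : ∀ t ∈ Ico t₀ t₁, HasDerivWithinAt p (p t * (μ + a (σ t, p t)) * κ) (Ici t) t)
    (hq' : ∀ t ∈ Ico t₀ t₁, HasDerivWithinAt q (q t * (μ + a (σ t, q t)) * κ) (Ici t) t)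
    (hpb : ∀ t ∈ Ico t₀ t₁, ‖p t‖ < ε₀) (hqb : ∀ t ∈ Ico t₀ t₁, ‖q t‖ < ε₀)
    (h0 : p t₀ = q t₀) : EqOn p q (Icc t₀ t₁) := by
  have hC := h.C_nonneg
  have hε₀ : 0 ≤ ε₀ := le_trans (mul_nonneg h.ε_pos.le (Real.exp_pos R).le) h.ε_le
  refine ODE_solution_unique_of_mem_Icc_right
    (v := fun t y => y * (μ + a (σ t, y)) * κ) (s := fun _ => {y | ‖y‖ < ε₀})
    (K := Real.toNNReal ((|μ| + C + ε₀ * C) * ‖κ‖)) ?_ hp hp' hpb hq hq' hqb h0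
  intro t ht
  refine LipschitzOnWith.of_dist_le_mul fun y hy y' hy' => ?_
  rw [dist_eq_norm, dist_eq_norm, ← sub_mul, norm_mul,
    Real.coe_toNNReal _ (by positivity)]
  calc _ ≤ (|μ| + C + ε₀ * C) * ‖y - y'‖ * ‖κ‖ := by
        gcongr; exact h.lipschitz_field (hσ t ht) hy hy'
    _ = _ := by ring

theorem leafMap_zero (h : IsLeafParametrization μ δ B ε₀ C ε R a w) (z : ℂ) :
    leafMap μ w (0, z) = z := by
  simp [leafMap, h.w_zero z]

theorem two_pi_mem (h : IsLeafParametrization μ δ B ε₀ C ε R a w) {z : ℂ} (hz : ‖z‖ < ε) :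
    (2 * Real.pi * Complex.I, z) ∈ leafDomain μ δ B ε := by
  refine ⟨by simpa using h.δ_pos, ?_, hz, by simpa using hz⟩
  simp only [Complex.mul_im, Complex.mul_re, Complex.re_ofNat, Complex.ofReal_re, Complex.im_ofNat,
    Complex.ofReal_im, Complex.I_im, Complex.I_re]
  simp only [mul_zero, sub_zero, mul_one, zero_mul, add_zero]
  rw [abs_of_pos Real.two_pi_pos]
  exact h.lt_B

theorem norm_leafMap_two_pi_le (h : IsLeafParametrization μ δ B ε₀ C ε R a w) {z : ℂ}
    (hz : ‖z‖ < ε) : ‖leafMap μ w (2 * Real.pi * Complex.I, z)‖ ≤ ‖z‖ * Real.exp R := by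
  simpa using norm_leafMap_le (μ := μ) (h.norm_w_le _ (h.two_pi_mem hz))

/-- Following a leaf over the segment from `2πi` to `s + 2πi` amounts to following, over the segment
from `0` to `s`, the leaf whose label is the image under the holonomy. -/
theorem leafMap_add_two_pi (h : IsLeafParametrization μ δ B ε₀ C ε R a w) {s z : ℂ}
    (hs : s.re < δ) (hi : |s.im| < B) (hi' : |s.im + 2 * Real.pi| < B)
    (hz : ‖z‖ * Real.exp R < ε) (hz' : ‖z‖ * Real.exp R * Real.exp (μ * s.re) < ε) :
    leafMap μ w (s + 2 * Real.pi * Complex.I, z) =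
      leafMap μ w (s, leafMap μ w (2 * Real.pi * Complex.I, z)) := by
  have hexpR : 1 ≤ Real.exp R := Real.one_le_exp h.R_nonneg
  have hzε : ‖z‖ < ε := lt_of_le_of_lt (le_mul_of_one_le_right (norm_nonneg _) hexpR) hz
  set z' := leafMap μ w (2 * Real.pi * Complex.I, z) with hz'def
  have hz'n : ‖z'‖ ≤ ‖z‖ * Real.exp R := h.norm_leafMap_two_pi_le hzε
  have him : (2 * Real.pi * Complex.I : ℂ).im = 2 * Real.pi := by simp
  have hre : (2 * Real.pi * Complex.I : ℂ).re = 0 := by simp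
  have hzs : ‖z‖ * Real.exp (μ * s.re) < ε := by
    refine lt_of_le_of_lt ?_ hz'
    gcongr
    exact le_mul_of_one_le_right (norm_nonneg _) hexpR
  have hmem1 : ∀ t ∈ Icc (0 : ℝ) 1,
      ((t : ℂ) * s + 2 * Real.pi * Complex.I, z) ∈ leafDomain μ δ B ε := by
    intro t ht
    refine ⟨?_, ?_, hzε, ?_⟩
    · simp only [Complex.add_re, hre, add_zero, Complex.re_ofReal_mul]
      rcases le_total 0 s.re with h' | h'
      · nlinarith [ht.1, ht.2]
      · exact (mul_nonpos_of_nonneg_of_nonpos ht.1 h').trans_lt h.δ_pos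
    · simp only [Complex.add_im, him, Complex.im_ofReal_mul]
      have hB := h.lt_B
      have hpi := Real.pi_pos
      rw [abs_lt] at hi hi' ⊢
      constructor
      · nlinarith [ht.1, ht.2]
      · rcases ht.1.eq_or_lt with h0 | h0
        · rw [← h0]; linarith
        · nlinarith [mul_pos h0 (sub_pos.2 hi'.2),
            mul_nonneg (sub_nonneg.2 ht.2) (sub_nonneg.2 hB.le)]
    · simp only [Complex.add_re, hre, add_zero, Complex.re_ofReal_mul]
      exact mul_exp_lt_of_segment (norm_nonneg _) hzε hzs ht
  have hmem2 : ∀ t ∈ Icc (0 : ℝ) 1, ((t : ℂ) * s, z') ∈ leafDomain μ δ B ε := by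
    intro t ht
    refine ofReal_mul_mem_leafDomain h.δ_pos (p := (s, z')) ⟨hs, hi, hz'n.trans_lt hz, ?_⟩ ht
    refine lt_of_le_of_lt ?_ hz'
    gcongr
  have hder : ∀ t : ℝ, ∀ c : ℂ, HasDerivAt (fun t : ℝ => (t : ℂ) * s + c) s t := by
    intro t c
    simpa using ((Complex.ofRealCLM.hasDerivAt (x := t)).mul_const s).add_const c
  have hd1 : ∀ t ∈ Icc (0 : ℝ) 1, HasDerivAt
      (fun t : ℝ => leafMap μ w ((t : ℂ) * s + 2 * Real.pi * Complex.I, z))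
      (leafMap μ w ((t : ℂ) * s + 2 * Real.pi * Complex.I, z) *
        (μ + a ((t : ℂ) * s, leafMap μ w ((t : ℂ) * s + 2 * Real.pi * Complex.I, z))) * s) t := by
    intro t ht
    have := (h.hasDerivAt_leafMap (hmem1 t ht)).comp t (hder t _)
    simp only [h.periodic_a] at this
    exact this
  have hd2 : ∀ t ∈ Icc (0 : ℝ) 1, HasDerivAt (fun t : ℝ => leafMap μ w ((t : ℂ) * s, z'))
      (leafMap μ w ((t : ℂ) * s, z') * (μ + a ((t : ℂ) * s, leafMap μ w ((t : ℂ) * s, z'))) * s)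
      t := by
    intro t ht
    have hd := hder t 0
    simp only [add_zero] at hd
    exact (h.hasDerivAt_leafMap (hmem2 t ht)).comp t hd
  have key := h.unique_along (κ := s) (σ := fun t => (t : ℂ) * s) (t₀ := 0) (t₁ := 1)
    (fun t ht => (hmem2 t (Ico_subset_Icc_self ht)).1)
    (fun t ht => (hd1 t ht).continuousAt.continuousWithinAt)
    (fun t ht => (hd2 t ht).continuousAt.continuousWithinAt)
    (fun t ht => (hd1 t (Ico_subset_Icc_self ht)).hasDerivWithinAt)
    (fun t ht => (hd2 t (Ico_subset_Icc_self ht)).hasDerivWithinAt)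
    (fun t ht => h.norm_leafMap_lt (hmem1 t (Ico_subset_Icc_self ht)))
    (fun t ht => h.norm_leafMap_lt (hmem2 t (Ico_subset_Icc_self ht)))
    (by simp only [Complex.ofReal_zero, zero_mul, zero_add, h.leafMap_zero]; rfl)
  simpa using key ⟨zero_le_one, le_rfl⟩

/-- In terms of the scaled label `η = z e^{μ s}`, the domain of the leaves contains a disc which does
not depend on `s`. -/
theorem mem_leafDomain_of_scaled (h : IsLeafParametrization μ δ B ε₀ C ε R a w) {s η : ℂ}
    (hs : s.re < 0) (hi : |s.im| < B) (hη : ‖η‖ < ε) :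
    (s, η * Complex.exp (-(μ * s))) ∈ leafDomain μ δ B ε := by
  have h1 : ‖Complex.exp (-((μ : ℂ) * s))‖ = Real.exp (-(μ * s.re)) := by
    rw [Complex.norm_exp]; simp
  refine ⟨hs.trans h.δ_pos, hi, ?_, ?_⟩
  · rw [norm_mul, h1]
    have : Real.exp (-(μ * s.re)) ≤ 1 := Real.exp_le_one_iff.2 (by nlinarith [h.μ_neg])
    nlinarith [norm_nonneg η]
  · rw [norm_mul, h1, mul_assoc, ← Real.exp_add]
    simpa using hη

/-- Cauchy's estimate for the derivative of `w` with respect to the scaled label. -/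
theorem lipschitz_w (h : IsLeafParametrization μ δ B ε₀ C ε R a w) {s η η' : ℂ}
    (hs : s.re < 0) (hi : |s.im| < B) (hη : ‖η‖ ≤ ε / 4) (hη' : ‖η'‖ ≤ ε / 4) :
    ‖w (s, η * Complex.exp (-(μ * s))) - w (s, η' * Complex.exp (-(μ * s)))‖ ≤
      2 * R / ε * ‖η - η'‖ := by
  have hε := h.ε_pos
  set W : ℂ → ℂ := fun η => w (s, η * Complex.exp (-(μ * s))) with hW
  have hWd : DifferentiableOn ℂ W (ball 0 ε) := by
    refine h.analytic_w.differentiableOn.comp (by fun_prop) fun η hη => ?_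
    exact h.mem_leafDomain_of_scaled hs hi (by simpa using hη)
  refine (convex_closedBall (0 : ℂ) (ε / 4)).norm_image_sub_le_of_norm_deriv_le (f := W)
    (fun x hx => ?_) (fun x hx => ?_) (by simpa using hη') (by simpa using hη)
  · refine hWd.differentiableAt (isOpen_ball.mem_nhds ?_)
    exact closedBall_subset_ball (by linarith) hx
  · have hsub : closedBall x (ε / 2) ⊆ ball 0 ε := by
      refine closedBall_subset_ball' ?_
      have : dist x 0 ≤ ε / 4 := hx
      linarith
    have := Complex.norm_deriv_le_of_forall_mem_sphere_norm_le (c := x) (R := ε / 2) (C := R)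
      (f := W) (by positivity) ((hWd.mono hsub).diffContOnCl_ball subset_rfl)
      (fun z hz => h.norm_w_le _ (h.mem_leafDomain_of_scaled hs hi
        (by simpa using hsub (sphere_subset_closedBall hz))))
    refine this.trans (le_of_eq ?_)
    field_simp

/-- The label of the leaf through `(s, y)`, for `Re s < 0`: since the leaves move away from the axis as
`Re s` tends to `-∞`, the label is defined for all small `y`, uniformly in `s`. -/
theorem exists_label (h : IsLeafParametrization μ δ B ε₀ C ε R a w) :
    ∃ ε₁ > 0, ε₁ * Real.exp (2 * R) ≤ ε / 4 ∧ ∃ I : ℂ × ℂ → ℂ,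
      AnalyticOnNhd ℂ I (labelDomain B ε₁) ∧
      (∀ p ∈ labelDomain B ε₁, ‖I p‖ * Real.exp (μ * p.1.re) ≤ ε / 4) ∧
      (∀ p ∈ labelDomain B ε₁, leafMap μ w (p.1, I p) = p.2) ∧
      (∀ p ∈ labelDomain B ε₁, ∀ z : ℂ, ‖z‖ * Real.exp (μ * p.1.re) ≤ ε / 4 →
        leafMap μ w (p.1, z) = p.2 → I p = z) := by
  have hε := h.ε_pos
  have hR := h.R_nonneg
  set ε₁ := ε * Real.exp (-(2 * R)) / (4 * (R + 1)) with hε₁def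
  have hε₁ : 0 < ε₁ := by positivity
  have hε₁R : ε₁ * Real.exp (2 * R) = ε / (4 * (R + 1)) := by
    rw [hε₁def, div_mul_eq_mul_div, mul_assoc, ← Real.exp_add]; simp
  have hε₁R2 : ε₁ * Real.exp (2 * R) ≤ ε / 4 := by
    rw [hε₁R]; gcongr; linarith
  have hε₁R1 : ε₁ * Real.exp R ≤ ε / (4 * (R + 1)) := by
    rw [← hε₁R]; gcongr; linarith
  refine ⟨ε₁, hε₁, hε₁R2, ?_⟩
  set U := labelDomain B ε₁
  have hUo : IsOpen U := isOpen_labelDomain _ _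
  have hmem : ∀ p ∈ U, ∀ η : ℂ, ‖η‖ ≤ ε / 4 →
      (p.1, η * Complex.exp (-(μ * p.1))) ∈ leafDomain μ δ B ε := fun p hp η hη =>
    h.mem_leafDomain_of_scaled hp.1 hp.2.1 (by linarith)
  -- in terms of the scaled label `η`, the equation `L (s, z) = y` reads `η = y e^{-w}`
  let T : (ℂ × ℂ → ℂ) → ℂ × ℂ → ℂ := fun η p =>
    p.2 * Complex.exp (-w (p.1, η p * Complex.exp (-(μ * p.1))))
  have hcontr : ∀ p ∈ U, ∀ η η' : ℂ, ‖η‖ ≤ ε / 4 → ‖η'‖ ≤ ε / 4 →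
      ‖p.2 * Complex.exp (-w (p.1, η * Complex.exp (-(μ * p.1)))) -
        p.2 * Complex.exp (-w (p.1, η' * Complex.exp (-(μ * p.1))))‖ ≤ ‖η - η'‖ / 2 := by
    intro p hp η η' hη hη'
    rw [← mul_sub, norm_mul]
    have h1 := norm_exp_sub_exp_le_of_norm_le (R := R)
      (u := -w (p.1, η * Complex.exp (-(μ * p.1)))) (v := -w (p.1, η' * Complex.exp (-(μ * p.1))))
      (by rw [norm_neg]; exact h.norm_w_le _ (hmem p hp η hη))
      (by rw [norm_neg]; exact h.norm_w_le _ (hmem p hp η' hη'))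
    rw [neg_sub_neg, norm_sub_rev (w _)] at h1
    have h2 := h.lipschitz_w hp.1 hp.2.1 hη hη'
    calc _ ≤ ε₁ * (Real.exp R * (2 * R / ε * ‖η - η'‖)) := by
          gcongr
          · exact hp.2.2.le
          · exact h1.trans (by gcongr)
      _ = (ε₁ * Real.exp R) * (2 * R / ε) * ‖η - η'‖ := by ring
      _ ≤ (ε / (4 * (R + 1))) * (2 * R / ε) * ‖η - η'‖ := by gcongr
      _ = (R / (R + 1)) * (‖η - η'‖ / 2) := by field_simp; ring
      _ ≤ 1 * (‖η - η'‖ / 2) := by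
          gcongr
          rw [div_le_one (by positivity)]; linarith
      _ = _ := one_mul _
  have hfix : ∃ η, AnalyticOnNhd ℂ η U ∧ (∀ p ∈ U, ‖η p‖ ≤ ε / 4) ∧ ∀ p ∈ U, T η p = η p := by
    refine exists_analyticOnNhd_fixedPoint hUo (by positivity) T ?_ ?_
    · intro u hu huR
      refine ⟨fun p hp => ?_, fun p hp => ?_⟩
      · have hw := h.analytic_w _ (hmem p hp _ (huR p hp))
        have h1 : AnalyticAt ℂ (fun p : ℂ × ℂ => (p.1, u p * Complex.exp (-(μ * p.1)))) p :=
          analyticAt_fst.prod ((hu p hp).mul (analyticAt_const.mul analyticAt_fst).neg.cexp)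
        exact analyticAt_snd.mul (AnalyticAt.comp (g := w)
          (f := fun p : ℂ × ℂ => (p.1, u p * Complex.exp (-(μ * p.1)))) hw h1).neg.cexp
      · have hn : ‖-w (p.1, u p * Complex.exp (-(μ * p.1)))‖ ≤ R := by
          rw [norm_neg]; exact h.norm_w_le _ (hmem p hp _ (huR p hp))
        simp only [T]
        rw [norm_mul]
        calc _ ≤ ε₁ * Real.exp R := by
              gcongr
              · exact hp.2.2.le
              · exact (Complex.norm_exp_le_exp_norm _).trans (Real.exp_le_exp.2 hn)
          _ ≤ ε / (4 * (R + 1)) := hε₁R1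
          _ ≤ ε / 4 := by gcongr; linarith
    · intro u v hu huR hv hvR d hd huv p hp
      refine (hcontr p hp _ _ (huR p hp) (hvR p hp)).trans ?_
      have := huv p hp
      linarith
  obtain ⟨η, hη, hηR, hηT⟩ := hfix
  have hexp : ∀ s : ℂ, Complex.exp (-(μ * s)) * Complex.exp (μ * s) = 1 := by
    intro s; rw [← Complex.exp_add]; simp
  refine ⟨fun p => η p * Complex.exp (-(μ * p.1)), ?_, ?_, ?_, ?_⟩
  · exact fun p hp => (hη p hp).mul (analyticAt_const.mul analyticAt_fst).neg.cexp
  · intro p hp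
    rw [← norm_exp_ofReal_mul, ← norm_mul, mul_assoc, hexp, mul_one]
    exact hηR p hp
  · intro p hp
    have h1 : p.2 * Complex.exp (-w (p.1, η p * Complex.exp (-(μ * p.1)))) = η p := hηT p hp
    simp only [leafMap]
    rw [mul_assoc (η p), hexp, mul_one]
    nth_rewrite 1 [← h1]
    rw [mul_assoc, ← Complex.exp_add]
    simp
  · intro p hp z hz hzp
    set η' := z * Complex.exp (μ * p.1) with hη'
    have hη'n : ‖η'‖ ≤ ε / 4 := by rw [hη', norm_mul, norm_exp_ofReal_mul]; exact hz
    have hzη : η' * Complex.exp (-(μ * p.1)) = z := by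
      rw [hη', mul_assoc, mul_comm (Complex.exp _), hexp, mul_one]
    have h1 : p.2 * Complex.exp (-w (p.1, η p * Complex.exp (-(μ * p.1)))) = η p := hηT p hp
    have h2 : p.2 * Complex.exp (-w (p.1, η' * Complex.exp (-(μ * p.1)))) = η' := by
      rw [hzη, ← hzp, leafMap, mul_assoc, ← Complex.exp_add]
      simp [hη']
    have h3 := hcontr p hp _ _ (hηR p hp) hη'n
    rw [h1, h2] at h3
    have h4 : ‖η p - η'‖ = 0 := le_antisymm (by linarith [norm_nonneg (η p - η')]) (norm_nonneg _)
    rw [norm_eq_zero, sub_eq_zero] at h4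
    show η p * _ = z
    rw [h4, hzη]

end IsLeafParametrization

/-! ### The holonomy in the logarithmic coordinate -/

namespace SiegelFoliation

variable {l₁ l₂ : ℂ}

/-- The ratio `(1 + g) / (1 + f)`: along the leaves, `x dy = (l₂ / l₁) y F.slope dx`. -/
def slope (F : SiegelFoliation l₁ l₂) (p : ℂ × ℂ) : ℂ := (1 + F.g p) / (1 + F.f p)

/-- The set of points where the vector field is holomorphic, and transverse to the vertical lines
outside of the axis `{x = 0}`. -/
def regularSet (F : SiegelFoliation l₁ l₂) : Set (ℂ × ℂ) :=
  {p | AnalyticAt ℂ F.f p ∧ AnalyticAt ℂ F.g p ∧ 1 + F.f p ≠ 0}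

theorem isOpen_regularSet (F : SiegelFoliation l₁ l₂) : IsOpen F.regularSet := by
  rw [isOpen_iff_mem_nhds]
  rintro p ⟨h1, h2, h3⟩
  filter_upwards [h1.eventually_analyticAt, h2.eventually_analyticAt,
    (continuousAt_const.add h1.continuousAt).eventually_ne h3] with q a b c using ⟨a, b, c⟩

theorem analyticAt_slope (F : SiegelFoliation l₁ l₂) {p : ℂ × ℂ} (hp : p ∈ F.regularSet) :
    AnalyticAt ℂ F.slope p :=
  (analyticAt_const.add hp.2.1).div (analyticAt_const.add hp.1) hp.2.2

theorem slope_zero (F : SiegelFoliation l₁ l₂) : F.slope 0 = 1 := by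
  simp [slope, F.f_zero, F.g_zero]

theorem zero_mem_regularSet (F : SiegelFoliation l₁ l₂) : (0 : ℂ × ℂ) ∈ F.regularSet :=
  ⟨F.f_analytic, F.g_analytic, by simp [F.f_zero]⟩

/-- On a neighbourhood of the disc of radius `r` in the axis, the slope is Lipschitz. -/
theorem exists_polydisc (F : SiegelFoliation l₁ l₂) {r : ℝ} (hr : F.AdmissibleRadius r) :
    ∃ r' > r, ∃ ε₀ > 0, ∃ C ≥ 0, ball (0 : ℂ) r' ×ˢ ball (0 : ℂ) ε₀ ⊆ F.regularSet ∧
      ∀ p ∈ ball (0 : ℂ) r' ×ˢ ball (0 : ℂ) ε₀, ∀ q ∈ ball (0 : ℂ) r' ×ˢ ball (0 : ℂ) ε₀,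
        ‖F.slope p - F.slope q‖ ≤ C * ‖p - q‖ := by
  have hK : IsCompact (closedBall (0 : ℂ) r ×ˢ {(0 : ℂ)}) :=
    (isCompact_closedBall 0 r).prod isCompact_singleton
  have hKU : closedBall (0 : ℂ) r ×ˢ {(0 : ℂ)} ⊆ F.regularSet := by
    rintro ⟨x, y⟩ ⟨hx, hy⟩
    rw [mem_singleton_iff] at hy
    simp only at hx hy
    subst hy
    exact hr.2 x (by simpa using hx)
  obtain ⟨ρ, hρ, hρU⟩ := hK.exists_cthickening_subset_open F.isOpen_regularSet hKU
  have hsub : closedBall (0 : ℂ) (r + ρ) ×ˢ closedBall (0 : ℂ) ρ ⊆ F.regularSet := by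
    refine Subset.trans ?_ hρU
    rintro ⟨x, y⟩ ⟨hx, hy⟩
    have hr0 := hr.1
    have hx' : x ∈ cthickening ρ (closedBall (0 : ℂ) r) := by
      rw [cthickening_closedBall hρ.le hr0.le, add_comm]; exact hx
    rw [(isCompact_closedBall (0 : ℂ) r).cthickening_eq_biUnion_closedBall hρ.le] at hx'
    simp only [mem_iUnion] at hx'
    obtain ⟨x₀, hx₀, hxx₀⟩ := hx'
    refine mem_cthickening_of_dist_le (x, y) (x₀, 0) ρ _ ⟨hx₀, rfl⟩ ?_
    rw [Prod.dist_eq]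
    exact max_le hxx₀ hy
  have hcomp : IsCompact (closedBall (0 : ℂ) (r + ρ) ×ˢ closedBall (0 : ℂ) ρ) :=
    (isCompact_closedBall _ _).prod (isCompact_closedBall _ _)
  have hcont : ContinuousOn (fun p => ‖fderiv ℂ F.slope p‖)
      (closedBall (0 : ℂ) (r + ρ) ×ˢ closedBall (0 : ℂ) ρ) := fun p hp =>
    ((F.analyticAt_slope (hsub hp)).fderiv.continuousAt.norm).continuousWithinAt
  obtain ⟨C, hC⟩ := (hcomp.image_of_continuousOn hcont).bddAbove
  have hC' : ∀ p ∈ closedBall (0 : ℂ) (r + ρ) ×ˢ closedBall (0 : ℂ) ρ,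
      ‖fderiv ℂ F.slope p‖ ≤ C := fun p hp => hC (mem_image_of_mem _ hp)
  have hmono : ball (0 : ℂ) (r + ρ) ×ˢ ball (0 : ℂ) ρ ⊆
      closedBall (0 : ℂ) (r + ρ) ×ˢ closedBall (0 : ℂ) ρ :=
    Set.prod_mono ball_subset_closedBall ball_subset_closedBall
  refine ⟨r + ρ, by linarith, ρ, hρ, max C 0, le_max_right _ _, hmono.trans hsub, ?_⟩
  intro p hp q hq
  exact ((convex_ball (0 : ℂ) (r + ρ)).prod (convex_ball (0 : ℂ) ρ)).norm_image_sub_le_of_norm_fderiv_le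
    (𝕜 := ℂ) (fun x hx => (F.analyticAt_slope (hsub (hmono hx))).differentiableAt)
    (fun x hx => (hC' x (hmono hx)).trans (le_max_left _ _)) hq hp

/-- The deviation of the foliation, in the logarithmic coordinate `x = r e^s`, from the linear
foliation `dy / ds = μ y`. -/
def logDeviation (F : SiegelFoliation l₁ l₂) (μ r : ℝ) (p : ℂ × ℂ) : ℂ :=
  μ * (F.slope (r * Complex.exp p.1, p.2) - 1)

theorem exists_isLeafParametrization (F : SiegelFoliation l₁ l₂) {μ r B : ℝ}
    (hr : F.AdmissibleRadius r) (hμ : μ < 0) (hB : 2 * Real.pi < B) :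
    ∃ δ ε₀ C ε R w, IsLeafParametrization μ δ B ε₀ C ε R (F.logDeviation μ r) w ∧
      ∀ s y : ℂ, s.re < δ → ‖y‖ < ε₀ → (r * Complex.exp s, y) ∈ F.regularSet := by
  obtain ⟨r', hr', ε₀, hε₀, C, hC, hreg, hlip⟩ := F.exists_polydisc hr
  have hr0 := hr.1
  have hr'0 : 0 < r' := hr0.trans hr'
  -- `Re s < δ` is the condition `‖r e^s‖ < r'`
  set δ := Real.log (r' / r) with hδdef
  have hδ : 0 < δ := Real.log_pos ((one_lt_div hr0).2 hr')
  have hmem : ∀ s y : ℂ, s.re < δ → ‖y‖ < ε₀ →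
      ((r : ℂ) * Complex.exp s, y) ∈ ball (0 : ℂ) r' ×ˢ ball (0 : ℂ) ε₀ := by
    intro s y hs hy
    refine ⟨?_, by simpa using hy⟩
    rw [mem_ball_zero_iff, norm_mul, Complex.norm_exp, Complex.norm_real, Real.norm_eq_abs,
      abs_of_pos hr0]
    have : Real.exp s.re < r' / r := by
      rw [← Real.exp_log (show 0 < r' / r by positivity)]
      exact Real.exp_lt_exp.2 hs
    rwa [lt_div_iff₀ hr0, mul_comm] at this
  have h00 : (0 : ℂ × ℂ) ∈ ball (0 : ℂ) r' ×ˢ ball (0 : ℂ) ε₀ :=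
    ⟨mem_ball_self (hr0.trans hr'), mem_ball_self hε₀⟩
  have hL : ∀ s : ℂ, s.re < δ → ∀ y y' : ℂ, ‖y‖ < ε₀ → ‖y'‖ < ε₀ →
      ‖F.logDeviation μ r (s, y) - F.logDeviation μ r (s, y')‖ ≤ |μ| * C * ‖y - y'‖ := by
    intro s hs y y' hy hy'
    have h1 := hlip _ (hmem s y hs hy) _ (hmem s y' hs hy')
    have h2 : ‖(((r : ℂ) * Complex.exp s, y) : ℂ × ℂ) - ((r : ℂ) * Complex.exp s, y')‖
        = ‖y - y'‖ := by
      simp [Prod.norm_def]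
    rw [h2] at h1
    simp only [logDeviation]
    rw [← mul_sub, sub_sub_sub_cancel_right, norm_mul, Complex.norm_real, Real.norm_eq_abs,
      mul_assoc]
    gcongr
  suffices h : ∃ ε R w C', IsLeafParametrization μ δ B ε₀ C' ε R (F.logDeviation μ r) w by
    obtain ⟨ε, R, w, C', h⟩ := h
    exact ⟨δ, ε₀, C', ε, R, w, h, fun s y hs hy => hreg (hmem s y hs hy)⟩
  refine _root_.exists_isLeafParametrization (C := |μ| * C * max r 1) hμ hδ hB hε₀
    (by positivity) ?_ ?_ ?_ ?_
  · rintro ⟨s, y⟩ ⟨hs, hy⟩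
    have h1 := F.analyticAt_slope (hreg (hmem s y hs hy))
    refine analyticAt_const.mul (AnalyticAt.sub ?_ analyticAt_const)
    exact AnalyticAt.comp (g := F.slope) (f := fun p : ℂ × ℂ => (r * Complex.exp p.1, p.2)) h1
      ((analyticAt_const.mul analyticAt_fst.cexp).prod analyticAt_snd)
  · intro s hs
    have h1 := hlip _ (hmem s 0 hs (by simpa using hε₀)) _ h00
    rw [F.slope_zero] at h1
    simp only [logDeviation]
    rw [norm_mul, Complex.norm_real, Real.norm_eq_abs]
    have h2 : ‖(((r : ℂ) * Complex.exp s, (0 : ℂ)) : ℂ × ℂ) - 0‖ = r * Real.exp s.re := by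
      rw [sub_zero, Prod.norm_def]
      simp [Complex.norm_exp, abs_of_pos hr0, (mul_pos hr0 (Real.exp_pos s.re)).le]
    rw [h2] at h1
    calc _ ≤ |μ| * (C * (r * Real.exp s.re)) := by gcongr
      _ = |μ| * C * r * Real.exp s.re := by ring
      _ ≤ _ := by gcongr; exact le_max_left _ _
  · intro s hs y y' hy hy'
    refine (hL s hs y y' hy hy').trans (mul_le_mul_of_nonneg_right ?_ (norm_nonneg _))
    exact le_mul_of_one_le_right (by positivity) (le_max_right _ _)
  · intro s y
    simp only [logDeviation, Complex.exp_add, Complex.exp_two_pi_mul_I, mul_one]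

/-- The lift of the loop through `(r, z)` is the leaf with label `z`, so that the holonomy is the
value at the logarithmic time `2πi`. -/
theorem holonomy_eq_leafMap (F : SiegelFoliation l₁ l₂) {μ r δ B ε₀ C ε R : ℝ} {w : ℂ × ℂ → ℂ}
    (hr : 0 < r) (hl₁ : l₁ ≠ 0) (hμ : l₂ / l₁ = μ)
    (h : IsLeafParametrization μ δ B ε₀ C ε R (F.logDeviation μ r) w)
    (hreg : ∀ s y : ℂ, s.re < δ → ‖y‖ < ε₀ → (r * Complex.exp s, y) ∈ F.regularSet) {z : ℂ}
    (hz : ‖z‖ < ε) :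
    F.holonomy r z = leafMap μ w (2 * Real.pi * Complex.I, z) := by
  have hpi := Real.two_pi_pos
  have hcm : ∀ θ : ℝ, circleMap 0 r θ = r * Complex.exp (θ * Complex.I) := fun θ => by
    simp [circleMap]
  have hfield : ∀ θ : ℝ, ∀ y : ℂ, (F.field (circleMap 0 r θ, y)).2 /
      (F.field (circleMap 0 r θ, y)).1 * (circleMap 0 r θ * Complex.I) =
      y * (μ + F.logDeviation μ r (θ * Complex.I, y)) * Complex.I := by
    intro θ y
    have hc : circleMap 0 r θ ≠ 0 := by simp [circleMap, hr.ne']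
    simp only [field, logDeviation, slope, hcm] at hc ⊢
    rw [← hμ, mul_sub, mul_one, add_sub_cancel]
    set X := (r : ℂ) * Complex.exp (θ * Complex.I)
    set f := 1 + F.f (X, y)
    rcases eq_or_ne f 0 with h0 | h0
    · simp [h0]
    · field_simp
  have hmem : ∀ θ ∈ Icc (0 : ℝ) (2 * Real.pi),
      ((θ : ℂ) * Complex.I, z) ∈ leafDomain μ δ B ε := by
    intro θ hθ
    refine ⟨by simpa using h.δ_pos, ?_, hz, by simpa using hz⟩
    simp only [Complex.im_ofReal_mul, Complex.I_im, mul_one]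
    rw [abs_of_nonneg hθ.1]
    exact hθ.2.trans_lt h.lt_B
  set γ : ℝ → ℂ := fun θ => leafMap μ w (θ * Complex.I, z) with hγ
  have hγd : ∀ θ ∈ Icc (0 : ℝ) (2 * Real.pi), HasDerivAt γ
      (γ θ * (μ + F.logDeviation μ r (θ * Complex.I, γ θ)) * Complex.I) θ := by
    intro θ hθ
    have h1 : HasDerivAt (fun t : ℝ => (t : ℂ) * Complex.I) Complex.I θ := by
      simpa using (Complex.ofRealCLM.hasDerivAt (x := θ)).mul_const Complex.I
    exact (h.hasDerivAt_leafMap (hmem θ hθ)).comp θ h1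
  have hγb : ∀ θ ∈ Icc (0 : ℝ) (2 * Real.pi), ‖γ θ‖ < ε₀ := fun θ hθ =>
    h.norm_leafMap_lt (hmem θ hθ)
  have hγ0 : γ 0 = z := by simp [hγ, h.leafMap_zero]
  have hγlift : F.IsLift r z γ := by
    refine ⟨hγ0, fun θ hθ => ?_⟩
    have h1 := hreg (θ * Complex.I) (γ θ) (by simpa using h.δ_pos) (hγb θ hθ)
    rw [← hcm] at h1
    refine ⟨h1.1, h1.2.1, h1.2.2, ?_⟩
    rw [hfield]
    exact (hγd θ hθ).hasDerivWithinAt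
  -- a second lift agrees with `γ` as long as it stays in the polydisc, hence by continuity everywhere
  have huniq : ∀ γ' : ℝ → ℂ, F.IsLift r z γ' → EqOn γ γ' (Icc 0 (2 * Real.pi)) := by
    rintro γ' ⟨hγ'0, hγ'⟩
    have hγ'd : ∀ θ ∈ Icc (0 : ℝ) (2 * Real.pi), HasDerivWithinAt γ'
        (γ' θ * (μ + F.logDeviation μ r (θ * Complex.I, γ' θ)) * Complex.I)
        (Icc (0 : ℝ) (2 * Real.pi)) θ := by
      intro θ hθ
      rw [← hfield]
      exact (hγ' θ hθ).2.2.2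
    have hc' : ContinuousOn γ' (Icc 0 (2 * Real.pi)) := fun θ hθ =>
      (hγ'd θ hθ).continuousWithinAt
    have hc : ContinuousOn γ (Icc 0 (2 * Real.pi)) := fun θ hθ =>
      (hγd θ hθ).continuousAt.continuousWithinAt
    have hclosed : IsClosed ({θ | γ θ = γ' θ} ∩ Icc 0 (2 * Real.pi)) := by
      have := (hc.sub hc').preimage_isClosed_of_isClosed isClosed_Icc
        (isClosed_singleton (x := (0 : ℂ)))
      convert this using 1
      ext θ
      simp [sub_eq_zero, and_comm]
    refine hclosed.Icc_subset_of_forall_exists_gt (by simp [hγ0, hγ'0]) ?_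
    rintro θ₀ ⟨hθ₀, hθ₀I⟩ y hy
    have hθ₀I' : θ₀ ∈ Icc 0 (2 * Real.pi) := Ico_subset_Icc_self hθ₀I
    have hball : ∀ᶠ θ in 𝓝[≥] θ₀, θ < 2 * Real.pi → ‖γ' θ‖ < ε₀ := by
      have h1 : ∀ᶠ θ in 𝓝[Icc 0 (2 * Real.pi)] θ₀, ‖γ' θ‖ < ε₀ := by
        refine (hc' θ₀ hθ₀I').norm.eventually (gt_mem_nhds ?_)
        show ‖γ' θ₀‖ < ε₀
        rw [← show γ θ₀ = γ' θ₀ from hθ₀]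
        exact hγb θ₀ hθ₀I'
      rw [eventually_nhdsWithin_iff] at h1 ⊢
      filter_upwards [h1] with θ hθ h2 h3
      exact hθ ⟨hθ₀I.1.trans h2, h3.le⟩
    obtain ⟨θ₁, hθ₁, hθ₁s⟩ := mem_nhdsGE_iff_exists_Ico_subset.1 hball
    set t₁ := min (min θ₁ y) (2 * Real.pi) with ht₁
    have hθt : θ₀ < t₁ := lt_min (lt_min hθ₁ hy) hθ₀I.2
    have hsubI : Icc θ₀ t₁ ⊆ Icc 0 (2 * Real.pi) :=
      Icc_subset_Icc hθ₀I.1 (min_le_right _ _)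
    have hIco : ∀ t ∈ Ico θ₀ t₁, t < 2 * Real.pi := fun t ht => ht.2.trans_le (min_le_right _ _)
    have key := h.unique_along (κ := Complex.I) (σ := fun t => (t : ℂ) * Complex.I)
      (t₀ := θ₀) (t₁ := t₁) (p := γ) (q := γ') (fun t _ => by simpa using h.δ_pos)
      (hc.mono hsubI) (hc'.mono hsubI)
      (fun t ht => (hγd t (hsubI (Ico_subset_Icc_self ht))).hasDerivWithinAt)
      (fun t ht => by
        refine (hγ'd t (hsubI (Ico_subset_Icc_self ht))).mono_of_mem_nhdsWithin ?_
        refine mem_of_superset (Icc_mem_nhdsGE (hIco t ht)) ?_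
        exact Icc_subset_Icc_left (hθ₀I.1.trans ht.1))
      (fun t ht => hγb t (hsubI (Ico_subset_Icc_self ht)))
      (fun t ht => hθ₁s ⟨ht.1, ht.2.trans_le ((min_le_left _ _).trans (min_le_left _ _))⟩
        (hIco t ht)) hθ₀
    exact ⟨t₁, key ⟨hθt.le, le_rfl⟩, hθt, (min_le_left _ _).trans (min_le_right _ _)⟩
  have hex : ∃ γ : ℝ → ℂ, F.IsLift r z γ := ⟨γ, hγlift⟩
  rw [holonomy, dif_pos hex, ← huniq _ hex.choose_spec ⟨hpi.le, le_rfl⟩]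
  simp [hγ]

/-- A parametrization of the leaves of the foliation near the separatrix `{y = 0}`, in the
coordinate `x = r e^s`, `Re s < 0`, `|Im s| < B`: `L (s, z)` is the point above `s` of the leaf
through `(r, z)`, and `I (s, y)` is the label `z` of the leaf through `(s, y)`. Both are compared
with the linear model `y = z e^{μ s}`, and both are equivariant, by the holonomy, under `s ↦ s + 2πi`. -/
structure IsUniformization (F : SiegelFoliation l₁ l₂) (μ r B ε K : ℝ) (L I : ℂ × ℂ → ℂ) :
    Prop where
  ε_pos : 0 < ε
  K_pos : 0 < K
  analytic_L : ∀ p : ℂ × ℂ, p.1.re < 0 → |p.1.im| < B → ‖p.2‖ * Real.exp (μ * p.1.re) < ε →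
    AnalyticAt ℂ L p
  analytic_I : ∀ p ∈ labelDomain B ε, AnalyticAt ℂ I p
  L_I : ∀ p ∈ labelDomain B ε, L (p.1, I p) = p.2
  norm_L_le : ∀ p : ℂ × ℂ, p.1.re < 0 → |p.1.im| < B → ‖p.2‖ * Real.exp (μ * p.1.re) < ε →
    ‖L p‖ ≤ K * (‖p.2‖ * Real.exp (μ * p.1.re))
  le_norm_L : ∀ p : ℂ × ℂ, p.1.re < 0 → |p.1.im| < B → ‖p.2‖ * Real.exp (μ * p.1.re) < ε →
    ‖p.2‖ * Real.exp (μ * p.1.re) ≤ K * ‖L p‖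
  norm_I_le : ∀ p ∈ labelDomain B ε, ‖I p‖ * Real.exp (μ * p.1.re) ≤ K * ‖p.2‖
  le_norm_I : ∀ p ∈ labelDomain B ε, ‖p.2‖ ≤ K * (‖I p‖ * Real.exp (μ * p.1.re))
  deriv_L : ∀ p : ℂ × ℂ, p.1.re < 0 → |p.1.im| < B → ‖p.2‖ * Real.exp (μ * p.1.re) < ε →
    HasDerivAt (fun s => L (s, p.2)) (μ * L p * F.slope (r * Complex.exp p.1, L p)) p.1
  fderiv_I : ∀ p ∈ labelDomain B ε,
    fderiv ℂ I p (1, μ * p.2 * F.slope (r * Complex.exp p.1, p.2)) = 0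
  L_add_two_pi : ∀ s z : ℂ, s.re < 0 → |s.im| < B → |s.im + 2 * Real.pi| < B →
    ‖z‖ * Real.exp (μ * s.re) < ε → L (s + 2 * Real.pi * Complex.I, z) = L (s, F.holonomy r z)
  I_add_two_pi : ∀ s y : ℂ, s.re < 0 → |s.im| < B → |s.im + 2 * Real.pi| < B → ‖y‖ < ε →
    I (s, y) = F.holonomy r (I (s + 2 * Real.pi * Complex.I, y))

theorem exists_isUniformization (F : SiegelFoliation l₁ l₂) {μ r B : ℝ}
    (hr : F.AdmissibleRadius r) (hl₁ : l₁ ≠ 0) (hμl : l₂ / l₁ = μ) (hμ : μ < 0)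
    (hB : 2 * Real.pi < B) :
    ∃ ε K L I, F.IsUniformization μ r B ε K L I := by
  obtain ⟨δ, ε₀, C, ε, R, w, h, hreg⟩ := F.exists_isLeafParametrization hr hμ hB
  obtain ⟨ε₁, hε₁, hε₁R, I, hI, hIb, hIL, hIuniq⟩ := h.exists_label
  have hε := h.ε_pos
  have hR := h.R_nonneg
  have hexpR : 1 ≤ Real.exp R := Real.one_le_exp hR
  have hexp2R : Real.exp (2 * R) = Real.exp R * Real.exp R := by rw [← Real.exp_add]; ring_nf
  have hε₁R' : ε₁ * Real.exp R * Real.exp R ≤ ε / 4 := by rw [mul_assoc, ← hexp2R]; exact hε₁R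
  have hε₁R1 : ε₁ * Real.exp R ≤ ε / 4 :=
    (le_mul_of_one_le_right (by positivity) hexpR).trans hε₁R'
  have hε₁ε : ε₁ ≤ ε / 4 := (le_mul_of_one_le_right hε₁.le hexpR).trans hε₁R1
  -- for `Re s < 0`, the bound on `z e^{μ s}` implies the one on `z`
  have hle : ∀ s z : ℂ, s.re < 0 → ‖z‖ ≤ ‖z‖ * Real.exp (μ * s.re) := fun s z hs =>
    le_mul_of_one_le_right (norm_nonneg _) (Real.one_le_exp (by nlinarith))
  have hdom : ∀ p : ℂ × ℂ, p.1.re < 0 → |p.1.im| < B → ‖p.2‖ * Real.exp (μ * p.1.re) < ε →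
      p ∈ leafDomain μ δ B ε := fun p h1 h2 h3 =>
    ⟨h1.trans h.δ_pos, h2, (hle p.1 p.2 h1).trans_lt h3, h3⟩
  have hslope : ∀ s y : ℂ, y * (μ + F.logDeviation μ r (s, y)) =
      μ * y * F.slope (r * Complex.exp s, y) := by
    intro s y; simp only [logDeviation]; ring
  have hIdom : ∀ p ∈ labelDomain B ε₁, (p.1, I p) ∈ leafDomain μ δ B ε := fun p hp =>
    hdom (p.1, I p) hp.1 hp.2.1 ((hIb p hp).trans_lt (by linarith))
  have hIle : ∀ p ∈ labelDomain B ε₁, ‖I p‖ * Real.exp (μ * p.1.re) ≤ Real.exp R * ‖p.2‖ := by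
    intro p hp
    have h1 := le_norm_leafMap (μ := μ) (h.norm_w_le _ (hIdom p hp))
    rw [hIL p hp] at h1
    simp only at h1
    rw [Real.exp_neg, ← div_eq_mul_inv, div_le_iff₀ (Real.exp_pos _)] at h1
    linarith
  have hhol : ∀ z : ℂ, ‖z‖ < ε → F.holonomy r z = leafMap μ w (2 * Real.pi * Complex.I, z) :=
    fun z hz => F.holonomy_eq_leafMap hr.1 hl₁ hμl h hreg hz
  refine ⟨ε₁, Real.exp R, leafMap μ w, I, hε₁, Real.exp_pos _, ?_, hI, hIL, ?_, ?_, hIle, ?_, ?_,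
    ?_, ?_, ?_⟩
  · exact fun p h1 h2 h3 =>
      analyticOnNhd_leafMap h.analytic_w p (hdom p h1 h2 (h3.trans (by linarith)))
  · intro p h1 h2 h3
    rw [mul_comm]
    exact norm_leafMap_le (h.norm_w_le _ (hdom p h1 h2 (h3.trans (by linarith))))
  · intro p h1 h2 h3
    have h4 := le_norm_leafMap (μ := μ) (h.norm_w_le _ (hdom p h1 h2 (h3.trans (by linarith))))
    rw [Real.exp_neg, ← div_eq_mul_inv, div_le_iff₀ (Real.exp_pos _)] at h4
    linarith
  · intro p hp
    have h1 := norm_leafMap_le (μ := μ) (h.norm_w_le _ (hIdom p hp))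
    rw [hIL p hp] at h1
    linarith
  · intro p h1 h2 h3
    have h4 := h.hasDerivAt_leafMap (hdom p h1 h2 (h3.trans (by linarith)))
    rwa [hslope] at h4
  · intro p hp
    -- differentiate `I (s, L (s, z)) = z` along the leaf through `p`
    have hd := h.hasDerivAt_leafMap (hIdom p hp)
    have hIp := hIL p hp
    rw [hslope, hIp] at hd
    simp only at hd
    have hc : HasDerivAt (fun s => (s, leafMap μ w (s, I p)))
        ((1 : ℂ), μ * p.2 * F.slope (r * Complex.exp p.1, p.2)) p.1 :=
      (hasDerivAt_id p.1).prodMk hd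
    have hIf : HasFDerivAt I (fderiv ℂ I p) (p.1, leafMap μ w (p.1, I p)) := by
      rw [hIp]; exact (hI p hp).differentiableAt.hasFDerivAt
    have h1 := hIf.comp_hasDerivAt p.1 hc
    have hlt : ‖I p‖ * Real.exp (μ * p.1.re) < ε / 4 := by
      have h2 := hIle p hp
      have h3 : Real.exp R * ‖p.2‖ < Real.exp R * ε₁ :=
        mul_lt_mul_of_pos_left hp.2.2 (Real.exp_pos _)
      linarith
    have hev : (fun _ : ℂ => I p) =ᶠ[𝓝 p.1] I ∘ fun s => (s, leafMap μ w (s, I p)) := by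
      have hcont : ContinuousAt (fun s : ℂ => ‖I p‖ * Real.exp (μ * s.re)) p.1 := by fun_prop
      have hmem : ∀ᶠ s in 𝓝 p.1, (s, leafMap μ w (s, I p)) ∈ labelDomain B ε₁ := by
        refine hc.continuousAt.eventually ((isOpen_labelDomain _ _).mem_nhds ?_)
        show (p.1, leafMap μ w (p.1, I p)) ∈ labelDomain B ε₁
        rw [hIp]; exact hp
      filter_upwards [hcont.eventually (gt_mem_nhds hlt), hmem] with s h2 h3
      exact (hIuniq _ h3 (I p) h2.le rfl).symm
    exact h1.unique ((hasDerivAt_const p.1 (I p)).congr_of_eventuallyEq hev.symm)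
  · intro s z hs hi hi' hz
    have hz1 : ‖z‖ * Real.exp R * Real.exp (μ * s.re) < ε := by
      have : ‖z‖ * Real.exp (μ * s.re) * Real.exp R < ε₁ * Real.exp R :=
        mul_lt_mul_of_pos_right hz (Real.exp_pos _)
      linarith
    have hz0 : ‖z‖ * Real.exp R < ε := by
      refine lt_of_le_of_lt ?_ hz1
      exact le_mul_of_one_le_right (by positivity) (Real.one_le_exp (by nlinarith))
    rw [hhol z ((hle s z hs).trans_lt (hz.trans (by linarith)))]
    exact h.leafMap_add_two_pi (hs.trans h.δ_pos) hi hi' hz0 hz1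
  · intro s y hs hi hi' hy
    have hre : (s + 2 * Real.pi * Complex.I).re = s.re := by simp
    have him : (s + 2 * Real.pi * Complex.I).im = s.im + 2 * Real.pi := by simp
    have hmem : (s + 2 * Real.pi * Complex.I, y) ∈ labelDomain B ε₁ :=
      ⟨by rw [hre]; exact hs, by rw [him]; exact hi', hy⟩
    set z := I (s + 2 * Real.pi * Complex.I, y) with hz
    have h1 : ‖z‖ * Real.exp (μ * s.re) ≤ Real.exp R * ‖y‖ := by
      have := hIle _ hmem
      rwa [hre] at this
    have h2 : Real.exp R * ‖y‖ < Real.exp R * ε₁ := mul_lt_mul_of_pos_left hy (Real.exp_pos _)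
    have h3 : ‖z‖ * Real.exp (μ * s.re) * Real.exp R < ε / 4 := by
      have : ‖z‖ * Real.exp (μ * s.re) * Real.exp R < Real.exp R * ε₁ * Real.exp R :=
        mul_lt_mul_of_pos_right (h1.trans_lt h2) (Real.exp_pos _)
      linarith
    have hz1 : ‖z‖ * Real.exp R * Real.exp (μ * s.re) < ε / 4 := by linarith
    have hz0 : ‖z‖ * Real.exp R < ε := by
      refine lt_of_le_of_lt ?_ (hz1.trans (by linarith))
      exact le_mul_of_one_le_right (by positivity) (Real.one_le_exp (by nlinarith))
    have hzε : ‖z‖ < ε := (le_mul_of_one_le_right (norm_nonneg _) hexpR).trans_lt hz0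
    refine hIuniq (s, y) ⟨hs, hi, hy⟩ _ ?_ ?_
    · rw [hhol z hzε]
      refine le_trans ?_ hz1.le
      gcongr
      exact h.norm_leafMap_two_pi_le hzε
    · rw [hhol z hzε, ← h.leafMap_add_two_pi (hs.trans h.δ_pos) hi hi' hz0 (hz1.trans (by linarith))]
      exact hIL _ hmem

end SiegelFoliation

/-! ### Germs of diffeomorphisms -/

/-- A holomorphic germ which does not shrink distances to the origin by more than a constant factor
is a germ of diffeomorphism: its derivative is injective, hence invertible. -/
theorem isGermDiffeo_of_norm_le {E : Type*} [NormedAddCommGroup E] [NormedSpace ℂ E]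
    [FiniteDimensional ℂ E] {φ : E → E} (hφ : AnalyticAt ℂ φ 0) (h0 : φ 0 = 0) {K : ℝ}
    (hK : ∀ᶠ p in 𝓝 (0 : E), ‖p‖ ≤ K * ‖φ p‖) : IsGermDiffeo φ := by
  have hcomplete : CompleteSpace E := FiniteDimensional.complete ℂ E
  set D := fderiv ℂ φ 0 with hD
  have hK' : ∀ᶠ p in 𝓝 (0 : E), ‖p‖ ≤ (|K| + 1) * ‖φ p‖ := by
    filter_upwards [hK] with p hp
    exact hp.trans (by gcongr; linarith [le_abs_self K])
  have hinj : Function.Injective (D : E →ₗ[ℂ] E) := by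
    rw [← LinearMap.ker_eq_bot, LinearMap.ker_eq_bot']
    intro v hv
    by_contra hv0
    have hlo := (hφ.differentiableAt.hasFDerivAt.isLittleO).def
      (c := (2 * (|K| + 1))⁻¹) (by positivity)
    have hboth := hlo.and hK'
    have hray : Tendsto (fun t : ℂ => t • v) (𝓝[≠] 0) (𝓝 0) := by
      have : ContinuousAt (fun t : ℂ => t • v) 0 := by fun_prop
      have h1 := this.tendsto
      rw [zero_smul] at h1
      exact h1.mono_left nhdsWithin_le_nhds
    obtain ⟨t, ⟨ht1, ht2⟩, ht0⟩ := ((hray.eventually hboth).and self_mem_nhdsWithin).exists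
    have hDt : D (t • v) = 0 := by rw [map_smul]; exact (congrArg _ hv).trans (smul_zero t)
    rw [h0, sub_zero, sub_zero, ← hD, hDt, sub_zero] at ht1
    have hpos : 0 < ‖t • v‖ := norm_pos_iff.2 (smul_ne_zero ht0 hv0)
    have h3 : (|K| + 1) * ‖φ (t • v)‖ ≤ (|K| + 1) * ((2 * (|K| + 1))⁻¹ * ‖t • v‖) := by gcongr
    have h4 : (|K| + 1) * ((2 * (|K| + 1))⁻¹ * ‖t • v‖) = ‖t • v‖ / 2 := by
      field_simp
    linarith
  let e : E ≃L[ℂ] E := (LinearEquiv.ofInjectiveEndo (D : E →ₗ[ℂ] E) hinj).toContinuousLinearEquiv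
  have he : (e : E →L[ℂ] E) = D := by ext v; rfl
  have hstrict : HasStrictFDerivAt φ (e : E →L[ℂ] E) 0 := by rw [he]; exact hφ.hasStrictFDerivAt
  set Ψ := hstrict.toOpenPartialHomeomorph φ with hΨ
  have hΨφ : (Ψ : E → E) = φ := hstrict.toOpenPartialHomeomorph_coe
  have hsrc : (0 : E) ∈ Ψ.source := hstrict.mem_toOpenPartialHomeomorph_source
  have htgt : (0 : E) ∈ Ψ.target := by
    have := Ψ.map_source hsrc
    rwa [hΨφ, h0] at this
  have hsymm0 : Ψ.symm 0 = 0 := by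
    have := Ψ.left_inv hsrc
    rwa [hΨφ, h0] at this
  obtain ⟨q, hq⟩ := hφ
  refine ⟨⟨q, hq⟩, h0, Ψ.symm, ?_, hsymm0, ?_, ?_⟩
  · have hq1 : q 1 = (continuousMultilinearCurryFin1 ℂ E E).symm e := by
      rw [LinearIsometryEquiv.eq_symm_apply, he, hD]
      exact (hq.hasFDerivAt.fderiv).symm
    have hq' : HasFPowerSeriesAt Ψ q 0 := by rw [hΨφ]; exact hq
    have := Ψ.hasFPowerSeriesAt_symm hsrc hq' hq1
    rw [hΨφ, h0] at this
    exact this.analyticAt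
  · filter_upwards [Ψ.open_source.mem_nhds hsrc] with p hp
    have := Ψ.left_inv hp
    rwa [hΨφ] at this
  · filter_upwards [Ψ.open_target.mem_nhds htgt] with p hp
    have := Ψ.right_inv hp
    rwa [hΨφ] at this

theorem AnalyticAt.eventually_norm_le {E : Type*} [NormedAddCommGroup E] [NormedSpace ℂ E]
    {φ : E → E} (hφ : AnalyticAt ℂ φ 0) (h0 : φ 0 = 0) :
    ∃ K > 0, ∀ᶠ p in 𝓝 (0 : E), ‖φ p‖ ≤ K * ‖p‖ := by
  obtain ⟨K, hK, hb⟩ := hφ.differentiableAt.isBigO_sub.exists_pos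
  refine ⟨K, hK, ?_⟩
  filter_upwards [hb.bound] with p hp
  simpa [h0] using hp

theorem IsGermDiffeo.exists_norm_bounds {E : Type*} [NormedAddCommGroup E] [NormedSpace ℂ E]
    {φ : E → E} (hφ : IsGermDiffeo φ) :
    ∃ K > 0, ∀ᶠ p in 𝓝 (0 : E), ‖φ p‖ ≤ K * ‖p‖ ∧ ‖p‖ ≤ K * ‖φ p‖ := by
  obtain ⟨hφa, hφ0, ψ, hψa, hψ0, hl, -⟩ := hφ
  obtain ⟨K₁, hK₁, h1⟩ := hφa.eventually_norm_le hφ0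
  obtain ⟨K₂, hK₂, h2⟩ := hψa.eventually_norm_le hψ0
  have hto : Tendsto φ (𝓝 0) (𝓝 0) := by
    have := hφa.continuousAt.tendsto
    rwa [hφ0] at this
  refine ⟨max K₁ K₂, lt_max_of_lt_left hK₁, ?_⟩
  filter_upwards [h1, hto.eventually h2, hl] with p h3 h4 h5
  rw [h5] at h4
  exact ⟨h3.trans (by gcongr; exact le_max_left _ _), h4.trans (by gcongr; exact le_max_right _ _)⟩

/-! ### Extension across the other separatrix -/

/-- **Riemann's extension theorem** across the axis `{x = 0}`. -/
theorem exists_analyticOnNhd_extension {r ε M : ℝ} (hr : 0 < r) {Q : ℂ × ℂ → ℂ}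
    (hQ : ∀ p : ℂ × ℂ, p.1 ≠ 0 → ‖p.1‖ < r → ‖p.2‖ < ε → AnalyticAt ℂ Q p)
    (hM : ∀ p : ℂ × ℂ, p.1 ≠ 0 → ‖p.1‖ < r → ‖p.2‖ < ε → ‖Q p‖ ≤ M) :
    ∃ Q' : ℂ × ℂ → ℂ, AnalyticOnNhd ℂ Q' (ball 0 (r / 2) ×ˢ ball 0 ε) ∧
      ∀ p ∈ ball (0 : ℂ) (r / 2) ×ˢ ball (0 : ℂ) ε, p.1 ≠ 0 → Q' p = Q p := by
  have hρ : 0 < r / 2 := by positivity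
  have hsph : ∀ ζ ∈ sphere (0 : ℂ) (r / 2), ζ ≠ 0 ∧ ‖ζ‖ < r := by
    intro ζ hζ
    rw [mem_sphere_zero_iff_norm] at hζ
    exact ⟨norm_pos_iff.1 (by rw [hζ]; exact hρ), by rw [hζ]; linarith⟩
  refine ⟨fun p => (2 * Real.pi * Complex.I : ℂ)⁻¹ • ∮ ζ in C(0, r / 2), (ζ - p.1)⁻¹ • Q (ζ, p.2),
    fun p hp => analyticAt_const.fun_smul
      (analyticAt_cauchyIntegral (Q := Q) hρ isOpen_ball ?_ ?_ hp), ?_⟩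
  · rintro ⟨ζ, y⟩ ⟨hζ, hy⟩
    exact (hQ (ζ, y) (hsph ζ hζ).1 (hsph ζ hζ).2 (by simpa using hy)).continuousAt.continuousWithinAt
  · intro ζ hζ y hy
    refine ((hQ (ζ, y) (hsph ζ hζ).1 (hsph ζ hζ).2 (by simpa using hy)).differentiableAt.comp y
      (f := fun y : ℂ => (ζ, y)) (by fun_prop)).differentiableWithinAt
  · rintro ⟨x, y⟩ ⟨hx, hy⟩ hx0
    simp only at hx hy hx0 ⊢
    have hy' : ‖y‖ < ε := by simpa using hy
    have hd := Complex.differentiableOn_update_limUnder_of_bddAbove (f := fun x => Q (x, y))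
      (ball_mem_nhds (0 : ℂ) hr)
      (fun x hx => ((hQ (x, y) hx.2 (by simpa using hx.1) hy').differentiableAt.comp x
        (f := fun x : ℂ => (x, y)) (by fun_prop)).differentiableWithinAt)
      ⟨M, by
        rintro _ ⟨x, hx, rfl⟩
        exact hM (x, y) hx.2 (by simpa using hx.1) hy'⟩
    have hcauchy := (hd.mono (closedBall_subset_ball (by linarith))).circleIntegral_sub_inv_smul hx
    rw [Function.update_of_ne hx0] at hcauchy
    have hcongr : (∮ ζ in C(0, r / 2), (ζ - x)⁻¹ • Q (ζ, y)) = ∮ ζ in C(0, r / 2), (ζ - x)⁻¹ •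
        Function.update (fun x => Q (x, y)) 0 (limUnder (𝓝[≠] 0) fun x => Q (x, y)) ζ := by
      refine circleIntegral.integral_congr hρ.le fun ζ hζ => ?_
      simp only [Function.update_of_ne (hsph ζ hζ).1]
    rw [hcongr, hcauchy, smul_smul, inv_mul_cancel₀, one_smul]
    simp [Real.pi_ne_zero]

/-- A bounded holomorphic function of `(s, y)` which is `2πi`-periodic in `s` is a holomorphic
function of `(r e^s, y)`, including at `x = 0`. -/
theorem exists_analyticOnNhd_descent {r B ε M : ℝ} (hr : 0 < r) (hB : 2 * Real.pi < B)
    {P : ℂ × ℂ → ℂ} (hP : ∀ p ∈ labelDomain B ε, AnalyticAt ℂ P p)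
    (hM : ∀ p ∈ labelDomain B ε, ‖P p‖ ≤ M)
    (hper : ∀ s y : ℂ, (s, y) ∈ labelDomain B ε → (s + 2 * Real.pi * Complex.I, y) ∈ labelDomain B ε →
      P (s + 2 * Real.pi * Complex.I, y) = P (s, y)) :
    ∃ Q : ℂ × ℂ → ℂ, AnalyticOnNhd ℂ Q (ball 0 (r / 2) ×ˢ ball 0 ε) ∧
      ∀ s y : ℂ, -Real.pi < s.im → s.im ≤ Real.pi → (r * Complex.exp s, y) ∈
        ball (0 : ℂ) (r / 2) ×ˢ ball (0 : ℂ) ε → Q (r * Complex.exp s, y) = P (s, y) := by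
  have hpi := Real.pi_pos
  have hr' : (r : ℂ) ≠ 0 := Complex.ofReal_ne_zero.2 hr.ne'
  have hlogre : ∀ x : ℂ, x ≠ 0 → ‖x‖ < 1 → (Complex.log x).re < 0 := fun x hx0 hx => by
    rw [Complex.log_re]; exact Real.log_neg (norm_pos_iff.2 hx0) hx
  have hmem : ∀ x y : ℂ, x ≠ 0 → ‖x‖ < 1 → ‖y‖ < ε → (Complex.log x, y) ∈ labelDomain B ε := by
    intro x y hx0 hx hy
    refine ⟨hlogre x hx0 hx, ?_, hy⟩
    refine lt_of_le_of_lt ?_ hB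
    rw [abs_le]
    constructor <;> linarith [Complex.neg_pi_lt_log_im x, Complex.log_im_le_pi x]
  have hmem' : ∀ x y : ℂ, x ≠ 0 → ‖x‖ < 1 → ‖y‖ < ε →
      (Complex.log (-x) + Real.pi * Complex.I, y) ∈ labelDomain B ε := by
    intro x y hx0 hx hy
    refine ⟨?_, ?_, hy⟩
    · simpa using hlogre (-x) (neg_ne_zero.2 hx0) (by simpa using hx)
    · refine lt_of_le_of_lt ?_ hB
      have h1 := Complex.neg_pi_lt_log_im (-x)
      have h2 := Complex.log_im_le_pi (-x)
      have h3 : (Complex.log (-x) + Real.pi * Complex.I).im = (Complex.log (-x)).im + Real.pi := by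
        simp
      rw [h3, abs_le]
      constructor <;> linarith
  -- the two determinations of the logarithm give the same value, by periodicity
  have hlog : ∀ x y : ℂ, x ≠ 0 → ‖x‖ < 1 → ‖y‖ < ε →
      P (Complex.log x, y) = P (Complex.log (-x) + Real.pi * Complex.I, y) := by
    intro x y hx0 hx hy
    have hexp : Complex.exp (Complex.log (-x) + Real.pi * Complex.I) =
        Complex.exp (Complex.log x) := by
      rw [Complex.exp_add, Complex.exp_log (neg_ne_zero.2 hx0), Complex.exp_log hx0,
        Complex.exp_pi_mul_I]
      ring
    obtain ⟨n, hn⟩ := Complex.exp_eq_exp_iff_exists_int.1 hexp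
    have him := congrArg Complex.im hn
    simp only [Complex.add_im, Complex.mul_im, Complex.ofReal_re, Complex.I_im, Complex.ofReal_im,
      Complex.I_re, Complex.intCast_re, Complex.intCast_im, Complex.mul_re, Complex.re_ofNat,
      Complex.im_ofNat] at him
    have h1 := Complex.neg_pi_lt_log_im x
    have h2 := Complex.log_im_le_pi x
    have h3 := Complex.neg_pi_lt_log_im (-x)
    have h4 := Complex.log_im_le_pi (-x)
    have h5 : (-1 : ℝ) < n := by
      by_contra hcon
      rw [not_lt] at hcon
      nlinarith
    have h6 : (n : ℝ) < 2 := by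
      by_contra hcon
      rw [not_lt] at hcon
      nlinarith
    have h5' : (-1 : ℤ) < n := by exact_mod_cast h5
    have h6' : n < 2 := by exact_mod_cast h6
    have hm := hmem' x y hx0 hx hy
    rw [hn] at hm ⊢
    obtain rfl | rfl : n = 0 ∨ n = 1 := by omega
    · simp
    · simp only [Int.cast_one, one_mul] at hm ⊢
      exact (hper _ _ (hmem x y hx0 hx hy) hm).symm
  have hnorm : ∀ x : ℂ, ‖x‖ < r → ‖x / r‖ < 1 := by
    intro x hx
    rw [norm_div, Complex.norm_real, Real.norm_eq_abs, abs_of_pos hr]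
    exact (div_lt_one hr).2 hx
  obtain ⟨Q, hQ, hQP⟩ := exists_analyticOnNhd_extension (ε := ε) (M := M) hr
    (Q := fun p => P (Complex.log (p.1 / r), p.2)) (fun p hp0 hp hy => by
      have hx0 : p.1 / r ≠ 0 := div_ne_zero hp0 hr'
      have hx1 := hnorm p.1 hp
      have hdiv : AnalyticAt ℂ (fun p : ℂ × ℂ => p.1 / (r : ℂ)) p :=
        analyticAt_fst.div analyticAt_const hr'
      by_cases hslit : p.1 / r ∈ Complex.slitPlane
      · exact AnalyticAt.comp (g := P) (f := fun p : ℂ × ℂ => (Complex.log (p.1 / r), p.2))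
          (hP _ (hmem _ _ hx0 hx1 hy)) ((hdiv.clog hslit).prod analyticAt_snd)
      · have hslit' : -(p.1 / r) ∈ Complex.slitPlane := by
          rw [Complex.mem_slitPlane_iff] at hslit ⊢
          push Not at hslit
          left
          rw [Complex.neg_re]
          rcases hslit.1.lt_or_eq with h | h
          · linarith
          · exact absurd (Complex.ext h hslit.2) hx0
        have han : AnalyticAt ℂ (fun p : ℂ × ℂ => P (Complex.log (-(p.1 / r)) +
            Real.pi * Complex.I, p.2)) p :=
          AnalyticAt.comp (g := P)
            (f := fun p : ℂ × ℂ => (Complex.log (-(p.1 / r)) + Real.pi * Complex.I, p.2))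
            (hP _ (hmem' _ _ hx0 hx1 hy))
            (((hdiv.neg.clog hslit').add analyticAt_const).prod analyticAt_snd)
        refine han.congr ?_
        have hopen : IsOpen {q : ℂ × ℂ | q.1 ≠ 0 ∧ ‖q.1‖ < r ∧ ‖q.2‖ < ε} := by
          have h1 : IsOpen {q : ℂ × ℂ | q.1 ≠ 0} := isOpen_ne_fun (by fun_prop) (by fun_prop)
          have h2 : IsOpen {q : ℂ × ℂ | ‖q.1‖ < r} := isOpen_lt (by fun_prop) (by fun_prop)
          have h3 : IsOpen {q : ℂ × ℂ | ‖q.2‖ < ε} := isOpen_lt (by fun_prop) (by fun_prop)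
          exact h1.inter (h2.inter h3)
        filter_upwards [hopen.mem_nhds ⟨hp0, hp, hy⟩] with q hq
        exact (hlog _ _ (div_ne_zero hq.1 hr') (hnorm _ hq.2.1) hq.2.2).symm)
    (fun p hp0 hp hy => hM _ (hmem _ _ (div_ne_zero hp0 hr') (hnorm _ hp) hy))
  refine ⟨Q, hQ, fun s y h1 h2 h3 => ?_⟩
  rw [hQP _ h3 (mul_ne_zero hr' (Complex.exp_ne_zero s))]
  simp only
  rw [mul_div_cancel_left₀ _ hr', Complex.log_exp h1 h2]

/-! ### Conjugating foliations with conjugate holonomies -/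

theorem Complex.dense_slitPlane : Dense Complex.slitPlane := by
  intro z
  by_cases hz : z ∈ Complex.slitPlane
  · exact subset_closure hz
  · rw [Complex.mem_slitPlane_iff] at hz
    push Not at hz
    refine mem_closure_of_tendsto (f := fun n : ℕ => z + (((n : ℝ) + 1)⁻¹ : ℝ) * Complex.I)
      (b := atTop) ?_ (Eventually.of_forall fun n => ?_)
    · have h1 : Tendsto (fun n : ℕ => (((n : ℝ) + 1)⁻¹ : ℝ)) atTop (𝓝 0) := by
        simpa using tendsto_one_div_add_atTop_nhds_zero_nat (𝕜 := ℝ)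
      have h2 := ((Complex.continuous_ofReal.tendsto 0).comp h1).mul_const Complex.I
      simpa using h2.const_add z
    · rw [Complex.mem_slitPlane_iff]
      right
      simp only [Complex.add_im, Complex.im_ofReal_mul, Complex.I_im, hz.2]
      positivity

theorem subset_closure_slitPlane_prod {U : Set (ℂ × ℂ)} (hU : IsOpen U) :
    U ⊆ closure (U ∩ (Complex.slitPlane ×ˢ univ)) :=
  (Complex.dense_slitPlane.prod dense_univ).open_subset_closure_inter hU

namespace SiegelFoliation

variable {l₁ l₂ : ℂ}

/-- If `φ` conjugates the holonomies, then following a leaf of the first foliation out to its label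
`z`, and the leaf of the second one with label `φ z` back in, conjugates the two foliations in
logarithmic coordinates. -/
theorem exists_log_conjugacy {μ r₁ r₂ : ℝ} (F₁ F₂ : SiegelFoliation l₁ l₂)
    (hr₁ : F₁.AdmissibleRadius r₁) (hr₂ : F₂.AdmissibleRadius r₂) (hl₁ : l₁ ≠ 0)
    (hμl : l₂ / l₁ = μ) (hμ : μ < 0)
    (hconj : GermConjugate (F₁.holonomy r₁) (F₂.holonomy r₂)) :
    ∃ ε > 0, ∃ M > 0, ∃ P : ℂ × ℂ → ℂ, (∀ p ∈ labelDomain 7 ε, AnalyticAt ℂ P p) ∧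
      (∀ p ∈ labelDomain 7 ε, ‖P p‖ ≤ M * ‖p.2‖) ∧ (∀ p ∈ labelDomain 7 ε, ‖p.2‖ ≤ M * ‖P p‖) ∧
      (∀ s y : ℂ, (s, y) ∈ labelDomain 7 ε → (s + 2 * Real.pi * Complex.I, y) ∈ labelDomain 7 ε →
        P (s + 2 * Real.pi * Complex.I, y) = P (s, y)) ∧
      ∀ p ∈ labelDomain 7 ε,
        fderiv ℂ P p (1, μ * p.2 * F₁.slope (r₁ * Complex.exp p.1, p.2)) =
          μ * P p * F₂.slope (r₂ * Complex.exp p.1, P p) := by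
  -- a strip wide enough to hold both ends of a segment from `s` to `s + 2πi`
  have hB : 2 * Real.pi < 7 := by linarith [Real.pi_lt_d2]
  obtain ⟨ε₁, K₁, L₁, I₁, U₁⟩ := F₁.exists_isUniformization hr₁ hl₁ hμl hμ hB
  obtain ⟨ε₂, K₂, L₂, I₂, U₂⟩ := F₂.exists_isUniformization hr₂ hl₁ hμl hμ hB
  obtain ⟨φ, hφ, hφh⟩ := hconj
  obtain ⟨Kφ, hKφ, hφb⟩ := hφ.exists_norm_bounds
  obtain ⟨ρ, hρ, hρφ⟩ := Metric.eventually_nhds_iff.1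
    ((hφ.1.eventually_analyticAt.and hφb).and hφh)
  have hK₁ := U₁.K_pos
  have hK₂ := U₂.K_pos
  have hε₁ := U₁.ε_pos
  have hε₂ := U₂.ε_pos
  set ε := min ε₁ (min (ρ / K₁) (ε₂ / (Kφ * K₁))) with hεdef
  have hε : 0 < ε := by positivity
  have hεε₁ : ε ≤ ε₁ := min_le_left _ _
  have hερ : K₁ * ε ≤ ρ := by
    rw [mul_comm, ← le_div_iff₀ hK₁]; exact (min_le_right _ _).trans (min_le_left _ _)
  have hεε₂ : Kφ * K₁ * ε ≤ ε₂ := by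
    rw [mul_comm, ← le_div_iff₀ (by positivity)]
    exact (min_le_right _ _).trans (min_le_right _ _)
  have hsub : ∀ p ∈ labelDomain 7 ε, p ∈ labelDomain 7 ε₁ := fun p hp =>
    ⟨hp.1, hp.2.1, hp.2.2.trans_le hεε₁⟩
  -- the image under `φ` of the label of a leaf of the first foliation
  have hI : ∀ p ∈ labelDomain 7 ε, ‖I₁ p‖ < ρ ∧
      ‖φ (I₁ p)‖ * Real.exp (μ * p.1.re) ≤ Kφ * K₁ * ‖p.2‖ ∧
      ‖φ (I₁ p)‖ * Real.exp (μ * p.1.re) < ε₂ := by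
    intro p hp
    have h1 := U₁.norm_I_le p (hsub p hp)
    have h2 : ‖I₁ p‖ ≤ ‖I₁ p‖ * Real.exp (μ * p.1.re) :=
      le_mul_of_one_le_right (norm_nonneg _) (Real.one_le_exp (by nlinarith [hp.1]))
    have h3 : K₁ * ‖p.2‖ < K₁ * ε := mul_lt_mul_of_pos_left hp.2.2 hK₁
    have h4 : ‖I₁ p‖ < ρ := by linarith
    have h5 := (hρφ (y := I₁ p) (by simpa using h4)).1.2.1
    have h6 : ‖φ (I₁ p)‖ * Real.exp (μ * p.1.re) ≤ Kφ * K₁ * ‖p.2‖ := by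
      calc _ ≤ Kφ * ‖I₁ p‖ * Real.exp (μ * p.1.re) := by gcongr
        _ = Kφ * (‖I₁ p‖ * Real.exp (μ * p.1.re)) := by ring
        _ ≤ Kφ * (K₁ * ‖p.2‖) := by gcongr
        _ = _ := by ring
    refine ⟨h4, h6, h6.trans_lt (lt_of_lt_of_le ?_ hεε₂)⟩
    exact mul_lt_mul_of_pos_left hp.2.2 (by positivity)
  let P : ℂ × ℂ → ℂ := fun p => L₂ (p.1, φ (I₁ p))
  have hPan : ∀ p ∈ labelDomain 7 ε, AnalyticAt ℂ P p := by
    intro p hp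
    obtain ⟨h1, -, h3⟩ := hI p hp
    refine AnalyticAt.comp (g := L₂) (f := fun p : ℂ × ℂ => (p.1, φ (I₁ p)))
      (U₂.analytic_L (p.1, φ (I₁ p)) hp.1 hp.2.1 h3) (analyticAt_fst.prod ?_)
    exact AnalyticAt.comp (g := φ) (hρφ (by simpa using h1)).1.1 (U₁.analytic_I p (hsub p hp))
  set M := K₁ * Kφ * K₂ with hM
  have hM0 : 0 < M := by positivity
  have hPle : ∀ p ∈ labelDomain 7 ε, ‖P p‖ ≤ M * ‖p.2‖ := by
    intro p hp
    obtain ⟨h1, h2, h3⟩ := hI p hp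
    refine (U₂.norm_L_le (p.1, φ (I₁ p)) hp.1 hp.2.1 h3).trans ?_
    calc _ ≤ K₂ * (Kφ * K₁ * ‖p.2‖) := by gcongr
      _ = _ := by rw [hM]; ring
  have hleP : ∀ p ∈ labelDomain 7 ε, ‖p.2‖ ≤ M * ‖P p‖ := by
    intro p hp
    obtain ⟨h1, h2, h3⟩ := hI p hp
    have h4 := U₂.le_norm_L (p.1, φ (I₁ p)) hp.1 hp.2.1 h3
    have h5 := (hρφ (y := I₁ p) (by simpa using h1)).1.2.2
    calc ‖p.2‖ ≤ K₁ * (‖I₁ p‖ * Real.exp (μ * p.1.re)) := U₁.le_norm_I p (hsub p hp)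
      _ ≤ K₁ * (Kφ * ‖φ (I₁ p)‖ * Real.exp (μ * p.1.re)) := by gcongr
      _ = K₁ * Kφ * (‖φ (I₁ p)‖ * Real.exp (μ * p.1.re)) := by ring
      _ ≤ K₁ * Kφ * (K₂ * ‖P p‖) := by gcongr
      _ = _ := by rw [hM]; ring
  have hPper : ∀ s y : ℂ, (s, y) ∈ labelDomain 7 ε →
      (s + 2 * Real.pi * Complex.I, y) ∈ labelDomain 7 ε →
      P (s + 2 * Real.pi * Complex.I, y) = P (s, y) := by
    intro s y h1 h2
    have him : (s + 2 * Real.pi * Complex.I).im = s.im + 2 * Real.pi := by simp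
    have hre : (s + 2 * Real.pi * Complex.I).re = s.re := by simp
    have h3 : |s.im + 2 * Real.pi| < 7 := by rw [← him]; exact h2.2.1
    have h4 := U₁.I_add_two_pi s y h1.1 h1.2.1 h3 (hsub _ h1).2.2
    obtain ⟨h5, -, h6⟩ := hI _ h2
    have h7 := (hρφ (y := I₁ (s + 2 * Real.pi * Complex.I, y)) (by simpa using h5)).2
    simp only [hre] at h6
    simp only [P]
    rw [U₂.L_add_two_pi s _ h1.1 h1.2.1 h3 h6, ← h7, ← h4]
  -- `P` maps leaves to leaves
  have hPleaf : ∀ p ∈ labelDomain 7 ε,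
      fderiv ℂ P p (1, μ * p.2 * F₁.slope (r₁ * Complex.exp p.1, p.2)) =
        μ * P p * F₂.slope (r₂ * Complex.exp p.1, P p) := by
    intro p hp
    obtain ⟨h1, -, h3⟩ := hI p hp
    set v : ℂ × ℂ := (1, μ * p.2 * F₁.slope (r₁ * Complex.exp p.1, p.2)) with hv
    have hId : HasFDerivAt I₁ (fderiv ℂ I₁ p) p :=
      (U₁.analytic_I p (hsub p hp)).differentiableAt.hasFDerivAt
    have hφd := (hρφ (y := I₁ p) (by simpa using h1)).1.1.differentiableAt.hasDerivAt
    have hφI : HasFDerivAt (fun p => φ (I₁ p)) (deriv φ (I₁ p) • fderiv ℂ I₁ p) p :=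
      hφd.comp_hasFDerivAt p hId
    have hm : HasFDerivAt (fun p : ℂ × ℂ => (p.1, φ (I₁ p)))
        ((ContinuousLinearMap.fst ℂ ℂ ℂ).prod (deriv φ (I₁ p) • fderiv ℂ I₁ p)) p :=
      hasFDerivAt_fst.prodMk hφI
    have hL : HasFDerivAt L₂ (fderiv ℂ L₂ (p.1, φ (I₁ p))) (p.1, φ (I₁ p)) :=
      (U₂.analytic_L (p.1, φ (I₁ p)) hp.1 hp.2.1 h3).differentiableAt.hasFDerivAt
    have hPd : HasFDerivAt P _ p := hL.comp p hm
    rw [hPd.fderiv, ContinuousLinearMap.comp_apply]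
    have hmv : ((ContinuousLinearMap.fst ℂ ℂ ℂ).prod (deriv φ (I₁ p) • fderiv ℂ I₁ p)) v =
        ((1 : ℂ), (0 : ℂ)) := by
      simp [hv, U₁.fderiv_I p (hsub p hp)]
    rw [hmv]
    have hcurve : HasDerivAt (fun s : ℂ => (s, φ (I₁ p))) ((1 : ℂ), (0 : ℂ)) p.1 :=
      (hasDerivAt_id p.1).prodMk (hasDerivAt_const p.1 _)
    exact (hL.comp_hasDerivAt p.1 hcurve).unique
      (U₂.deriv_L (p.1, φ (I₁ p)) hp.1 hp.2.1 h3)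
  exact ⟨ε, hε, M, hM0, P, hPan, hPle, hleP, hPper, hPleaf⟩

/-- The conjugacy in logarithmic coordinates is `2πi`-periodic and bounded, so that it descends to a
neighbourhood of the origin; the conjugacy relation, known on a slit neighbourhood, extends by
density. -/
theorem exists_isConjugacy_of_germConjugate {μ r₁ r₂ : ℝ} (F₁ F₂ : SiegelFoliation l₁ l₂)
    (hr₁ : F₁.AdmissibleRadius r₁) (hr₂ : F₂.AdmissibleRadius r₂) (hl₁ : l₁ ≠ 0)
    (hμl : l₂ / l₁ = μ) (hμ : μ < 0)
    (hconj : GermConjugate (F₁.holonomy r₁) (F₂.holonomy r₂)) :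
    ∃ Φ : ℂ × ℂ → ℂ × ℂ, IsConjugacy F₁ F₂ Φ ∧ ∀ᶠ x in 𝓝 (0 : ℂ), (Φ (x, 0)).2 = 0 := by
  have hB : 2 * Real.pi < 7 := by linarith [Real.pi_lt_d2]
  have hr₁0 := hr₁.1
  have hr₂0 := hr₂.1
  have hr₁' : (r₁ : ℂ) ≠ 0 := Complex.ofReal_ne_zero.2 hr₁0.ne'
  have hr₂' : (r₂ : ℂ) ≠ 0 := Complex.ofReal_ne_zero.2 hr₂0.ne'
  obtain ⟨ε, hε, M, hM0, P, hPan, hPle, hleP, hPper, hPleaf⟩ :=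
    exists_log_conjugacy F₁ F₂ hr₁ hr₂ hl₁ hμl hμ hconj
  obtain ⟨Q, hQan, hQP⟩ := exists_analyticOnNhd_descent (M := M * ε) hr₁0 hB hPan
    (fun p hp => (hPle p hp).trans (by gcongr; exact hp.2.2.le)) hPper
  set V := ball (0 : ℂ) (r₁ / 2) ×ˢ ball (0 : ℂ) ε with hV
  have hVo : IsOpen V := isOpen_ball.prod isOpen_ball
  have h0V : (0 : ℂ × ℂ) ∈ V := ⟨mem_ball_self (by positivity), mem_ball_self hε⟩
  -- logarithmic coordinates on the slit neighbourhood
  have hlogc : ∀ p ∈ V ∩ (Complex.slitPlane ×ˢ univ), ∃ s : ℂ, p.1 = r₁ * Complex.exp s ∧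
      -Real.pi < s.im ∧ s.im < Real.pi ∧ (s, p.2) ∈ labelDomain 7 ε := by
    rintro p ⟨hp, hps, -⟩
    have hp0 : p.1 ≠ 0 := Complex.slitPlane_ne_zero hps
    have hpr : p.1 / r₁ ≠ 0 := div_ne_zero hp0 hr₁'
    have hn : ‖p.1 / r₁‖ < 1 := by
      rw [norm_div, Complex.norm_real, Real.norm_eq_abs, abs_of_pos hr₁0, div_lt_one hr₁0]
      have : ‖p.1‖ < r₁ / 2 := by simpa using hp.1
      linarith
    have him : (Complex.log (p.1 / r₁)).im = Complex.arg p.1 := by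
      rw [Complex.log_im, div_eq_mul_inv, ← Complex.ofReal_inv, Complex.arg_mul_real (by positivity)]
    have h1 := Complex.neg_pi_lt_arg p.1
    have h2 : Complex.arg p.1 < Real.pi :=
      lt_of_le_of_ne (Complex.arg_le_pi _) (Complex.slitPlane_arg_ne_pi hps)
    refine ⟨Complex.log (p.1 / r₁), ?_, by rw [him]; exact h1, by rw [him]; exact h2, ?_, ?_,
      by simpa using hp.2⟩
    · rw [Complex.exp_log hpr, mul_div_cancel₀ _ hr₁']
    · simp only
      rw [Complex.log_re]; exact Real.log_neg (norm_pos_iff.2 hpr) hn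
    · simp only
      rw [him, abs_lt]
      constructor <;> linarith [Real.pi_pos]
  have hQle : ∀ p ∈ V, ‖Q p‖ ≤ M * ‖p.2‖ := by
    intro p hp
    refine ContinuousWithinAt.closure_le (subset_closure_slitPlane_prod hVo hp)
      ((hQan p hp).continuousAt.norm.continuousWithinAt)
      (continuous_const.mul continuous_snd.norm).continuousWithinAt ?_
    rintro q hq
    obtain ⟨s, hs, h1, h2, h3⟩ := hlogc q hq
    have h4 : Q q = P (s, q.2) := by
      have h5 := hQP s q.2 h1 h2.le (by rw [← hs]; exact hq.1)
      rwa [← hs] at h5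
    rw [h4]
    exact hPle _ h3
  have hleQ : ∀ p ∈ V, ‖p.2‖ ≤ M * ‖Q p‖ := by
    intro p hp
    refine ContinuousWithinAt.closure_le (subset_closure_slitPlane_prod hVo hp)
      continuous_snd.norm.continuousWithinAt
      ((hQan p hp).continuousAt.norm.continuousWithinAt.const_smul M) ?_
    rintro q hq
    obtain ⟨s, hs, h1, h2, h3⟩ := hlogc q hq
    have h4 : Q q = P (s, q.2) := by
      have h5 := hQP s q.2 h1 h2.le (by rw [← hs]; exact hq.1)
      rwa [← hs] at h5
    simp only [Pi.smul_apply, smul_eq_mul]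
    rw [h4]
    exact hleP _ h3
  have hQ0 : ∀ x : ℂ, ‖x‖ < r₁ / 2 → Q (x, 0) = 0 := by
    intro x hx
    have := hQle (x, 0) ⟨by simpa using hx, mem_ball_self hε⟩
    simpa using this
  have hQ00 : Q 0 = 0 := hQ0 0 (by simpa using hr₁0)
  have hQleaf : ∀ p ∈ V ∩ (Complex.slitPlane ×ˢ univ),
      fderiv ℂ Q p (p.1, μ * p.2 * F₁.slope p) = μ * Q p * F₂.slope (r₂ / r₁ * p.1, Q p) := by
    intro p hp
    obtain ⟨s, hs, h1, h2, h3⟩ := hlogc p hp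
    have hQp : Q p = P (s, p.2) := by
      have h5 := hQP s p.2 h1 h2.le (by rw [← hs]; exact hp.1)
      rwa [← hs] at h5
    set b := μ * p.2 * F₁.slope p with hb
    have hline : HasDerivAt (fun t : ℂ => (s + t, p.2 + t * b)) ((1 : ℂ), b) 0 := by
      refine ((hasDerivAt_id (0 : ℂ)).const_add s).prodMk ?_
      simpa using ((hasDerivAt_id (0 : ℂ)).mul_const b).const_add p.2
    have hexpl : HasDerivAt (fun t : ℂ => ((r₁ : ℂ) * Complex.exp (s + t), p.2 + t * b)) (p.1, b)
        0 := by
      refine HasDerivAt.prodMk ?_ ?_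
      · have := (((hasDerivAt_id (0 : ℂ)).const_add s).cexp).const_mul (r₁ : ℂ)
        simpa [hs] using this
      · simpa using ((hasDerivAt_id (0 : ℂ)).mul_const b).const_add p.2
    have hPd : HasFDerivAt P (fderiv ℂ P (s, p.2)) (s + 0, p.2 + 0 * b) := by
      rw [add_zero, zero_mul, add_zero]
      exact (hPan _ h3).differentiableAt.hasFDerivAt
    have hbase : ((r₁ : ℂ) * Complex.exp (s + 0), p.2 + 0 * b) = p := by
      rw [add_zero, zero_mul, add_zero, ← hs]
    have hQd : HasFDerivAt Q (fderiv ℂ Q p) ((r₁ : ℂ) * Complex.exp (s + 0), p.2 + 0 * b) := by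
      rw [hbase]
      exact (hQan p hp.1).differentiableAt.hasFDerivAt
    have e1 := hPd.comp_hasDerivAt 0 hline
    have e2 := hQd.comp_hasDerivAt 0 hexpl
    have hev : (Q ∘ fun t : ℂ => ((r₁ : ℂ) * Complex.exp (s + t), p.2 + t * b)) =ᶠ[𝓝 0]
        (P ∘ fun t : ℂ => (s + t, p.2 + t * b)) := by
      have c1 : ContinuousAt (fun t : ℂ => (s + t).im) 0 := by fun_prop
      have c1' : (s + 0).im = s.im := by rw [add_zero]
      have m1 := c1.eventually (lt_mem_nhds (show -Real.pi < (s + 0).im by rw [c1']; exact h1))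
      have m2 := c1.eventually (gt_mem_nhds (show (s + 0).im < Real.pi by rw [c1']; exact h2))
      have m3 : ∀ᶠ t : ℂ in 𝓝 0, ((r₁ : ℂ) * Complex.exp (s + t), p.2 + t * b) ∈ V :=
        hexpl.continuousAt.eventually (hVo.mem_nhds (by
          show ((r₁ : ℂ) * Complex.exp (s + 0), p.2 + 0 * b) ∈ V
          rw [hbase]; exact hp.1))
      filter_upwards [m1, m2, m3] with t t1 t2 t3
      exact hQP _ _ t1 t2.le t3
    have e3 := e2.unique (e1.congr_of_eventuallyEq hev)
    rw [e3]
    have hsl : F₁.slope p = F₁.slope (r₁ * Complex.exp s, p.2) := by rw [← hs]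
    have h6 := hPleaf (s, p.2) h3
    simp only at h6
    rw [hb, hsl, h6, hQp]
    congr 3
    rw [hs]
    field_simp
  set Φ : ℂ × ℂ → ℂ × ℂ := fun p => ((r₂ / r₁ : ℂ) * p.1, Q p) with hΦ
  have hΦan : ∀ p ∈ V, AnalyticAt ℂ Φ p := fun p hp =>
    (analyticAt_const.mul analyticAt_fst).prod (hQan p hp)
  have hΦ0 : Φ 0 = 0 := by simp [hΦ, hQ00]
  have hΦgerm : IsGermDiffeo Φ := by
    refine isGermDiffeo_of_norm_le (K := max M (r₁ / r₂)) (hΦan 0 h0V) hΦ0 ?_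
    filter_upwards [hVo.mem_nhds h0V] with p hp
    have n1 : ‖(r₂ / r₁ : ℂ) * p.1‖ ≤ ‖Φ p‖ := norm_fst_le (Φ p)
    have n2 : ‖Q p‖ ≤ ‖Φ p‖ := norm_snd_le (Φ p)
    rw [Prod.norm_def p]
    refine max_le ?_ ?_
    · have : ‖p.1‖ = r₁ / r₂ * ‖(r₂ / r₁ : ℂ) * p.1‖ := by
        rw [norm_mul, norm_div, Complex.norm_real, Complex.norm_real, Real.norm_eq_abs,
          Real.norm_eq_abs, abs_of_pos hr₁0, abs_of_pos hr₂0]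
        field_simp
      rw [this]
      gcongr
      exact le_max_right _ _
    · refine (hleQ p hp).trans ?_
      gcongr
      exact le_max_left _ _
  -- a smaller neighbourhood, on which both vector fields are holomorphic
  have hΦc : Tendsto Φ (𝓝 0) (𝓝 0) := by
    have := (hΦan 0 h0V).continuousAt.tendsto
    rwa [hΦ0] at this
  obtain ⟨W, hWsub, hWo, h0W⟩ := _root_.mem_nhds_iff.1 (inter_mem (inter_mem (hVo.mem_nhds h0V)
    (F₁.isOpen_regularSet.mem_nhds F₁.zero_mem_regularSet))
    (hΦc (F₂.isOpen_regularSet.mem_nhds F₂.zero_mem_regularSet)))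
  have hWV : ∀ p ∈ W, p ∈ V := fun p hp => (hWsub hp).1.1
  have hW1 : ∀ p ∈ W, p ∈ F₁.regularSet := fun p hp => (hWsub hp).1.2
  have hW2 : ∀ p ∈ W, Φ p ∈ F₂.regularSet := fun p hp => (hWsub hp).2
  have hf₂Φ : ∀ p ∈ W, AnalyticAt ℂ (fun p => F₂.f (Φ p)) p := fun p hp =>
    AnalyticAt.comp (g := F₂.f) (hW2 p hp).1 (hΦan p (hWV p hp))
  have hg₂Φ : ∀ p ∈ W, AnalyticAt ℂ (fun p => F₂.g (Φ p)) p := fun p hp =>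
    AnalyticAt.comp (g := F₂.g) (hW2 p hp).2.1 (hΦan p (hWV p hp))
  set u : ℂ × ℂ → ℂ := fun p => (1 + F₁.f p) / (1 + F₂.f (Φ p)) with hu
  have hua : ∀ p ∈ W, AnalyticAt ℂ u p := fun p hp =>
    (analyticAt_const.add (hW1 p hp).1).div (analyticAt_const.add (hf₂Φ p hp)) (hW2 p hp).2.2
  have hΦfd : ∀ p ∈ V, ∀ v, fderiv ℂ Φ p v = ((r₂ / r₁ : ℂ) * v.1, fderiv ℂ Q p v) := by
    intro p hp v
    have h1 : HasFDerivAt (fun p : ℂ × ℂ => (r₂ / r₁ : ℂ) * p.1)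
        ((r₂ / r₁ : ℂ) • ContinuousLinearMap.fst ℂ ℂ ℂ) p := hasFDerivAt_fst.const_mul _
    have h2 : HasFDerivAt Φ _ p := h1.prodMk (hQan p hp).differentiableAt.hasFDerivAt
    rw [h2.fderiv]
    simp
  have hμl' : l₂ = μ * l₁ := by rw [← hμl]; field_simp
  have hslit : EqOn (fun p => fderiv ℂ Φ p (F₁.field p)) (fun p => u p • F₂.field (Φ p))
      (W ∩ (Complex.slitPlane ×ˢ univ)) := by
    intro p hp
    have hpV := hWV p hp.1
    have hf1 := (hW1 p hp.1).2.2
    have hf2 := (hW2 p hp.1).2.2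
    have hleaf := hQleaf p ⟨hpV, hp.2⟩
    have hfield : F₁.field p = (l₁ * (1 + F₁.f p)) • (p.1, μ * p.2 * F₁.slope p) := by
      simp only [field, slope, hμl', Prod.smul_mk, smul_eq_mul, Prod.mk.injEq]
      constructor
      · ring
      · field_simp
    simp only
    rw [hfield, map_smul, hΦfd p hpV, hleaf]
    have hslope2 : F₂.slope (r₂ / r₁ * p.1, Q p) = (1 + F₂.g (Φ p)) / (1 + F₂.f (Φ p)) := rfl
    rw [hslope2]
    simp only [field, hu, hμl', Prod.smul_mk, smul_eq_mul, Prod.mk.injEq]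
    have hΦ1 : (Φ p).1 = r₂ / r₁ * p.1 := rfl
    have hΦ2 : (Φ p).2 = Q p := rfl
    rw [hΦ1, hΦ2]
    constructor
    · field_simp
    · field_simp
  have hfield_cont : ContinuousOn (fun p => fderiv ℂ Φ p (F₁.field p)) W := by
    intro p hp
    refine ContinuousAt.continuousWithinAt ?_
    have h1 := (hΦan p (hWV p hp)).fderiv.continuousAt
    have hf := (hW1 p hp).1.continuousAt
    have hg := (hW1 p hp).2.1.continuousAt
    refine h1.clm_apply ?_
    unfold field
    fun_prop
  have hfield_cont' : ContinuousOn (fun p => u p • F₂.field (Φ p)) W := by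
    intro p hp
    refine ContinuousAt.continuousWithinAt ?_
    have h1 := (hua p hp).continuousAt
    have hf := (hf₂Φ p hp).continuousAt
    have hg := (hg₂Φ p hp).continuousAt
    have h2 := (hΦan p (hWV p hp)).continuousAt
    unfold field
    fun_prop
  refine ⟨Φ, ⟨hΦgerm, u, hua 0 h0W, ?_, ?_⟩, ?_⟩
  · simp [hu, hΦ0, F₁.f_zero, F₂.f_zero]
  · filter_upwards [hWo.mem_nhds h0W] with p hp
    exact hslit.of_subset_closure hfield_cont hfield_cont' inter_subset_left
      (subset_closure_slitPlane_prod hWo) hp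
  · filter_upwards [ball_mem_nhds (0 : ℂ) (show 0 < r₁ / 2 by positivity)] with x hx
    exact hQ0 x (by simpa using hx)

end SiegelFoliation

/-! ### Separatrices are preserved by conjugacies -/

/-- The equation `x b' = c b` has no nonzero holomorphic solution vanishing at `0` if `c 0` is not a
positive integer: compare the orders of vanishing. -/
theorem eventually_eq_zero_of_mul_deriv_eq {b c : ℂ → ℂ} (hb : AnalyticAt ℂ b 0) (hb0 : b 0 = 0)
    (hc : ContinuousAt c 0) (hc0 : ∀ n : ℕ, n ≠ 0 → c 0 ≠ n)
    (h : ∀ᶠ x in 𝓝 (0 : ℂ), x * deriv b x = c x * b x) : ∀ᶠ x in 𝓝 (0 : ℂ), b x = 0 := by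
  by_contra hne
  obtain ⟨n, g, hg, hg0, hbg⟩ := hb.exists_eventuallyEq_pow_smul_nonzero_iff.2 hne
  simp only [sub_zero, smul_eq_mul] at hbg
  have hn : n ≠ 0 := by
    rintro rfl
    have := hbg.self_of_nhds
    rw [hb0, pow_zero, one_mul] at this
    exact hg0 this.symm
  have hkey : ∀ᶠ x in 𝓝[≠] (0 : ℂ), (n : ℂ) * g x + x * deriv g x = c x * g x := by
    have h1 := hbg.eventually_nhds
    filter_upwards [nhdsWithin_le_nhds h1, nhdsWithin_le_nhds h,
      nhdsWithin_le_nhds hg.eventually_analyticAt, self_mem_nhdsWithin] with x hx hx' hgx hx0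
    have hd : deriv b x = n * x ^ (n - 1) * g x + x ^ n * deriv g x := by
      rw [EventuallyEq.deriv_eq hx]
      exact ((hasDerivAt_pow n x).mul hgx.differentiableAt.hasDerivAt).deriv
    rw [hd, hx.self_of_nhds] at hx'
    have hxn : x ^ n ≠ 0 := pow_ne_zero n hx0
    have hpow : x * x ^ (n - 1) = x ^ n := mul_pow_sub_one hn x
    refine mul_left_cancel₀ hxn ?_
    calc x ^ n * (n * g x + x * deriv g x)
        = x * x ^ (n - 1) * (n * g x) + x * (x ^ n * deriv g x) := by rw [hpow]; ring
      _ = x * (n * x ^ (n - 1) * g x + x ^ n * deriv g x) := by ring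
      _ = x ^ n * (c x * g x) := by rw [hx']; ring
  have hgd : ContinuousAt (deriv g) 0 := hg.deriv.continuousAt
  have hgc := hg.continuousAt
  have h1 : ContinuousAt (fun x => (n : ℂ) * g x + x * deriv g x) 0 := by fun_prop
  have h2 : ContinuousAt (fun x => c x * g x) 0 := by fun_prop
  have h3 := tendsto_nhds_unique_of_eventuallyEq (h1.tendsto.mono_left nhdsWithin_le_nhds)
    (h2.tendsto.mono_left nhdsWithin_le_nhds) hkey
  rw [zero_mul, add_zero] at h3
  exact hc0 n hn (mul_right_cancel₀ hg0 h3).symm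

theorem IsGermDiffeo.fderiv_eq_zero {E : Type*} [NormedAddCommGroup E] [NormedSpace ℂ E]
    {φ : E → E} (hφ : IsGermDiffeo φ) {v : E} (hv : fderiv ℂ φ 0 v = 0) : v = 0 := by
  obtain ⟨hφa, hφ0, ψ, hψa, hψ0, hl, -⟩ := hφ
  have h1 : HasFDerivAt ψ (fderiv ℂ ψ 0) (φ 0) := by
    rw [hφ0]; exact hψa.differentiableAt.hasFDerivAt
  have h2 := h1.comp (0 : E) hφa.differentiableAt.hasFDerivAt
  have h3 := h2.unique ((hasFDerivAt_id (𝕜 := ℂ) (0 : E)).congr_of_eventuallyEq hl)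
  have h4 := congrArg (fun T : E →L[ℂ] E => T v) h3
  simpa [hv] using h4.symm

/-- If `ψ` vanishes on the image of the linear map `π`, then the error in approximating `ψ p` by the
linear part of `ψ` at `p - π p` is small compared with `p - π p` alone. For a projection `π` on an
axis, this is an estimate by the distance to the axis. -/
theorem AnalyticAt.eventually_norm_sub_le {E : Type*} [NormedAddCommGroup E] [NormedSpace ℂ E]
    {ψ : E → ℂ} (hψ : AnalyticAt ℂ ψ 0) {π : E →L[ℂ] E} (h : ∀ᶠ p in 𝓝 (0 : E), ψ (π p) = 0)
    {κ : ℝ} (hκ : 0 < κ) :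
    ∀ᶠ p in 𝓝 (0 : E), ‖ψ p - fderiv ℂ ψ 0 (p - π p)‖ ≤ κ * ‖p - π p‖ := by
  have h1 := (hψ.hasStrictFDerivAt.isLittleO).def hκ
  have h2 : Tendsto (fun p => (p, π p)) (𝓝 (0 : E)) (𝓝 ((0 : E), (0 : E))) := by
    have : ContinuousAt (fun p => (p, π p)) (0 : E) := by fun_prop
    simpa using this.tendsto
  filter_upwards [h2.eventually h1, h] with p hp hp'
  simpa [hp'] using hp

namespace SiegelFoliation

variable {l₁ l₂ : ℂ} {F₁ F₂ : SiegelFoliation l₁ l₂} {Φ : ℂ × ℂ → ℂ × ℂ} {u : ℂ × ℂ → ℂ}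

/-- The relation between the linear parts of a conjugacy and of the vector fields. -/
theorem fderiv_linear_eq (hΦ : IsGermDiffeo Φ) (hu : AnalyticAt ℂ u 0)
    (hconj : ∀ᶠ p in 𝓝 (0 : ℂ × ℂ), fderiv ℂ Φ p (F₁.field p) = u p • F₂.field (Φ p))
    (v : ℂ × ℂ) :
    fderiv ℂ Φ 0 (l₁ * v.1, l₂ * v.2) =
      u 0 • (l₁ * (fderiv ℂ Φ 0 v).1, l₂ * (fderiv ℂ Φ 0 v).2) := by
  have hΦa := hΦ.1
  have hΦ0 := hΦ.2.1
  have hray : Continuous (fun t : ℂ => t • v) := by fun_prop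
  have hray0 : Tendsto (fun t : ℂ => t • v) (𝓝[≠] 0) (𝓝 0) := by
    have h1 := hray.tendsto 0
    rw [zero_smul] at h1
    exact h1.mono_left nhdsWithin_le_nhds
  have hΦray : Tendsto (fun t : ℂ => Φ (t • v)) (𝓝[≠] 0) (𝓝 0) := by
    have := hΦa.continuousAt.tendsto
    rw [hΦ0] at this
    exact this.comp hray0
  have hslope : Tendsto (fun t : ℂ => t⁻¹ • Φ (t • v)) (𝓝[≠] 0) (𝓝 (fderiv ℂ Φ 0 v)) := by
    have h1 : HasFDerivAt Φ (fderiv ℂ Φ 0) ((0 : ℂ) • v) := by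
      rw [zero_smul]; exact hΦa.differentiableAt.hasFDerivAt
    have h2 : HasDerivAt (fun t : ℂ => t • v) v 0 := by
      simpa using (hasDerivAt_id (0 : ℂ)).smul_const v
    have h3 := hasDerivAt_iff_tendsto_slope.1 (h1.comp_hasDerivAt (0 : ℂ) h2)
    refine h3.congr fun t => ?_
    simp [slope_def_module, hΦ0]
  have hf₁ : Tendsto (fun t : ℂ => F₁.f (t • v)) (𝓝[≠] 0) (𝓝 0) := by
    have := F₁.f_analytic.continuousAt.tendsto.comp hray0
    rwa [F₁.f_zero] at this
  have hg₁ : Tendsto (fun t : ℂ => F₁.g (t • v)) (𝓝[≠] 0) (𝓝 0) := by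
    have := F₁.g_analytic.continuousAt.tendsto.comp hray0
    rwa [F₁.g_zero] at this
  have hf₂ : Tendsto (fun t : ℂ => F₂.f (Φ (t • v))) (𝓝[≠] 0) (𝓝 0) := by
    have := F₂.f_analytic.continuousAt.tendsto.comp hΦray
    rwa [F₂.f_zero] at this
  have hg₂ : Tendsto (fun t : ℂ => F₂.g (Φ (t • v))) (𝓝[≠] 0) (𝓝 0) := by
    have := F₂.g_analytic.continuousAt.tendsto.comp hΦray
    rwa [F₂.g_zero] at this
  have hD : Tendsto (fun t : ℂ => fderiv ℂ Φ (t • v)) (𝓝[≠] 0) (𝓝 (fderiv ℂ Φ 0)) :=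
    hΦa.fderiv.continuousAt.tendsto.comp hray0
  have hL : Tendsto (fun t : ℂ => fderiv ℂ Φ (t • v)
      (l₁ * v.1 * (1 + F₁.f (t • v)), l₂ * v.2 * (1 + F₁.g (t • v)))) (𝓝[≠] 0)
      (𝓝 (fderiv ℂ Φ 0 (l₁ * v.1, l₂ * v.2))) := by
    refine (isBoundedBilinearMap_apply (𝕜 := ℂ) (E := ℂ × ℂ) (F := ℂ × ℂ)).continuous.tendsto
      (fderiv ℂ Φ 0, (l₁ * v.1, l₂ * v.2)) |>.comp (hD.prodMk_nhds (Tendsto.prodMk_nhds ?_ ?_))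
    · simpa using (hf₁.const_add 1).const_mul (l₁ * v.1)
    · simpa using (hg₁.const_add 1).const_mul (l₂ * v.2)
  have hR : Tendsto (fun t : ℂ => u (t • v) • (l₁ * (t⁻¹ • Φ (t • v)).1 * (1 + F₂.f (Φ (t • v))),
      l₂ * (t⁻¹ • Φ (t • v)).2 * (1 + F₂.g (Φ (t • v))))) (𝓝[≠] 0)
      (𝓝 (u 0 • (l₁ * (fderiv ℂ Φ 0 v).1, l₂ * (fderiv ℂ Φ 0 v).2))) := by
    refine (hu.continuousAt.tendsto.comp hray0).smul (Tendsto.prodMk_nhds ?_ ?_)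
    · simpa using (((continuous_fst.tendsto _).comp hslope).const_mul l₁).mul (hf₂.const_add 1)
    · simpa using (((continuous_snd.tendsto _).comp hslope).const_mul l₂).mul (hg₂.const_add 1)
  refine tendsto_nhds_unique_of_eventuallyEq hL hR ?_
  filter_upwards [hray0.eventually hconj, self_mem_nhdsWithin] with t ht ht0
  have ht0' : t ≠ 0 := ht0
  have h1 : F₁.field (t • v) =
      t • (l₁ * v.1 * (1 + F₁.f (t • v)), l₂ * v.2 * (1 + F₁.g (t • v))) := by
    simp only [field, Prod.smul_mk, smul_eq_mul, Prod.mk.injEq, Prod.smul_fst, Prod.smul_snd]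
    constructor <;> ring
  have h2 : F₂.field (Φ (t • v)) = t • (l₁ * (t⁻¹ • Φ (t • v)).1 * (1 + F₂.f (Φ (t • v))),
      l₂ * (t⁻¹ • Φ (t • v)).2 * (1 + F₂.g (Φ (t • v)))) := by
    simp only [field, Prod.smul_mk, smul_eq_mul, Prod.mk.injEq, Prod.smul_fst, Prod.smul_snd]
    constructor <;> field_simp
  rw [h1, h2, map_smul, smul_comm] at ht
  exact smul_right_injective _ ht0' ht

/-- If the axis `{y = 0}` is preserved, the unit of the conjugacy is `1` at the origin. -/
theorem unit_eq_one_of_axis (hl₁ : l₁ ≠ 0) (hΦ : IsGermDiffeo Φ) (hu : AnalyticAt ℂ u 0)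
    (hconj : ∀ᶠ p in 𝓝 (0 : ℂ × ℂ), fderiv ℂ Φ p (F₁.field p) = u p • F₂.field (Φ p))
    (haxis : ∀ᶠ x in 𝓝 (0 : ℂ), (Φ (x, 0)).2 = 0) : u 0 = 1 := by
  have hc : HasDerivAt (fun x : ℂ => (x, (0 : ℂ))) ((1 : ℂ), (0 : ℂ)) 0 :=
    (hasDerivAt_id (0 : ℂ)).prodMk (hasDerivAt_const _ _)
  have h1 : HasFDerivAt Φ (fderiv ℂ Φ 0) ((0 : ℂ), (0 : ℂ)) := hΦ.1.differentiableAt.hasFDerivAt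
  have h2 := (ContinuousLinearMap.snd ℂ ℂ ℂ).hasFDerivAt.comp_hasDerivAt (0 : ℂ)
    (HasFDerivAt.comp_hasDerivAt (f := fun x : ℂ => (x, (0 : ℂ))) (0 : ℂ) h1 hc)
  have h3 : (fderiv ℂ Φ 0 ((1 : ℂ), (0 : ℂ))).2 = 0 :=
    h2.unique ((hasDerivAt_const (0 : ℂ) (0 : ℂ)).congr_of_eventuallyEq haxis)
  have h4 : (fderiv ℂ Φ 0 ((1 : ℂ), (0 : ℂ))).1 ≠ 0 := by
    intro h0
    have := hΦ.fderiv_eq_zero (Prod.ext h0 h3)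
    simp at this
  have e1 := fderiv_linear_eq hΦ hu hconj ((1 : ℂ), (0 : ℂ))
  have h6 : ((l₁ * 1, l₂ * 0) : ℂ × ℂ) = l₁ • ((1 : ℂ), (0 : ℂ)) := by simp
  simp only [h6, map_smul] at e1
  have h5 := congrArg Prod.fst e1
  simp only [Prod.smul_fst, smul_eq_mul, Prod.smul_mk] at h5
  have h7 : l₁ * (fderiv ℂ Φ 0 ((1 : ℂ), (0 : ℂ))).1 ≠ 0 := mul_ne_zero hl₁ h4
  exact (mul_right_cancel₀ h7 (by rw [one_mul]; exact h5)).symm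

/-- The eigenvalues `l₁, l₂` are permuted, up to the factor `u 0`; unless `l₁ = -l₂` this forces
`u 0 = 1`. -/
theorem unit_eq_one_of_ne (hl₁ : l₁ ≠ 0) (hl₂ : l₂ ≠ 0) (hne : l₁ ≠ -l₂) (hΦ : IsGermDiffeo Φ)
    (hu : AnalyticAt ℂ u 0)
    (hconj : ∀ᶠ p in 𝓝 (0 : ℂ × ℂ), fderiv ℂ Φ p (F₁.field p) = u p • F₂.field (Φ p)) :
    u 0 = 1 := by
  by_contra hu1
  have e1 := fderiv_linear_eq hΦ hu hconj ((1 : ℂ), (0 : ℂ))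
  have e2 := fderiv_linear_eq hΦ hu hconj ((0 : ℂ), (1 : ℂ))
  have h6 : ((l₁ * 1, l₂ * 0) : ℂ × ℂ) = l₁ • ((1 : ℂ), (0 : ℂ)) := by simp
  have h7 : ((l₁ * 0, l₂ * 1) : ℂ × ℂ) = l₂ • ((0 : ℂ), (1 : ℂ)) := by simp
  simp only [h6, map_smul] at e1
  simp only [h7, map_smul] at e2
  have n1 : fderiv ℂ Φ 0 ((1 : ℂ), (0 : ℂ)) ≠ 0 := fun h0 => by
    have := hΦ.fderiv_eq_zero h0
    simp at this
  have n2 : fderiv ℂ Φ 0 ((0 : ℂ), (1 : ℂ)) ≠ 0 := fun h0 => by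
    have := hΦ.fderiv_eq_zero h0
    simp at this
  set A := fderiv ℂ Φ 0 ((1 : ℂ), (0 : ℂ))
  set D := fderiv ℂ Φ 0 ((0 : ℂ), (1 : ℂ))
  have a1 := congrArg Prod.fst e1
  have a2 := congrArg Prod.snd e1
  have d1 := congrArg Prod.fst e2
  have d2 := congrArg Prod.snd e2
  simp only [Prod.smul_fst, Prod.smul_snd, smul_eq_mul, Prod.smul_mk] at a1 a2 d1 d2
  have hA1 : A.1 = 0 := by
    by_contra h0
    exact hu1 (mul_right_cancel₀ (mul_ne_zero hl₁ h0) (by rw [one_mul]; exact a1.symm))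
  have hD2 : D.2 = 0 := by
    by_contra h0
    exact hu1 (mul_right_cancel₀ (mul_ne_zero hl₂ h0) (by rw [one_mul]; exact d2.symm))
  have hA2 : A.2 ≠ 0 := fun h0 => n1 (Prod.ext hA1 h0)
  have hD1 : D.1 ≠ 0 := fun h0 => n2 (Prod.ext h0 hD2)
  have b1 : l₁ = u 0 * l₂ := mul_right_cancel₀ hA2 (by rw [a2]; ring)
  have b2 : l₂ = u 0 * l₁ := mul_right_cancel₀ hD1 (by rw [d1]; ring)
  have hsq : (u 0 - 1) * (u 0 + 1) = 0 := by
    have : l₁ * ((u 0 - 1) * (u 0 + 1)) = 0 := by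
      have : l₁ = u 0 * (u 0 * l₁) := by rw [← b2]; exact b1
      linear_combination -this
    exact (mul_eq_zero.1 this).resolve_left hl₁
  rcases mul_eq_zero.1 hsq with h0 | h0
  · exact hu1 (sub_eq_zero.1 h0)
  · refine hne ?_
    rw [b1, eq_neg_of_add_eq_zero_left h0]
    ring

/-- The second component `b` of the image of the axis `{y = 0}` solves `x b' = c b` with
`c 0 = l₂ / l₁`, which is negative. -/
theorem eventually_snd_eq_zero {μ : ℝ} (hl₁ : l₁ ≠ 0) (hμl : l₂ / l₁ = μ) (hμ : μ < 0)
    (hΦ : IsGermDiffeo Φ) (hu : AnalyticAt ℂ u 0) (hu1 : u 0 = 1)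
    (hconj : ∀ᶠ p in 𝓝 (0 : ℂ × ℂ), fderiv ℂ Φ p (F₁.field p) = u p • F₂.field (Φ p)) :
    ∀ᶠ x in 𝓝 (0 : ℂ), (Φ (x, 0)).2 = 0 := by
  have hι : Tendsto (fun x : ℂ => (x, (0 : ℂ))) (𝓝 0) (𝓝 0) :=
    (Continuous.prodMk_left (0 : ℂ)).tendsto 0
  have hιa : AnalyticAt ℂ (fun x : ℂ => (x, (0 : ℂ))) 0 := analyticAt_id.prod analyticAt_const
  have hΦι : AnalyticAt ℂ (fun x : ℂ => Φ (x, 0)) 0 :=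
    AnalyticAt.comp (g := Φ) (f := fun x : ℂ => (x, (0 : ℂ))) hΦ.1 hιa
  have hΦ00 : Φ ((0 : ℂ), (0 : ℂ)) = 0 := hΦ.2.1
  have hf₁ : ContinuousAt (fun x : ℂ => F₁.f (x, 0)) 0 :=
    (AnalyticAt.comp (g := F₁.f) (f := fun x : ℂ => (x, (0 : ℂ))) F₁.f_analytic hιa).continuousAt
  have hg₂ : ContinuousAt (fun x : ℂ => F₂.g (Φ (x, 0))) 0 := by
    refine ContinuousAt.comp (g := F₂.g) (f := fun x : ℂ => Φ (x, 0)) ?_ hΦι.continuousAt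
    rw [hΦ00]; exact F₂.g_analytic.continuousAt
  have huι : ContinuousAt (fun x : ℂ => u (x, 0)) 0 :=
    (AnalyticAt.comp (g := u) (f := fun x : ℂ => (x, (0 : ℂ))) hu hιa).continuousAt
  have hf₁0 : F₁.f ((0 : ℂ), (0 : ℂ)) = 0 := F₁.f_zero
  have hne : 1 + F₁.f ((0 : ℂ), (0 : ℂ)) ≠ 0 := by simp [hf₁0]
  refine eventually_eq_zero_of_mul_deriv_eq
    (c := fun x => u (x, 0) * μ * (1 + F₂.g (Φ (x, 0))) / (1 + F₁.f (x, 0))) ?_ (by simp [hΦ00]) ?_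
    ?_ ?_
  · exact AnalyticAt.comp (g := Prod.snd) (f := fun x : ℂ => Φ (x, 0)) analyticAt_snd hΦι
  · exact ((huι.mul continuousAt_const).mul (continuousAt_const.add hg₂)).div
      (continuousAt_const.add hf₁) hne
  · intro n hn h0
    have h1 : u ((0 : ℂ), (0 : ℂ)) = 1 := hu1
    have h2 : F₂.g (0 : ℂ × ℂ) = 0 := F₂.g_zero
    rw [hΦ00, h1, h2, hf₁0] at h0
    simp only [one_mul, add_zero, mul_one, div_one] at h0
    have h3 : μ = n := by exact_mod_cast h0
    have h4 : (0 : ℝ) ≤ n := Nat.cast_nonneg n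
    linarith
  · have hev := hι.eventually (hconj.and (hΦ.1.eventually_analyticAt))
    have hnear : ∀ᶠ x in 𝓝 (0 : ℂ), 1 + F₁.f (x, 0) ≠ 0 :=
      (continuousAt_const.add hf₁).eventually_ne hne
    filter_upwards [hev, hnear] with x ⟨hx, hxa⟩ hxne
    have hc : HasDerivAt (fun x : ℂ => (x, (0 : ℂ))) ((1 : ℂ), (0 : ℂ)) x :=
      (hasDerivAt_id x).prodMk (hasDerivAt_const _ _)
    have hd := (ContinuousLinearMap.snd ℂ ℂ ℂ).hasFDerivAt.comp_hasDerivAt x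
      (hxa.differentiableAt.hasFDerivAt.comp_hasDerivAt x hc)
    have hd' : deriv (fun x : ℂ => (Φ (x, 0)).2) x = (fderiv ℂ Φ (x, 0) ((1 : ℂ), (0 : ℂ))).2 :=
      hd.deriv
    have hfield : F₁.field (x, 0) = (l₁ * x * (1 + F₁.f (x, 0))) • ((1 : ℂ), (0 : ℂ)) := by
      simp [field]
    have h5 := congrArg Prod.snd hx
    rw [hfield, map_smul] at h5
    simp only [Prod.smul_snd, smul_eq_mul, field] at h5
    rw [hd', div_mul_eq_mul_div, eq_div_iff hxne]
    have hμl' : l₂ = μ * l₁ := by rw [← hμl]; field_simp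
    refine mul_left_cancel₀ hl₁ ?_
    linear_combination h5 + u (x, 0) * (Φ (x, 0)).2 * (1 + F₂.g (Φ (x, 0))) * hμl'

/-- Exchanging the two coordinates. -/
def swap (F : SiegelFoliation l₁ l₂) : SiegelFoliation l₂ l₁ where
  f := fun p => F.g p.swap
  g := fun p => F.f p.swap
  f_analytic := AnalyticAt.comp (g := F.g) (f := Prod.swap) F.g_analytic
    (analyticAt_snd.prod analyticAt_fst)
  g_analytic := AnalyticAt.comp (g := F.f) (f := Prod.swap) F.f_analytic
    (analyticAt_snd.prod analyticAt_fst)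
  f_zero := F.g_zero
  g_zero := F.f_zero

/-- The statement for the other axis, by symmetry. -/
theorem eventually_fst_eq_zero {μ : ℝ} (hl₂ : l₂ ≠ 0) (hμl : l₂ / l₁ = μ)
    (hμ : μ < 0) (hΦ : IsGermDiffeo Φ) (hu : AnalyticAt ℂ u 0) (hu1 : u 0 = 1)
    (hconj : ∀ᶠ p in 𝓝 (0 : ℂ × ℂ), fderiv ℂ Φ p (F₁.field p) = u p • F₂.field (Φ p)) :
    ∀ᶠ y in 𝓝 (0 : ℂ), (Φ (0, y)).1 = 0 := by
  let σ : (ℂ × ℂ) ≃L[ℂ] (ℂ × ℂ) := ContinuousLinearEquiv.prodComm ℂ ℂ ℂ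
  have hσ : ∀ p, σ p = p.swap := fun p => rfl
  have hσσ : ∀ p, σ (σ p) = p := fun p => rfl
  have hσ0 : Tendsto σ (𝓝 0) (𝓝 0) := by
    have := σ.continuous.tendsto 0
    rwa [map_zero] at this
  have han : ∀ {ψ : ℂ × ℂ → ℂ × ℂ}, AnalyticAt ℂ ψ 0 → AnalyticAt ℂ (fun p => σ (ψ (σ p))) 0 := by
    intro ψ hψ
    refine AnalyticAt.comp (g := σ) (f := fun p => ψ (σ p)) (σ.analyticAt _) ?_
    refine AnalyticAt.comp (g := ψ) (f := σ) ?_ (σ.analyticAt _)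
    rw [map_zero]; exact hψ
  have hΦ' : IsGermDiffeo (fun p => σ (Φ (σ p))) := by
    obtain ⟨hΦa, hΦ0, ψ, hψa, hψ0, hl, hr⟩ := hΦ
    refine ⟨han hΦa, by simp [hΦ0], fun p => σ (ψ (σ p)), han hψa, by simp [hψ0], ?_, ?_⟩
    · filter_upwards [hσ0.eventually hl] with p hp
      rw [hσσ, hp, hσσ]
    · filter_upwards [hσ0.eventually hr] with p hp
      rw [hσσ, hp, hσσ]
  refine eventually_snd_eq_zero (F₁ := F₁.swap) (F₂ := F₂.swap) (Φ := fun p => σ (Φ (σ p)))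
    (u := fun p => u (σ p)) (μ := μ⁻¹) hl₂ ?_ (inv_lt_zero.2 hμ) hΦ' ?_ (by simpa using hu1) ?_
  · rw [Complex.ofReal_inv, ← hμl, inv_div]
  · refine AnalyticAt.comp (g := u) (f := σ) ?_ (σ.analyticAt _)
    rw [map_zero]; exact hu
  · filter_upwards [hσ0.eventually (hconj.and hΦ.1.eventually_analyticAt)] with p ⟨hp, hpa⟩
    have h1 : HasFDerivAt Φ (fderiv ℂ Φ (σ p)) (σ p) := hpa.differentiableAt.hasFDerivAt
    have h2 : HasFDerivAt (fun p => σ (Φ (σ p))) _ p :=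
      σ.hasFDerivAt.comp p (h1.comp p σ.hasFDerivAt)
    have hfield : ∀ (F : SiegelFoliation l₁ l₂) (q : ℂ × ℂ), F.swap.field q = σ (F.field (σ q)) :=
      fun F q => rfl
    rw [h2.fderiv, hfield, hfield, hσσ]
    simp only [ContinuousLinearMap.comp_apply, ContinuousLinearEquiv.coe_coe, hσσ, hp, map_smul]

end SiegelFoliation

/-! ### Conjugate foliations have conjugate holonomies -/

theorem AnalyticAt.eventually_norm_sub_mul_fst_le {ψ : ℂ × ℂ → ℂ} (hψ : AnalyticAt ℂ ψ 0)
    (h : ∀ᶠ y in 𝓝 (0 : ℂ), ψ (0, y) = 0) {κ : ℝ} (hκ : 0 < κ) :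
    ∀ᶠ p in 𝓝 (0 : ℂ × ℂ), ‖ψ p - fderiv ℂ ψ 0 (1, 0) * p.1‖ ≤ κ * ‖p.1‖ := by
  have h1 : ∀ᶠ p in 𝓝 (0 : ℂ × ℂ), ψ (((0 : ℂ × ℂ →L[ℂ] ℂ).prod
      (ContinuousLinearMap.snd ℂ ℂ ℂ)) p) = 0 := (continuous_snd.tendsto (0 : ℂ × ℂ)).eventually h
  filter_upwards [hψ.eventually_norm_sub_le h1 hκ] with p hp
  have h2 : p - ((0 : ℂ × ℂ →L[ℂ] ℂ).prod (ContinuousLinearMap.snd ℂ ℂ ℂ)) p =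
      p.1 • ((1 : ℂ), (0 : ℂ)) := by
    ext <;> simp
  have h3 : ‖p.1 • ((1 : ℂ), (0 : ℂ))‖ = ‖p.1‖ := by
    rw [norm_smul, Prod.norm_def]; simp
  rwa [h2, h3, map_smul, smul_eq_mul, mul_comm] at hp

theorem AnalyticAt.eventually_norm_sub_mul_snd_le {ψ : ℂ × ℂ → ℂ} (hψ : AnalyticAt ℂ ψ 0)
    (h : ∀ᶠ x in 𝓝 (0 : ℂ), ψ (x, 0) = 0) {κ : ℝ} (hκ : 0 < κ) :
    ∀ᶠ p in 𝓝 (0 : ℂ × ℂ), ‖ψ p - fderiv ℂ ψ 0 (0, 1) * p.2‖ ≤ κ * ‖p.2‖ := by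
  have h1 : ∀ᶠ p in 𝓝 (0 : ℂ × ℂ), ψ (((ContinuousLinearMap.fst ℂ ℂ ℂ).prod
      (0 : ℂ × ℂ →L[ℂ] ℂ)) p) = 0 := (continuous_fst.tendsto (0 : ℂ × ℂ)).eventually h
  filter_upwards [hψ.eventually_norm_sub_le h1 hκ] with p hp
  have h2 : p - ((ContinuousLinearMap.fst ℂ ℂ ℂ).prod (0 : ℂ × ℂ →L[ℂ] ℂ)) p =
      p.2 • ((0 : ℂ), (1 : ℂ)) := by
    ext <;> simp
  have h3 : ‖p.2 • ((0 : ℂ), (1 : ℂ))‖ = ‖p.2‖ := by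
    rw [norm_smul, Prod.norm_def]; simp
  rwa [h2, h3, map_smul, smul_eq_mul, mul_comm] at hp

theorem re_div_pos_of_norm_sub_le {α x X : ℂ} (hα : α ≠ 0) (hx : x ≠ 0)
    (h : ‖X - α * x‖ ≤ ‖α‖ / 2 * ‖x‖) : 0 < (X / (α * x)).re := by
  have hαx : α * x ≠ 0 := mul_ne_zero hα hx
  have h1 : ‖1 - X / (α * x)‖ ≤ 1 / 2 := by
    rw [one_sub_div hαx, norm_div, norm_sub_rev, div_le_iff₀ (norm_pos_iff.2 hαx), norm_mul]
    linarith
  have h2 := (Complex.re_le_norm (1 - X / (α * x))).trans h1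
  rw [Complex.sub_re, Complex.one_re] at h2
  linarith

namespace SiegelFoliation

variable {l₁ l₂ : ℂ} {F₁ F₂ : SiegelFoliation l₁ l₂} {Φ : ℂ × ℂ → ℂ × ℂ} {u : ℂ × ℂ → ℂ}

/-- A conjugacy preserving both axes is, near the origin, close to a diagonal linear map. -/
theorem exists_diagonal_bounds (hΦ : IsGermDiffeo Φ)
    (hy : ∀ᶠ x in 𝓝 (0 : ℂ), (Φ (x, 0)).2 = 0) (hx : ∀ᶠ y in 𝓝 (0 : ℂ), (Φ (0, y)).1 = 0) :
    ∃ α : ℂ, α ≠ 0 ∧ ∃ c > 0, ∀ᶠ p in 𝓝 (0 : ℂ × ℂ),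
      ‖(Φ p).1 - α * p.1‖ ≤ ‖α‖ / 2 * ‖p.1‖ ∧ ‖p.2‖ ≤ c * ‖(Φ p).2‖ := by
  have h1 : AnalyticAt ℂ (fun p => (Φ p).1) 0 :=
    AnalyticAt.comp (g := Prod.fst) (f := Φ) analyticAt_fst hΦ.1
  have h2 : AnalyticAt ℂ (fun p => (Φ p).2) 0 :=
    AnalyticAt.comp (g := Prod.snd) (f := Φ) analyticAt_snd hΦ.1
  have hΦd : HasFDerivAt Φ (fderiv ℂ Φ 0) ((0 : ℂ), (0 : ℂ)) := hΦ.1.differentiableAt.hasFDerivAt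
  have hd1 : ∀ v, fderiv ℂ (fun p => (Φ p).1) 0 v = (fderiv ℂ Φ 0 v).1 := fun v => by
    have := (ContinuousLinearMap.fst ℂ ℂ ℂ).hasFDerivAt.comp (0 : ℂ × ℂ) hΦd
    have h3 : HasFDerivAt (fun p => (Φ p).1) _ 0 := this
    rw [h3.fderiv]; rfl
  have hd2 : ∀ v, fderiv ℂ (fun p => (Φ p).2) 0 v = (fderiv ℂ Φ 0 v).2 := fun v => by
    have := (ContinuousLinearMap.snd ℂ ℂ ℂ).hasFDerivAt.comp (0 : ℂ × ℂ) hΦd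
    have h3 : HasFDerivAt (fun p => (Φ p).2) _ 0 := this
    rw [h3.fderiv]; rfl
  have hcx : HasDerivAt (fun x : ℂ => (x, (0 : ℂ))) ((1 : ℂ), (0 : ℂ)) 0 :=
    (hasDerivAt_id (0 : ℂ)).prodMk (hasDerivAt_const _ _)
  have hcy : HasDerivAt (fun y : ℂ => ((0 : ℂ), y)) ((0 : ℂ), (1 : ℂ)) 0 :=
    (hasDerivAt_const _ _).prodMk (hasDerivAt_id (0 : ℂ))
  have hoff1 : (fderiv ℂ Φ 0 (1, 0)).2 = 0 :=
    ((ContinuousLinearMap.snd ℂ ℂ ℂ).hasFDerivAt.comp_hasDerivAt (0 : ℂ)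
      (HasFDerivAt.comp_hasDerivAt (f := fun x : ℂ => (x, (0 : ℂ))) (0 : ℂ) hΦd hcx)).unique
      ((hasDerivAt_const (0 : ℂ) (0 : ℂ)).congr_of_eventuallyEq hy)
  have hoff2 : (fderiv ℂ Φ 0 (0, 1)).1 = 0 :=
    ((ContinuousLinearMap.fst ℂ ℂ ℂ).hasFDerivAt.comp_hasDerivAt (0 : ℂ)
      (HasFDerivAt.comp_hasDerivAt (f := fun y : ℂ => ((0 : ℂ), y)) (0 : ℂ) hΦd hcy)).unique
      ((hasDerivAt_const (0 : ℂ) (0 : ℂ)).congr_of_eventuallyEq hx)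
  have hα : (fderiv ℂ Φ 0 (1, 0)).1 ≠ 0 := fun h0 => by
    have := hΦ.fderiv_eq_zero (Prod.ext h0 hoff1)
    simp at this
  have hβ : (fderiv ℂ Φ 0 (0, 1)).2 ≠ 0 := fun h0 => by
    have := hΦ.fderiv_eq_zero (Prod.ext hoff2 h0)
    simp at this
  refine ⟨(fderiv ℂ Φ 0 (1, 0)).1, hα, 2 / ‖(fderiv ℂ Φ 0 (0, 1)).2‖,
    by have := norm_pos_iff.2 hβ; positivity, ?_⟩
  have hαn := norm_pos_iff.2 hα
  have hβn := norm_pos_iff.2 hβ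
  filter_upwards [h1.eventually_norm_sub_mul_fst_le hx (half_pos hαn),
    h2.eventually_norm_sub_mul_snd_le hy (half_pos hβn)] with p hp1 hp2
  rw [hd1] at hp1
  rw [hd2] at hp2
  refine ⟨hp1, ?_⟩
  set β := (fderiv ℂ Φ 0 (0, 1)).2
  have h3 : ‖β‖ * ‖p.2‖ ≤ ‖(Φ p).2‖ + ‖(Φ p).2 - β * p.2‖ := by
    rw [← norm_mul]
    have := norm_sub_norm_le (β * p.2) (Φ p).2
    rw [norm_sub_rev] at this
    linarith
  rw [div_mul_eq_mul_div, le_div_iff₀ hβn]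
  linarith

/-- The label of the image of a leaf is constant along the leaf; this defines a germ of
diffeomorphism, which conjugates the holonomies by equivariance under `s ↦ s + 2πi`. -/
theorem germConjugate_of_isGermDiffeo {μ r₁ r₂ : ℝ}
    (hr₁ : F₁.AdmissibleRadius r₁) (hr₂ : F₂.AdmissibleRadius r₂) (hl₁ : l₁ ≠ 0) (hl₂ : l₂ ≠ 0)
    (hμl : l₂ / l₁ = μ) (hμ : μ < 0) (hΦ : IsGermDiffeo Φ) (hu : AnalyticAt ℂ u 0) (hu1 : u 0 = 1)
    (hconj : ∀ᶠ p in 𝓝 (0 : ℂ × ℂ), fderiv ℂ Φ p (F₁.field p) = u p • F₂.field (Φ p)) :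
    GermConjugate (F₁.holonomy r₁) (F₂.holonomy r₂) := by
  have hpi := Real.pi_pos
  have hpi' := Real.pi_lt_d2
  have hr₁0 := hr₁.1
  have hr₂0 := hr₂.1
  have hr₁' : (r₁ : ℂ) ≠ 0 := Complex.ofReal_ne_zero.2 hr₁0.ne'
  have hr₂' : (r₂ : ℂ) ≠ 0 := Complex.ofReal_ne_zero.2 hr₂0.ne'
  have hμl' : l₂ = μ * l₁ := by rw [← hμl]; field_simp
  -- a lift of the conjugacy moves `Im s` by at most `3π / 2 < 5`, and `2π + 5 < 12`
  have hB : 2 * Real.pi < 12 := by linarith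
  obtain ⟨ε₁, K₁, L₁, I₁, U₁⟩ := F₁.exists_isUniformization hr₁ hl₁ hμl hμ hB
  obtain ⟨ε₂, K₂, L₂, I₂, U₂⟩ := F₂.exists_isUniformization hr₂ hl₁ hμl hμ hB
  have hK₁ := U₁.K_pos
  have hK₂ := U₂.K_pos
  have hε₁ := U₁.ε_pos
  have hε₂ := U₂.ε_pos
  have haxis := eventually_snd_eq_zero hl₁ hμl hμ hΦ hu hu1 hconj
  obtain ⟨α, hα, c, hc, hαc⟩ := exists_diagonal_bounds hΦ haxis
    (eventually_fst_eq_zero hl₂ hμl hμ hΦ hu hu1 hconj)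
  have hαn := norm_pos_iff.2 hα
  have hΦc : Tendsto Φ (𝓝 0) (𝓝 0) := by
    have := hΦ.1.continuousAt.tendsto
    rwa [hΦ.2.1] at this
  have hsmall : ∀ᶠ p in 𝓝 (0 : ℂ × ℂ), ‖Φ p‖ < min r₂ ε₂ := by
    have := (hΦc.norm).eventually (gt_mem_nhds (show ‖(0 : ℂ × ℂ)‖ < min r₂ ε₂ by
      rw [norm_zero]; positivity))
    exact this
  obtain ⟨τ, hτ, hall⟩ := Metric.eventually_nhds_iff.1
    ((((hΦ.1.eventually_analyticAt.and hconj).and (hαc.and hsmall)).and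
      (F₁.isOpen_regularSet.mem_nhds F₁.zero_mem_regularSet)).and
      ((hΦc.eventually (F₂.isOpen_regularSet.mem_nhds F₂.zero_mem_regularSet)).and
        ((continuous_fst.tendsto (0 : ℂ × ℂ)).eventually haxis)))
  replace hall : ∀ p : ℂ × ℂ, ‖p.1‖ < τ → ‖p.2‖ < τ → _ := fun p h1 h2 =>
    hall (y := p) (by rw [dist_zero_right, Prod.norm_def]; exact max_lt h1 h2)
  -- a base point on the positive half of the axis, close to the origin
  obtain ⟨s₀, hs₀0, hs₀τ⟩ : ∃ s₀ : ℝ, s₀ < 0 ∧ r₁ * Real.exp s₀ < τ := by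
    refine ⟨min (-1) (Real.log (τ / r₁) - 1), by
      exact (min_le_left _ _).trans_lt (by norm_num), ?_⟩
    have : Real.exp (min (-1) (Real.log (τ / r₁) - 1)) < τ / r₁ := by
      rw [← Real.lt_log_iff_exp_lt (by positivity)]
      exact (min_le_right _ _).trans_lt (by linarith)
    rwa [lt_div_iff₀ hr₁0, mul_comm] at this
  set x₀ := r₁ * Real.exp s₀ with hx₀
  have hx₀0 : 0 < x₀ := by positivity
  have hxn : ∀ s : ℂ, s.re = s₀ → ‖(r₁ : ℂ) * Complex.exp s‖ = x₀ := fun s hs => by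
    rw [norm_mul, Complex.norm_exp, hs, Complex.norm_real, Real.norm_eq_abs, abs_of_pos hr₁0]
  have hx0 : ∀ s : ℂ, (r₁ : ℂ) * Complex.exp s ≠ 0 := fun s =>
    mul_ne_zero hr₁' (Complex.exp_ne_zero s)
  -- the lift of the conjugacy to the logarithmic coordinates
  let X : ℂ × ℂ → ℂ × ℂ := fun q => (r₁ * Complex.exp q.1, q.2)
  let T : ℂ × ℂ → ℂ := fun q =>
    q.1 + Complex.log (α * r₁ / r₂) + Complex.log ((Φ (X q)).1 / (α * (r₁ * Complex.exp q.1)))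
  let N : ℂ × ℂ → ℂ × ℂ := fun q => (T q, (Φ (X q)).2)
  have hX : ∀ q : ℂ × ℂ, q.1.re = s₀ → ‖q.2‖ < τ → _ := fun q hq hq2 =>
    hall (X q) (by rw [show (X q).1 = r₁ * Complex.exp q.1 from rfl, hxn _ hq]; exact hs₀τ) hq2
  have hre : ∀ q : ℂ × ℂ, q.1.re = s₀ → ‖q.2‖ < τ →
      0 < ((Φ (X q)).1 / (α * (r₁ * Complex.exp q.1))).re := fun q hq hq2 =>
    re_div_pos_of_norm_sub_le hα (hx0 _) (hX q hq hq2).1.1.2.1.1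
  have hΦne : ∀ q : ℂ × ℂ, q.1.re = s₀ → ‖q.2‖ < τ → (Φ (X q)).1 ≠ 0 := by
    intro q hq hq2 h0
    have := hre q hq hq2
    rw [h0, zero_div] at this
    exact lt_irrefl _ this
  have hconst : α * r₁ / r₂ ≠ 0 := div_ne_zero (mul_ne_zero hα hr₁') hr₂'
  have hexpT : ∀ q : ℂ × ℂ, q.1.re = s₀ → ‖q.2‖ < τ →
      r₂ * Complex.exp (T q) = (Φ (X q)).1 := by
    intro q hq hq2
    have h1 := hΦne q hq hq2
    have h2 := Complex.exp_ne_zero q.1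
    simp only [T]
    rw [Complex.exp_add, Complex.exp_add, Complex.exp_log hconst, Complex.exp_log
      (div_ne_zero h1 (mul_ne_zero hα (hx0 _)))]
    field_simp
  have hTre : ∀ q : ℂ × ℂ, q.1.re = s₀ → ‖q.2‖ < τ →
      r₂ * Real.exp (T q).re = ‖(Φ (X q)).1‖ := by
    intro q hq hq2
    rw [← hexpT q hq hq2, norm_mul, Complex.norm_exp, Complex.norm_real, Real.norm_eq_abs,
      abs_of_pos hr₂0]
  have hTneg : ∀ q : ℂ × ℂ, q.1.re = s₀ → ‖q.2‖ < τ → (T q).re < 0 := by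
    intro q hq hq2
    have h1 := hTre q hq hq2
    have h2 : ‖(Φ (X q)).1‖ < r₂ :=
      (norm_fst_le _).trans_lt ((hX q hq hq2).1.1.2.2.trans_le (min_le_left _ _))
    rw [← h1] at h2
    exact Real.exp_lt_one_iff.1 (by nlinarith)
  have hTim : ∀ q : ℂ × ℂ, q.1.re = s₀ → ‖q.2‖ < τ →
      q.1.im - 5 ≤ (T q).im ∧ (T q).im ≤ q.1.im + 5 := by
    intro q hq hq2
    have h1 := hre q hq hq2
    have h2 : |Complex.arg ((Φ (X q)).1 / (α * (r₁ * Complex.exp q.1)))| < Real.pi / 2 :=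
      Complex.abs_arg_lt_pi_div_two_iff.2 (Or.inl h1)
    have h3 := Complex.neg_pi_lt_arg (α * r₁ / r₂)
    have h4 := Complex.arg_le_pi (α * r₁ / r₂)
    have h5 : (T q).im = q.1.im + Complex.arg (α * r₁ / r₂) +
        Complex.arg ((Φ (X q)).1 / (α * (r₁ * Complex.exp q.1))) := by
      simp only [T, Complex.add_im, Complex.log_im]
    rw [abs_lt] at h2
    rw [h5]
    constructor <;> linarith
  have hNmem : ∀ q : ℂ × ℂ, q.1.re = s₀ → ‖q.2‖ < τ → 0 ≤ q.1.im → q.1.im ≤ 2 * Real.pi →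
      N q ∈ labelDomain 12 ε₂ := by
    intro q hq hq2 h0 h1
    have h2 := hTim q hq hq2
    refine ⟨hTneg q hq hq2, ?_, ?_⟩
    · rw [abs_lt]
      constructor
      · show -12 < (T q).im
        linarith
      · show (T q).im < 12
        linarith
    · exact (norm_snd_le (Φ (X q))).trans_lt ((hX q hq hq2).1.1.2.2.trans_le (min_le_right _ _))
  have hXan : ∀ q : ℂ × ℂ, AnalyticAt ℂ X q := fun q =>
    (analyticAt_const.mul analyticAt_fst.cexp).prod analyticAt_snd
  have hNan : ∀ q : ℂ × ℂ, q.1.re = s₀ → ‖q.2‖ < τ → AnalyticAt ℂ N q := by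
    intro q hq hq2
    have hΦX : AnalyticAt ℂ (fun q => Φ (X q)) q :=
      AnalyticAt.comp (g := Φ) (f := X) (hX q hq hq2).1.1.1.1 (hXan q)
    have h1 : AnalyticAt ℂ (fun q => (Φ (X q)).1) q :=
      AnalyticAt.comp (g := Prod.fst) (f := fun q => Φ (X q)) analyticAt_fst hΦX
    have h2 : AnalyticAt ℂ (fun q => (Φ (X q)).2) q :=
      AnalyticAt.comp (g := Prod.snd) (f := fun q => Φ (X q)) analyticAt_snd hΦX
    refine AnalyticAt.prod ?_ h2
    refine (analyticAt_fst.add analyticAt_const).add (AnalyticAt.clog ?_ (Or.inl (hre q hq hq2)))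
    exact h1.div (analyticAt_const.mul (analyticAt_const.mul analyticAt_fst.cexp))
      (mul_ne_zero hα (hx0 _))
  -- the lift is equivariant
  have hNper : ∀ y : ℂ, N (s₀ + 2 * Real.pi * Complex.I, y) =
      (T (s₀, y) + 2 * Real.pi * Complex.I, (Φ (X (s₀, y))).2) := by
    intro y
    simp only [N, T, X, Complex.exp_add, Complex.exp_two_pi_mul_I, mul_one]
    congr 1
    ring
  -- labels `z` of the leaves used below
  set E := Real.exp (μ * s₀) with hE
  have hE0 : 0 < E := Real.exp_pos _
  set ρ := min (ε₁ / E) (τ / (K₁ * E)) with hρ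
  have hρ0 : 0 < ρ := by positivity
  have hρ1 : ∀ z : ℂ, ‖z‖ < ρ → ‖z‖ * E < ε₁ := fun z hz => by
    rw [← lt_div_iff₀ hE0]; exact hz.trans_le (min_le_left _ _)
  have hρ2 : ∀ z : ℂ, ‖z‖ < ρ → K₁ * (‖z‖ * E) < τ := fun z hz => by
    have := hz.trans_le (min_le_right (ε₁ / E) (τ / (K₁ * E)))
    rw [lt_div_iff₀ (by positivity)] at this
    linarith
  have hLdom : ∀ s z : ℂ, s.re = s₀ → ‖z‖ < ρ →
      ‖z‖ * Real.exp (μ * s.re) < ε₁ := fun s z hs hz => by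
    rw [hs]; exact hρ1 z hz
  have hLτ : ∀ s z : ℂ, s.re = s₀ → |s.im| < 12 → ‖z‖ < ρ → ‖L₁ (s, z)‖ < τ := by
    intro s z hs hi hz
    have := U₁.norm_L_le (s, z) (by rw [hs]; exact hs₀0) hi (hLdom s z hs hz)
    simp only [hs] at this
    exact this.trans_lt (hρ2 z hz)
  -- the label of the image of a leaf has zero derivative along the leaf
  have hderiv : ∀ s z : ℂ, s.re = s₀ → 0 ≤ s.im → s.im ≤ 2 * Real.pi → ‖z‖ < ρ →
      HasDerivAt (fun s => I₂ (N (s, L₁ (s, z)))) 0 s := by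
    intro s z hs h0 h1 hz
    have hi : |s.im| < 12 := by rw [abs_lt]; constructor <;> linarith
    have hyτ := hLτ s z hs hi hz
    have hLd := U₁.deriv_L (s, z) (by rw [hs]; exact hs₀0) hi (hLdom s z hs hz)
    set y := L₁ (s, z) with hy
    simp only at hLd
    obtain ⟨⟨⟨⟨hΦa, hconjp⟩, -⟩, hreg1⟩, hreg2, -⟩ := hX (s, y) hs hyτ
    set p := X (s, y) with hp
    have hp1 : p.1 = r₁ * Complex.exp s := rfl
    have hp2 : p.2 = y := rfl
    set κ := u p * (1 + F₂.f (Φ p)) / (1 + F₁.f p) with hκ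
    have hf1 : 1 + F₁.f p ≠ 0 := hreg1.2.2
    have hf2 : 1 + F₂.f (Φ p) ≠ 0 := hreg2.2.2
    have hcurve : HasDerivAt (fun s => X (s, L₁ (s, z))) (p.1, μ * y * F₁.slope p) s := by
      refine HasDerivAt.prodMk ?_ ?_
      · simpa [hp1] using (Complex.hasDerivAt_exp s).const_mul (r₁ : ℂ)
      · exact hLd
    -- the tangent to the leaf is proportional to the vector field, and `Φ` respects this
    have hdir : ((p.1, μ * y * F₁.slope p) : ℂ × ℂ) = (l₁ * (1 + F₁.f p))⁻¹ • F₁.field p := by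
      simp only [field, slope, hμl', Prod.smul_mk, smul_eq_mul, Prod.mk.injEq, hp2]
      constructor <;> field_simp
    have hΦdir : fderiv ℂ Φ p (p.1, μ * y * F₁.slope p) =
        κ • ((Φ p).1, μ * (Φ p).2 * F₂.slope (Φ p)) := by
      rw [hdir, map_smul, hconjp]
      simp only [field, slope, hμl', hκ, Prod.smul_mk, smul_eq_mul, Prod.mk.injEq]
      constructor <;> field_simp
    have hΦcurve : HasDerivAt (fun s => Φ (X (s, L₁ (s, z))))
        (κ • ((Φ p).1, μ * (Φ p).2 * F₂.slope (Φ p))) s := by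
      rw [← hΦdir]
      exact HasFDerivAt.comp_hasDerivAt (f := fun s => X (s, L₁ (s, z))) s
        hΦa.differentiableAt.hasFDerivAt hcurve
    have hΦ1 : HasDerivAt (fun s => (Φ (X (s, L₁ (s, z)))).1) (κ * (Φ p).1) s := by
      exact (ContinuousLinearMap.fst ℂ ℂ ℂ).hasFDerivAt.comp_hasDerivAt s hΦcurve
    have hΦ2 : HasDerivAt (fun s => (Φ (X (s, L₁ (s, z)))).2)
        (κ * (μ * (Φ p).2 * F₂.slope (Φ p))) s := by
      exact (ContinuousLinearMap.snd ℂ ℂ ℂ).hasFDerivAt.comp_hasDerivAt s hΦcurve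
    have hΦp1 : (Φ p).1 ≠ 0 := hΦne (s, y) hs hyτ
    have hT : HasDerivAt (fun s => T (s, L₁ (s, z))) κ s := by
      have hden : HasDerivAt (fun s : ℂ => α * (r₁ * Complex.exp s))
          (α * (r₁ * Complex.exp s)) s :=
        ((Complex.hasDerivAt_exp s).const_mul (r₁ : ℂ)).const_mul α
      have hlog := (hΦ1.fun_div hden (mul_ne_zero hα (hx0 s))).clog
        (Or.inl (hre (s, y) hs hyτ))
      have hsum := ((hasDerivAt_id s).add_const (Complex.log (α * r₁ / r₂))).add hlog
      refine hsum.congr_deriv ?_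
      rw [show Φ (X (s, L₁ (s, z))) = Φ p from rfl]
      have := Complex.exp_ne_zero s
      field_simp
      ring
    have hN : HasDerivAt (fun s => N (s, L₁ (s, z)))
        (κ • ((1 : ℂ), μ * (Φ p).2 * F₂.slope (Φ p))) s := by
      have := hT.prodMk hΦ2
      simpa using this
    have hNm := hNmem (s, y) hs hyτ h0 h1
    have hI : HasFDerivAt I₂ (fderiv ℂ I₂ (N (s, y))) (N (s, L₁ (s, z))) :=
      (U₂.analytic_I _ hNm).differentiableAt.hasFDerivAt
    have hcomp := HasFDerivAt.comp_hasDerivAt (f := fun s => N (s, L₁ (s, z))) s hI hN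
    have hpde := U₂.fderiv_I _ hNm
    have hN1 : r₂ * Complex.exp (N (s, y)).1 = (Φ p).1 := hexpT (s, y) hs hyτ
    have hN2 : (N (s, y)).2 = (Φ p).2 := rfl
    rw [hN1, hN2] at hpde
    -- the curve is tangent to a leaf of the second foliation, along which `I₂` is constant
    have hzero : fderiv ℂ I₂ (N (s, y)) (κ • ((1 : ℂ), μ * (Φ p).2 * F₂.slope (Φ p))) = 0 := by
      rw [map_smul, show F₂.slope (Φ p) = F₂.slope ((Φ p).1, (Φ p).2) from rfl, hpde, smul_zero]
    rw [hzero] at hcomp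
    exact hcomp
  have hs₀re : ((s₀ : ℂ)).re = s₀ := Complex.ofReal_re s₀
  have hs₀im : ((s₀ : ℂ)).im = 0 := Complex.ofReal_im s₀
  have hends : ∀ z : ℂ, ‖z‖ < ρ →
      I₂ (N (s₀ + 2 * Real.pi * Complex.I, L₁ (s₀ + 2 * Real.pi * Complex.I, z))) =
        I₂ (N (s₀, L₁ (s₀, z))) := by
    intro z hz
    have hθ : ∀ θ ∈ Icc (0 : ℝ) (2 * Real.pi), HasDerivAt
        (fun θ : ℝ => I₂ (N (s₀ + θ * Complex.I, L₁ (s₀ + θ * Complex.I, z)))) 0 θ := by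
      intro θ hθ
      have h1 : HasDerivAt (fun θ : ℝ => (s₀ : ℂ) + θ * Complex.I) Complex.I θ := by
        simpa using ((Complex.ofRealCLM.hasDerivAt (x := θ)).mul_const Complex.I).const_add (s₀ : ℂ)
      have h2 := (hderiv (s₀ + θ * Complex.I) z (by simp) (by simpa using hθ.1)
        (by simpa using hθ.2) hz).comp θ h1
      rw [zero_mul] at h2
      exact h2
    have h3 := constant_of_has_deriv_right_zero
      (fun θ hθ' => (hθ θ hθ').continuousAt.continuousWithinAt)
      (fun θ hθ' => (hθ θ (Ico_subset_Icc_self hθ')).hasDerivWithinAt)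
      (2 * Real.pi) ⟨by positivity, le_rfl⟩
    simpa using h3
  -- `L₁` and `I₂` transport along the two foliations between `Re s = 0` and the base point
  let ψ : ℂ → ℂ := fun z => I₂ (N (s₀, L₁ (s₀, z)))
  have hψb : ∀ z : ℂ, ‖z‖ < ρ → ‖L₁ (s₀, z)‖ < τ ∧ N (s₀, L₁ (s₀, z)) ∈ labelDomain 12 ε₂ := by
    intro z hz
    have h1 := hLτ s₀ z hs₀re (by rw [hs₀im]; norm_num) hz
    exact ⟨h1, hNmem _ hs₀re h1 (by rw [hs₀im]) (by rw [hs₀im]; positivity)⟩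
  have hψan : AnalyticAt ℂ ψ 0 := by
    have h0 : ‖(0 : ℂ)‖ < ρ := by simpa using hρ0
    have hL : AnalyticAt ℂ (fun z => L₁ (s₀, z)) 0 :=
      AnalyticAt.comp (g := L₁) (f := fun z => ((s₀ : ℂ), z))
        (U₁.analytic_L ((s₀ : ℂ), 0) (by rw [hs₀re]; exact hs₀0) (by rw [hs₀im]; norm_num)
          (hLdom _ _ hs₀re h0)) (analyticAt_const.prod analyticAt_id)
    have hNL : AnalyticAt ℂ (fun z => N (s₀, L₁ (s₀, z))) 0 :=
      AnalyticAt.comp (g := N) (f := fun z => ((s₀ : ℂ), L₁ (s₀, z)))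
        (hNan _ hs₀re (hψb 0 h0).1) (analyticAt_const.prod hL)
    exact AnalyticAt.comp (g := I₂) (f := fun z => N (s₀, L₁ (s₀, z)))
      (U₂.analytic_I _ (hψb 0 h0).2) hNL
  -- lower bound for the norm of `ψ`
  have hlow : ∀ z : ℂ, ‖z‖ < ρ →
      ‖z‖ ≤ (K₁ * c * K₂ * Real.exp (μ * Real.log (‖α‖ / 2 * x₀ / r₂)) / E) * ‖ψ z‖ := by
    intro z hz
    obtain ⟨h1, h2⟩ := hψb z hz
    have h3 : ‖z‖ * E ≤ K₁ * ‖L₁ (s₀, z)‖ := by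
      have := U₁.le_norm_L ((s₀ : ℂ), z) (by rw [hs₀re]; exact hs₀0) (by rw [hs₀im]; norm_num)
        (hLdom _ _ hs₀re hz)
      simpa using this
    obtain ⟨⟨⟨⟨-, -⟩, ⟨h4, h5⟩, -⟩, -⟩, -⟩ := hX ((s₀ : ℂ), L₁ (s₀, z)) hs₀re h1
    have h6 := U₂.le_norm_I _ h2
    have h7 : Real.log (‖α‖ / 2 * x₀ / r₂) ≤ (T (s₀, L₁ (s₀, z))).re := by
      rw [Real.log_le_iff_le_exp (by positivity), div_le_iff₀ hr₂0, mul_comm (Real.exp _),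
        hTre _ hs₀re h1]
      have h8 : ‖(X (s₀, L₁ (s₀, z))).1‖ = x₀ := hxn _ hs₀re
      have h9 := norm_sub_norm_le (α * (X (s₀, L₁ (s₀, z))).1) (Φ (X (s₀, L₁ (s₀, z)))).1
      rw [norm_sub_rev, norm_mul, h8] at h9
      rw [h8] at h4
      linarith
    have h8 : Real.exp (μ * (T (s₀, L₁ (s₀, z))).re) ≤
        Real.exp (μ * Real.log (‖α‖ / 2 * x₀ / r₂)) :=
      Real.exp_le_exp.2 (mul_le_mul_of_nonpos_left h7 hμ.le)
    rw [div_mul_eq_mul_div, le_div_iff₀ hE0]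
    calc ‖z‖ * E ≤ K₁ * (c * (K₂ * (‖ψ z‖ * Real.exp (μ * (T (s₀, L₁ (s₀, z))).re)))) :=
          h3.trans (by gcongr; exact h5.trans (by gcongr))
      _ ≤ K₁ * (c * (K₂ * (‖ψ z‖ * Real.exp (μ * Real.log (‖α‖ / 2 * x₀ / r₂))))) := by gcongr
      _ = _ := by ring
  have hψ0 : ψ 0 = 0 := by
    have h0 : ‖(0 : ℂ)‖ < ρ := by simpa using hρ0
    obtain ⟨h1, h2⟩ := hψb 0 h0
    have h3 : L₁ ((s₀ : ℂ), 0) = 0 := by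
      have := U₁.norm_L_le ((s₀ : ℂ), 0) (by rw [hs₀re]; exact hs₀0) (by rw [hs₀im]; norm_num)
        (hLdom _ _ hs₀re h0)
      simpa using this
    have h4 : (N (s₀, L₁ (s₀, 0))).2 = 0 := by
      rw [h3] at h1 ⊢
      exact (hX (s₀, 0) hs₀re h1).2.2
    have h5 := U₂.norm_I_le _ h2
    rw [h4, norm_zero, mul_zero] at h5
    exact norm_le_zero_iff.1 (nonpos_of_mul_nonpos_left h5 (Real.exp_pos _))
  refine ⟨ψ, isGermDiffeo_of_norm_le hψan hψ0 (mem_of_superset (ball_mem_nhds (0 : ℂ) hρ0)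
    fun z hz => hlow z (by simpa using hz)), ?_⟩
  · filter_upwards [ball_mem_nhds (0 : ℂ) hρ0] with z hz
    have hz' : ‖z‖ < ρ := by simpa using hz
    have hdeck := U₁.L_add_two_pi s₀ z (by rw [hs₀re]; exact hs₀0) (by rw [hs₀im]; norm_num)
      (by rw [hs₀im, zero_add, abs_of_pos (by positivity)]; exact hB) (hLdom _ _ hs₀re hz')
    have hre2 : ((s₀ : ℂ) + 2 * Real.pi * Complex.I).re = s₀ := by simp
    have him2 : ((s₀ : ℂ) + 2 * Real.pi * Complex.I).im = 2 * Real.pi := by simp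
    have hy'τ := hLτ _ z hre2 (by rw [him2, abs_of_pos (by positivity)]; exact hB) hz'
    have hend := hends z hz'
    rw [hdeck] at hend hy'τ
    set y' := L₁ (s₀, F₁.holonomy r₁ z) with hy'
    have hm := hNmem ((s₀ : ℂ), y') hs₀re hy'τ (by rw [hs₀im]) (by rw [hs₀im]; positivity)
    have hm2 := hNmem ((s₀ : ℂ) + 2 * Real.pi * Complex.I, y') hre2 hy'τ
      (by rw [him2]; positivity) (by rw [him2])
    rw [hNper y'] at hend hm2
    have him3 : (T (s₀, y') + 2 * Real.pi * Complex.I).im = (T (s₀, y')).im + 2 * Real.pi := by simp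
    have hfin := U₂.I_add_two_pi (T (s₀, y')) (Φ (X (s₀, y'))).2 hm.1 hm.2.1
      (by rw [← him3]; exact hm2.2.1) hm.2.2
    show I₂ (N (s₀, y')) = F₂.holonomy r₂ (I₂ (N (s₀, L₁ (s₀, z))))
    rw [← hend, ← hfin]

end SiegelFoliation

end

theorem mainTheorem2 (l₁ l₂ : ℂ) (hl : ∃ t : ℝ, t < 0 ∧ l₁ / l₂ = (t : ℂ))
    (F₁ F₂ : SiegelFoliation l₁ l₂) (r₁ r₂ : ℝ)
    (hr₁ : F₁.AdmissibleRadius r₁) (hr₂ : F₂.AdmissibleRadius r₂) :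
    ((∃ φ : ℂ × ℂ → ℂ × ℂ, SiegelFoliation.IsConjugacy F₁ F₂ φ ∧
        ∀ᶠ x in 𝓝 (0 : ℂ), (φ (x, 0)).2 = 0) ↔
      GermConjugate (F₁.holonomy r₁) (F₂.holonomy r₂)) ∧
    (l₁ ≠ -l₂ →
      ((∃ φ : ℂ × ℂ → ℂ × ℂ, SiegelFoliation.IsConjugacy F₁ F₂ φ) ↔
        GermConjugate (F₁.holonomy r₁) (F₂.holonomy r₂))) := by
  obtain ⟨t, ht, hlt⟩ := hl
  have ht' : (t : ℂ) ≠ 0 := Complex.ofReal_ne_zero.2 ht.ne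
  have hl₁ : l₁ ≠ 0 := by
    rintro rfl
    rw [zero_div] at hlt
    exact ht' hlt.symm
  have hl₂ : l₂ ≠ 0 := by
    rintro rfl
    rw [div_zero] at hlt
    exact ht' hlt.symm
  have hμl : l₂ / l₁ = (t⁻¹ : ℝ) := by rw [Complex.ofReal_inv, ← hlt, inv_div]
  have hμ : t⁻¹ < 0 := inv_lt_zero.2 ht
  refine ⟨⟨?_, SiegelFoliation.exists_isConjugacy_of_germConjugate F₁ F₂ hr₁ hr₂ hl₁ hμl hμ⟩,
    fun hne => ⟨?_, fun h => ?_⟩⟩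
  · rintro ⟨Φ, ⟨hΦ, u, hu, -, hconj⟩, haxis⟩
    exact SiegelFoliation.germConjugate_of_isGermDiffeo hr₁ hr₂ hl₁ hl₂ hμl hμ hΦ hu
      (SiegelFoliation.unit_eq_one_of_axis hl₁ hΦ hu hconj haxis) hconj
  · rintro ⟨Φ, hΦ, u, hu, -, hconj⟩
    exact SiegelFoliation.germConjugate_of_isGermDiffeo hr₁ hr₂ hl₁ hl₂ hμl hμ hΦ hu
      (SiegelFoliation.unit_eq_one_of_ne hl₁ hl₂ hne hΦ hu hconj) hconj
  · obtain ⟨Φ, hΦ, -⟩ :=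
      SiegelFoliation.exists_isConjugacy_of_germConjugate F₁ F₂ hr₁ hr₂ hl₁ hμl hμ h
    exact ⟨Φ, hΦ⟩
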